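/- Let $\mathbb K=\mathbb C$ or $\mathbb R$, let $\lambda$ vary near $\lambda_0$ in a normed $\mathbb K$-vector space, and let $$f_\lambda(x_1,x_2)=(\mu_1(\lambda)x_1,\mu_2(\lambda)x_2)+\sum_{|k|\ge 2}a_k(\lambda)x^k ,\qquad a_k(\lambda)\in\mathbb K^2,$$ be a family of local diffeomorphisms of $(\mathbb K^2,0)$, with $\mu_1,\mu_2$ continuous at $\lambda_0$, such that for some $r>0$ and some neighbourhood $\Lambda$ of $\lambda_0$ one has $\sum_{k}\sup_{\lambda\in\Lambda}\|a_k(\lambda)\|\,r^{|k|}<\infty$. Call a family of functions of two variables that is, for all $\lambda$ in a neighbourhood of $\lambda_0$, given by power series whose coefficients satisfy such a bound an analytic family near $0$. Suppose that $0$ is a hyperbolic fixed point of $f_{\lambda_0}$, i.e. $\mu_i(\lambda_0)\neq0$ and $|\mu_i(\lambda_0)|\ne 1$ for $i=1,2$, and that $$R=-\frac{\log|\mu_1(\lambda_0)|}{\log|\mu_2(\lambda_0)|}$$ is positive and irrational. Let $R=[a_1\,a_2\,a_3\dots]$ be the continued fraction expansion of $R$ (so $a_1=\lfloor R\rfloor$),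 with convergents $q_n/p_n=[a_1\,a_2\dots a_n]$ in lowest terms, $n\ge1$. Let $k\ge 0$ be an integer and put $q=q_{2k+1}$, $p=p_{2k+1}$, $\tilde q=q_{2k+2}$, $\tilde p=p_{2k+2}$. Then there is an analytic family $h_\lambda$ of changes of variables near $0$ (with $h_\lambda(0)=0$ and with local inverses $h_\lambda^{-1}$ that also form an analytic family near $0$) such that, for all $\lambda$ near $\lambda_0$ and all $x$ in a neighbourhood of $0$ independent of $\lambda$, the map $g_\lambda=h_\lambda^{-1}\circ f_\lambda\circ h_\lambda$ has the form $$g_\lambda(x_1,x_2)=\Big(x_1\big[\mu_1(\lambda)+u\,b^1_1(u,\tilde u,\lambda)+\tilde u\,b^2_1(u,\tilde u,\lambda)\big],\;x_2\big[\mu_2(\lambda)+u\,b^1_2(u,\tilde u,\lambda)+\tilde u\,b^2_2(u,\tilde u,\lambda)\big]\Big),$$ where $u=x_1^{p}x_2^{q}$ and $\tilde u=x_1^{\tilde p}x_2^{\tilde q}$, and where moreover: (i) the functions $b^j_i(\cdot,\cdot,\lambda)$, $i,j\in\{1,2\}$, form analytic families near $(u,\tilde u)=(0,0)$; (ii) if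 $f_\lambda(x)$ is analytic in $(\lambda,x)$ near $(\lambda_0,0)$, then $h_\lambda(x)$, $h_\lambda^{-1}(x)$ and $g_\lambda(x)$ are analytic in $(\lambda,x)$ near $(\lambda_0,0)$, and the $b^j_i(u,\tilde u,\lambda)$ are analytic in $(u,\tilde u,\lambda)$ near $(0,0,\lambda_0)$. -/

import Mathlib

open Filter Topology

/-- The family `F lam : 𝕜² → W` is, for all parameters `lam` near `lam0` and on a common closed
polydisk `max (|x₁|, |x₂|) ≤ r`, the sum of the power series `∑ₖ x₁ ^ k₁ x₂ ^ k₂ cₖ(lam)`. The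
series converges absolutely there for the supremum norm (with respect to the parameter, over a
neighbourhood of `lam0`) of the coefficients. -/
def HasUniformExpansion {𝕜 E W : Type*} [RCLike 𝕜] [TopologicalSpace E]
    [NormedAddCommGroup W] [NormedSpace 𝕜 W]
    (c : ℕ × ℕ → E → W) (F : E → 𝕜 × 𝕜 → W) (lam0 : E) : Prop :=
  ∃ r : ℝ, 0 < r ∧ ∃ M : ℕ × ℕ → ℝ,
    Summable (fun k : ℕ × ℕ => M k * r ^ (k.1 + k.2)) ∧
    ∀ᶠ lam in 𝓝 lam0,
      (∀ k, ‖c k lam‖ ≤ M k) ∧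
      ∀ x : 𝕜 × 𝕜, ‖x‖ ≤ r →
        HasSum (fun k : ℕ × ℕ => (x.1 ^ k.1 * x.2 ^ k.2) • c k lam) (F lam x)

/-- `F` is a family of functions of two variables that are analytic near the origin, uniformly in
the parameter near `lam0`. -/
def IsAnalyticFamily {𝕜 E W : Type*} [RCLike 𝕜] [TopologicalSpace E]
    [NormedAddCommGroup W] [NormedSpace 𝕜 W]
    (F : E → 𝕜 × 𝕜 → W) (lam0 : E) : Prop :=
  ∃ c : ℕ × ℕ → E → W, HasUniformExpansion c F lam0

/-- The family
`f lam (x₁, x₂) = (μ₁(lam) x₁, μ₂(lam) x₂) + ∑_{|k| ≥ 2} aₖ(lam) x ^ k`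
of analytic germs of the plane that fix the origin and have a diagonal linear part. -/
def IsDiagonalFamily {𝕜 E : Type*} [RCLike 𝕜] [TopologicalSpace E]
    (f : E → 𝕜 × 𝕜 → 𝕜 × 𝕜) (μ₁ μ₂ : E → 𝕜) (lam0 : E) : Prop :=
  ∃ a : ℕ × ℕ → E → 𝕜 × 𝕜, HasUniformExpansion a f lam0 ∧
    ∀ᶠ lam in 𝓝 lam0,
      a (0, 0) lam = 0 ∧ a (1, 0) lam = (μ₁ lam, 0) ∧ a (0, 1) lam = (0, μ₂ lam)

/-- `h` is a family of analytic changes of variables near the origin, fixing the origin, and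
`hinv` is the family of their local inverses. -/
def IsAnalyticChange {𝕜 E : Type*} [RCLike 𝕜] [TopologicalSpace E]
    (h hinv : E → 𝕜 × 𝕜 → 𝕜 × 𝕜) (lam0 : E) : Prop :=
  IsAnalyticFamily h lam0 ∧ IsAnalyticFamily hinv lam0 ∧
  (∀ᶠ lam in 𝓝 lam0, h lam 0 = 0 ∧ hinv lam 0 = 0) ∧
  ∀ᶠ z : E × (𝕜 × 𝕜) in 𝓝 (lam0, 0),
    hinv z.1 (h z.1 z.2) = z.2 ∧ h z.1 (hinv z.1 z.2) = z.2

/-- The family `F` is analytic jointly in the parameter and the variables at `(lam0, 0)`. -/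
def DependsAnalytically {𝕜 E W : Type*} [RCLike 𝕜] [NormedAddCommGroup E] [NormedSpace 𝕜 E]
    [NormedAddCommGroup W] [NormedSpace 𝕜 W]
    (F : E → 𝕜 × 𝕜 → W) (lam0 : E) : Prop :=
  AnalyticAt 𝕜 (fun z : E × (𝕜 × 𝕜) => F z.1 z.2) (lam0, 0)

/-! ### The algebra of absolutely convergent power series in two variables -/

/-! Consider the exponents `k` that occur in the component `i`. Consecutive convergents satisfy `p
q' - q p' = 1`. Hence the cone given by `-q k₁ + p k₂ ≥ 0` and `q' k₁ - p' k₂ ≥ 0` has `(p, q)`,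
`(p', q')` as a basis: its lattice points are their combinations with coefficients in `ℕ`. If `k -
eᵢ` lies in this cone, then `xᵏ = xᵢ uᵐ u'ⁿ`, and `|k| ≥ 2` excludes `m = n = 0`. It therefore
suffices to conjugate `f` to a map with only such exponents (`TameFamily.exists_coneForm`).

The two convergents lie on different sides of `R`. If `|μ₁| < 1 < |μ₂|`, then `log |μ₁ᵖ μ₂^q| = (q -
R p) log |μ₂| < 0`. The exponents that violate the first inequality then satisfy `|μᵏ| ≤ η |μᵢ|`
with a fixed `η < 1`, so there are no small divisors (`spectralGap_lower`). Those that violate the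
second are contracted in the same way by `f⁻¹` (`spectralGap_upper`). If `|μ₂| < 1 < |μ₁|`, the
roles are exchanged. One conjugation of `f` and one of an inverse achieve both inequalities
(`TameFamily.exists_normalForm`). The second does not spoil the first, because the inequalities are
inherited by compositions and inverses.

A single conjugation (`WienerAlgebra.exists_conjugacy`) solves `f ∘ h = h ∘ g` by the analytic
implicit function theorem in the `ℓ¹` algebra of coefficients. The unwanted exponents go into `h -
id`, the others into `g - μ`. The linearization is diagonal, with entries `μᵢ - μᵏ` or `±1`. The
obstacle is that `g` expands one coordinate, so `h ∘ g` is not defined on a fixed polydisk for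
general `h`. But for some `sⱼ > |μⱼ|` the powers `sᵏ` stay bounded on the unwanted exponents, so the
coefficients can be multiplied by `sᵏ` and evaluated at `s⁻¹ g`.

The parameter enters only through the eigenvalues and the coefficients, which are small after a
change of scale. The solution is an analytic function of these two data near `(μ(lam0), 0)`. This
gives bounds uniform in `lam` without continuity of the coefficients, and analytic dependence by
composition whenever the coefficients are analytic; the proposition `P` carries both versions at
once. -/

/-- Absolutely summable families of coefficients `aₖ`, `k ∈ ℕ × ℕ`. -/
def WienerAlgebra (𝕜 : Type*) [RCLike 𝕜] : Type _ := lp (fun _ : ℕ × ℕ => 𝕜) 1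

namespace WienerAlgebra

variable {𝕜 : Type*} [RCLike 𝕜]
  {X : Type*} [NormedAddCommGroup X] [NormedSpace 𝕜 X] [CompleteSpace X]
  {Y : Type*} [NormedAddCommGroup Y] [NormedSpace 𝕜 Y] [CompleteSpace Y]

noncomputable instance : NormedAddCommGroup (WienerAlgebra 𝕜) :=
  inferInstanceAs (NormedAddCommGroup (lp (fun _ : ℕ × ℕ => 𝕜) 1))

noncomputable instance : NormedSpace 𝕜 (WienerAlgebra 𝕜) :=
  inferInstanceAs (NormedSpace 𝕜 (lp (fun _ : ℕ × ℕ => 𝕜) 1))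

instance : CompleteSpace (WienerAlgebra 𝕜) :=
  inferInstanceAs (CompleteSpace (lp (fun _ : ℕ × ℕ => 𝕜) 1))

instance : FunLike (WienerAlgebra 𝕜) (ℕ × ℕ) 𝕜 := ⟨fun a => a.1, Subtype.val_injective⟩

@[simp] theorem add_apply (a b : WienerAlgebra 𝕜) (k : ℕ × ℕ) : (a + b) k = a k + b k := rfl

@[simp] theorem sub_apply (a b : WienerAlgebra 𝕜) (k : ℕ × ℕ) : (a - b) k = a k - b k := rfl

@[simp] theorem smul_apply (c : 𝕜) (a : WienerAlgebra 𝕜) (k : ℕ × ℕ) : (c • a) k = c • a k := rfl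

@[simp] theorem zero_apply (k : ℕ × ℕ) : (0 : WienerAlgebra 𝕜) k = 0 := rfl

theorem summable_norm (a : WienerAlgebra 𝕜) : Summable fun k => ‖a k‖ := by
  have h := (lp.memℓp (p := 1) (E := fun _ : ℕ × ℕ => 𝕜) a).summable (by simp)
  simp only [ENNReal.toReal_one, Real.rpow_one] at h
  exact h

theorem norm_eq_tsum (a : WienerAlgebra 𝕜) : ‖a‖ = ∑' k, ‖a k‖ := by
  refine (lp.norm_eq_tsum_rpow (by simp) (E := fun _ : ℕ × ℕ => 𝕜) (p := 1) a).trans ?_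
  simp only [ENNReal.toReal_one, Real.rpow_one, div_one]
  rfl

/-- The element with given absolutely summable coefficients. -/
def ofSummable (a : ℕ × ℕ → 𝕜) (ha : Summable fun k => ‖a k‖) : WienerAlgebra 𝕜 :=
  ⟨a, memℓp_gen (by simpa using ha)⟩

@[simp] theorem ofSummable_apply (a : ℕ × ℕ → 𝕜) (ha : Summable fun k => ‖a k‖) (k : ℕ × ℕ) :
    ofSummable a ha k = a k := rfl

/-- The monomial with exponent `k`. -/
noncomputable def monomial (𝕜 : Type*) [RCLike 𝕜] (k : ℕ × ℕ) : WienerAlgebra 𝕜 :=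
  lp.single (E := fun _ : ℕ × ℕ => 𝕜) 1 k (1 : 𝕜)

theorem norm_monomial (k : ℕ × ℕ) : ‖monomial 𝕜 k‖ = 1 :=
  (lp.norm_single (E := fun _ : ℕ × ℕ => 𝕜) (p := 1) (by simp) k 1).trans norm_one

theorem monomial_apply (k l : ℕ × ℕ) : monomial 𝕜 k l = if l = k then 1 else 0 :=
  (lp.single_apply (E := fun _ : ℕ × ℕ => 𝕜) 1 k 1 l).trans (by simp [Pi.single_apply])

theorem hasSum_monomial (a : WienerAlgebra 𝕜) : HasSum (fun k => a k • monomial 𝕜 k) a := by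
  refine (lp.hasSum_single (E := fun _ : ℕ × ℕ => 𝕜) (p := 1) (by simp) a).congr_fun ?_
  intro k
  refine (lp.single_smul (E := fun _ : ℕ × ℕ => 𝕜) 1 k (a k) (1 : 𝕜)).symm.trans ?_
  rw [smul_eq_mul, mul_one]
  rfl

/-! ### Linear maps determined by their values on monomials -/

theorem summable_smul (a : WienerAlgebra 𝕜) {w : ℕ × ℕ → X} {C : ℝ} (hw : ∀ k, ‖w k‖ ≤ C) :
    Summable fun k => a k • w k := by
  refine Summable.of_norm_bounded (a.summable_norm.mul_right C) fun k => ?_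
  rw [norm_smul]
  exact mul_le_mul_of_nonneg_left (hw k) (norm_nonneg _)

open Classical in
/-- The continuous linear map that sends the monomials to the bounded family `w`. -/
noncomputable def lift (w : ℕ × ℕ → X) : WienerAlgebra 𝕜 →L[𝕜] X :=
  if h : ∃ C, ∀ k, ‖w k‖ ≤ C then
    LinearMap.mkContinuous
      { toFun := fun a => ∑' k, a k • w k
        map_add' := fun a b => by
          obtain ⟨C, hC⟩ := h
          rw [← (summable_smul a hC).tsum_add (summable_smul b hC)]
          exact tsum_congr fun k => add_smul _ _ _
        map_smul' := fun c a => by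
          obtain ⟨C, hC⟩ := h
          rw [RingHom.id_apply, ← (summable_smul a hC).tsum_const_smul]
          exact tsum_congr fun k => by
            simp [mul_smul] }
      h.choose fun a => by
        rw [norm_eq_tsum, mul_comm, ← tsum_mul_right]
        refine tsum_of_norm_bounded ((a.summable_norm.mul_right _).hasSum) fun k => ?_
        rw [norm_smul]
        exact mul_le_mul_of_nonneg_left (h.choose_spec k) (norm_nonneg _)
  -- The value for unbounded families is arbitrary; it makes `aeval y` a total function of `y`.
  else 0

theorem lift_apply {w : ℕ × ℕ → X} {C : ℝ} (hw : ∀ k, ‖w k‖ ≤ C) (a : WienerAlgebra 𝕜) :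
    lift w a = ∑' k, a k • w k := by
  rw [lift, dif_pos ⟨C, hw⟩]; rfl

theorem hasSum_lift {w : ℕ × ℕ → X} {C : ℝ} (hw : ∀ k, ‖w k‖ ≤ C) (a : WienerAlgebra 𝕜) :
    HasSum (fun k => a k • w k) (lift w a) := by
  rw [lift_apply hw]
  exact (summable_smul a hw).hasSum

theorem lift_monomial {w : ℕ × ℕ → X} {C : ℝ} (hw : ∀ k, ‖w k‖ ≤ C) (k : ℕ × ℕ) :
    lift w (monomial 𝕜 k) = w k := by
  rw [lift_apply hw, tsum_eq_single k]
  · simp [monomial_apply]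
  · intro l hl
    simp [monomial_apply, hl]

theorem norm_lift_apply_le {w : ℕ × ℕ → X} {C : ℝ} (hw : ∀ k, ‖w k‖ ≤ C) (a : WienerAlgebra 𝕜) :
    ‖lift w a‖ ≤ C * ‖a‖ := by
  rw [lift_apply hw, norm_eq_tsum, mul_comm, ← tsum_mul_right]
  refine tsum_of_norm_bounded ((a.summable_norm.mul_right _).hasSum) fun k => ?_
  rw [norm_smul]
  exact mul_le_mul_of_nonneg_left (hw k) (norm_nonneg _)

theorem norm_lift_le {w : ℕ × ℕ → X} {C : ℝ} (hw : ∀ k, ‖w k‖ ≤ C) :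
    ‖(lift w : WienerAlgebra 𝕜 →L[𝕜] X)‖ ≤ C :=
  ContinuousLinearMap.opNorm_le_bound _ ((norm_nonneg _).trans (hw 0)) (norm_lift_apply_le hw)

/-- Continuous linear maps that agree on the monomials are equal. -/
theorem ext_monomial {Z : Type*} [AddCommMonoid Z] [Module 𝕜 Z] [TopologicalSpace Z] [T2Space Z]
    {φ ψ : WienerAlgebra 𝕜 →L[𝕜] Z} (h : ∀ k, φ (monomial 𝕜 k) = ψ (monomial 𝕜 k)) : φ = ψ := by
  refine ContinuousLinearMap.ext fun a => ((hasSum_monomial a).map φ φ.continuous).unique ?_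
  have hψ := (hasSum_monomial a).map ψ ψ.continuous
  have : (⇑φ ∘ fun k => a k • monomial 𝕜 k) = ⇑ψ ∘ fun k => a k • monomial 𝕜 k := by
    funext k
    simp [h]
  rwa [this]

theorem clm_apply_lift (φ : X →L[𝕜] Y) {w : ℕ × ℕ → X} {C : ℝ} (hw : ∀ k, ‖w k‖ ≤ C)
    (a : WienerAlgebra 𝕜) : φ (lift w a) = lift (fun k => φ (w k)) a := by
  have h : ∀ k, ‖φ (w k)‖ ≤ ‖φ‖ * C := fun k =>
    (φ.le_opNorm _).trans (mul_le_mul_of_nonneg_left (hw k) (norm_nonneg _))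
  rw [lift_apply hw, lift_apply h, φ.map_tsum (summable_smul a hw)]
  exact tsum_congr fun k => by simp

/-! ### Convolution and the ring structure -/

/-- Convolution, as a continuous bilinear map. -/
noncomputable def conv : WienerAlgebra 𝕜 →L[𝕜] WienerAlgebra 𝕜 →L[𝕜] WienerAlgebra 𝕜 :=
  lift fun k => lift fun l => monomial 𝕜 (k + l)

theorem conv_monomial_left (k : ℕ × ℕ) :
    conv (monomial 𝕜 k) = lift fun l => monomial 𝕜 (k + l) :=
  lift_monomial (C := 1) (fun _ => norm_lift_le fun _ => (norm_monomial _).le) k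

theorem conv_monomial (k l : ℕ × ℕ) :
    conv (monomial 𝕜 k) (monomial 𝕜 l) = monomial 𝕜 (k + l) := by
  rw [conv_monomial_left]
  exact lift_monomial (C := 1) (fun _ => (norm_monomial _).le) l

theorem norm_conv_le (a b : WienerAlgebra 𝕜) : ‖conv a b‖ ≤ ‖a‖ * ‖b‖ := by
  have h : ‖conv (𝕜 := 𝕜)‖ ≤ 1 :=
    norm_lift_le fun _ => norm_lift_le fun _ => (norm_monomial _).le
  calc ‖conv a b‖ ≤ ‖conv (𝕜 := 𝕜)‖ * ‖a‖ * ‖b‖ := ContinuousLinearMap.le_opNorm₂ _ _ _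
    _ ≤ 1 * ‖a‖ * ‖b‖ := by gcongr
    _ = ‖a‖ * ‖b‖ := by rw [one_mul]

theorem conv_comm (a b : WienerAlgebra 𝕜) : conv a b = conv b a := by
  have : (conv (𝕜 := 𝕜)) = conv.flip :=
    ext_monomial fun k => ext_monomial fun l => by
      rw [ContinuousLinearMap.flip_apply, conv_monomial, conv_monomial, add_comm]
  exact congrArg (fun φ => φ a b) this

/-- Both sides are continuous and linear in each argument, so monomials suffice; they are inserted
one argument at a time. -/
theorem conv_assoc (a b c : WienerAlgebra 𝕜) : conv (conv a b) c = conv a (conv b c) := by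
  have h₁ : ∀ k l, conv (conv (monomial 𝕜 k) (monomial 𝕜 l))
      = (conv (monomial 𝕜 k)).comp (conv (monomial 𝕜 l)) := fun k l => ext_monomial fun m => by
    simp [conv_monomial, add_assoc]
  have h₂ : ∀ k, (conv.flip c).comp (conv (monomial 𝕜 k))
      = (conv (monomial 𝕜 k)).comp (conv.flip c) := fun k => ext_monomial fun l => by
    simp [h₁]
  have h₃ : ((conv (𝕜 := 𝕜)).flip c).comp ((conv (𝕜 := 𝕜)).flip b)
      = (conv (𝕜 := 𝕜)).flip (conv b c) := ext_monomial fun k => by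
    simpa using congrArg (fun φ => φ b) (h₂ k)
  simpa using congrArg (fun φ => φ a) h₃

theorem one_conv (a : WienerAlgebra 𝕜) : conv (monomial 𝕜 0) a = a := by
  have : conv (monomial 𝕜 0) = ContinuousLinearMap.id 𝕜 _ := ext_monomial fun k => by
    simp [conv_monomial]
  rw [this, ContinuousLinearMap.id_apply]

noncomputable instance : NormedCommRing (WienerAlgebra 𝕜) where
  __ := (inferInstance : NormedAddCommGroup (WienerAlgebra 𝕜))
  mul a b := conv a b
  one := monomial 𝕜 0
  mul_assoc := conv_assoc
  mul_comm := conv_comm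
  one_mul := one_conv
  mul_one a := (conv_comm _ _).trans (one_conv a)
  left_distrib a b c := map_add (conv a) b c
  right_distrib a b c := (congrArg (fun φ => φ c) (map_add conv a b) : _)
  zero_mul a := (congrArg (fun φ => φ a) (map_zero conv) : _)
  mul_zero a := map_zero (conv a)
  norm_mul_le := norm_conv_le

theorem mul_def (a b : WienerAlgebra 𝕜) : a * b = conv a b := rfl

theorem one_def : (1 : WienerAlgebra 𝕜) = monomial 𝕜 0 := rfl

noncomputable instance : NormedAlgebra 𝕜 (WienerAlgebra 𝕜) where
  __ := Algebra.ofModule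
    (fun c a b => (congrArg (fun φ => φ b) (map_smul conv c a) : _))
    (fun c a b => map_smul (conv a) c b)
  norm_smul_le c a := norm_smul_le c a

instance : NormOneClass (WienerAlgebra 𝕜) := ⟨norm_monomial 0⟩


theorem monomial_mul (k l : ℕ × ℕ) : monomial 𝕜 k * monomial 𝕜 l = monomial 𝕜 (k + l) :=
  conv_monomial k l

theorem monomial_pow (k : ℕ × ℕ) (n : ℕ) : monomial 𝕜 k ^ n = monomial 𝕜 (n • k) := by
  induction n with
  | zero => simp [one_def]
  | succ n ih => rw [pow_succ, ih, monomial_mul, succ_nsmul]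

end WienerAlgebra

/-! ### Evaluation and substitution -/

namespace WienerAlgebra

variable {𝕜 : Type*} [RCLike 𝕜]
  {B : Type*} [NormedCommRing B] [NormOneClass B]

/-- The monomial `y₁ ^ k₁ y₂ ^ k₂`. -/
def powProd {B : Type*} [CommMonoid B] (y : Fin 2 → B) (k : ℕ × ℕ) : B := y 0 ^ k.1 * y 1 ^ k.2

theorem powProd_mul {B : Type*} [CommMonoid B] (y z : Fin 2 → B) (k : ℕ × ℕ) :
    powProd (fun j => y j * z j) k = powProd y k * powProd z k := by
  simp only [powProd, mul_pow]
  exact mul_mul_mul_comm _ _ _ _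

theorem powProd_add {B : Type*} [CommMonoid B] (y : Fin 2 → B) (k l : ℕ × ℕ) :
    powProd y (k + l) = powProd y k * powProd y l := by
  simp only [powProd, Prod.fst_add, Prod.snd_add, pow_add]
  exact mul_mul_mul_comm _ _ _ _

theorem powProd_zero {B : Type*} [CommMonoid B] (y : Fin 2 → B) : powProd y 0 = 1 := by
  simp [powProd]

theorem norm_powProd_le_pow {y : Fin 2 → B} {r : ℝ} (hy : ∀ j, ‖y j‖ ≤ r) (k : ℕ × ℕ) :
    ‖powProd y k‖ ≤ r ^ (k.1 + k.2) := by
  have h0 : 0 ≤ r := (norm_nonneg _).trans (hy 0)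
  calc ‖powProd y k‖ ≤ ‖y 0‖ ^ k.1 * ‖y 1‖ ^ k.2 :=
        (norm_mul_le _ _).trans (mul_le_mul (norm_pow_le _ _) (norm_pow_le _ _) (norm_nonneg _)
          (by positivity))
    _ ≤ r ^ k.1 * r ^ k.2 := by gcongr <;> apply hy
    _ = r ^ (k.1 + k.2) := (pow_add _ _ _).symm

theorem norm_powProd_le {y : Fin 2 → B} (hy : ‖y‖ ≤ 1) (k : ℕ × ℕ) : ‖powProd y k‖ ≤ 1 :=
  (norm_powProd_le_pow (fun j => (norm_le_pi_norm y j).trans hy) k).trans_eq (one_pow _)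

variable [NormedAlgebra 𝕜 B] [CompleteSpace B]

/-- Substitution of `y` with `‖y‖ ≤ 1` for the variables. -/
noncomputable def aeval (y : Fin 2 → B) : WienerAlgebra 𝕜 →L[𝕜] B := lift (powProd y)

theorem hasSum_aeval {y : Fin 2 → B} (hy : ‖y‖ ≤ 1) (a : WienerAlgebra 𝕜) :
    HasSum (fun k => a k • powProd y k) (aeval y a) :=
  hasSum_lift (norm_powProd_le hy) a

theorem aeval_monomial {y : Fin 2 → B} (hy : ‖y‖ ≤ 1) (k : ℕ × ℕ) :
    aeval y (monomial 𝕜 k) = powProd y k :=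
  lift_monomial (norm_powProd_le hy) k

theorem norm_aeval_le {y : Fin 2 → B} (hy : ‖y‖ ≤ 1) (a : WienerAlgebra 𝕜) :
    ‖aeval y a‖ ≤ ‖a‖ :=
  (norm_lift_apply_le (norm_powProd_le hy) a).trans_eq (one_mul _)

theorem aeval_mul {y : Fin 2 → B} (hy : ‖y‖ ≤ 1) (a b : WienerAlgebra 𝕜) :
    aeval y (a * b) = aeval y a * aeval y b := by
  have h₁ : ∀ k, (aeval y).comp (conv (monomial 𝕜 k))
      = (ContinuousLinearMap.mul 𝕜 B (powProd y k)).comp (aeval y) := fun k =>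
    ext_monomial fun l => by
      simp [conv_monomial, aeval_monomial hy, powProd_add]
  have h₂ : (aeval y).comp (conv.flip b)
      = ((ContinuousLinearMap.mul 𝕜 B).flip (aeval y b)).comp (aeval y) :=
    ext_monomial fun k => by
      simpa [aeval_monomial hy, mul_comm] using congrArg (fun φ => φ b) (h₁ k)
  simpa [mul_def, mul_comm] using congrArg (fun φ => φ a) h₂

theorem aeval_one {y : Fin 2 → B} (hy : ‖y‖ ≤ 1) : aeval y (1 : WienerAlgebra 𝕜) = 1 := by
  rw [one_def, aeval_monomial hy, powProd_zero]

theorem aeval_pow {y : Fin 2 → B} (hy : ‖y‖ ≤ 1) (a : WienerAlgebra 𝕜) (n : ℕ) :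
    aeval y (a ^ n) = aeval y a ^ n := by
  induction n with
  | zero => simp [aeval_one hy]
  | succ n ih => rw [pow_succ, aeval_mul hy, ih, pow_succ]

theorem aeval_powProd {y : Fin 2 → B} (hy : ‖y‖ ≤ 1) (h : Fin 2 → WienerAlgebra 𝕜) (k : ℕ × ℕ) :
    aeval y (powProd h k) = powProd (fun j => aeval y (h j)) k := by
  simp only [powProd, aeval_mul hy, aeval_pow hy]

theorem norm_aeval_pi_le {y : Fin 2 → B} (hy : ‖y‖ ≤ 1) {h : Fin 2 → WienerAlgebra 𝕜} {r : ℝ}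
    (hr : ‖h‖ ≤ r) : ‖fun j => aeval y (h j)‖ ≤ r :=
  (pi_norm_le_iff_of_nonneg ((norm_nonneg _).trans hr)).2 fun j =>
    (norm_aeval_le hy _).trans ((norm_le_pi_norm h j).trans hr)

/-- `aeval y` is continuous, hence acts term by term on the series that defines `aeval h`, and it is
multiplicative on each term. -/
theorem aeval_aeval {y : Fin 2 → B} (hy : ‖y‖ ≤ 1) {h : Fin 2 → WienerAlgebra 𝕜} (hh : ‖h‖ ≤ 1)
    (a : WienerAlgebra 𝕜) : aeval y (aeval h a) = aeval (fun j => aeval y (h j)) a := by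
  rw [aeval, aeval, clm_apply_lift (lift (powProd y)) (norm_powProd_le hh) a]
  congr 2
  funext k
  exact aeval_powProd hy h k

/-! ### Coefficient functionals, multipliers and division by a variable -/

/-- The coefficients are continuous linear functionals. -/
noncomputable def coeff (k : ℕ × ℕ) : WienerAlgebra 𝕜 →L[𝕜] 𝕜 :=
  LinearMap.mkContinuous
    { toFun := fun a => a k, map_add' := fun _ _ => rfl, map_smul' := fun _ _ => rfl } 1
    fun a => by
      rw [one_mul, norm_eq_tsum]
      exact a.summable_norm.le_tsum k fun _ _ => norm_nonneg _

@[simp] theorem coeff_apply (k : ℕ × ℕ) (a : WienerAlgebra 𝕜) : coeff k a = a k := rfl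

theorem norm_apply_le (a : WienerAlgebra 𝕜) (k : ℕ × ℕ) : ‖a k‖ ≤ ‖a‖ := by
  rw [norm_eq_tsum]
  exact a.summable_norm.le_tsum k fun _ _ => norm_nonneg _

/-- Multiplication of the coefficients by a bounded family. -/
noncomputable def diag (d : ℕ × ℕ → 𝕜) : WienerAlgebra 𝕜 →L[𝕜] WienerAlgebra 𝕜 :=
  lift fun k => d k • monomial 𝕜 k

theorem norm_smul_monomial (c : 𝕜) (k : ℕ × ℕ) : ‖c • monomial 𝕜 k‖ = ‖c‖ := by
  rw [norm_smul, norm_monomial, mul_one]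

theorem diag_monomial {d : ℕ × ℕ → 𝕜} {C : ℝ} (hd : ∀ k, ‖d k‖ ≤ C) (k : ℕ × ℕ) :
    diag d (monomial 𝕜 k) = d k • monomial 𝕜 k :=
  lift_monomial (C := C) (fun k => (norm_smul_monomial _ k).trans_le (hd k)) k

theorem diag_apply {d : ℕ × ℕ → 𝕜} {C : ℝ} (hd : ∀ k, ‖d k‖ ≤ C) (a : WienerAlgebra 𝕜)
    (k : ℕ × ℕ) : diag d a k = d k * a k := by
  have h : (coeff k).comp (diag d) = d k • coeff (𝕜 := 𝕜) k := ext_monomial fun l => by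
    rw [ContinuousLinearMap.comp_apply, diag_monomial hd]
    by_cases hkl : k = l <;> simp [monomial_apply, hkl]
  exact congrArg (fun φ => φ a) h

theorem norm_diag_le {d : ℕ × ℕ → 𝕜} {C : ℝ} (hd : ∀ k, ‖d k‖ ≤ C) (a : WienerAlgebra 𝕜) :
    ‖diag d a‖ ≤ C * ‖a‖ :=
  norm_lift_apply_le (fun k => (norm_smul_monomial _ k).trans_le (hd k)) a

/-- The comparison behind every change of scale. Only the exponents of `a` need to match, so `d` can
be chosen freely elsewhere to keep it bounded. -/
theorem aeval_diag {y z : Fin 2 → B} (hy : ‖y‖ ≤ 1) (hz : ‖z‖ ≤ 1) {d : ℕ × ℕ → 𝕜} {C : ℝ}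
    (hd : ∀ k, ‖d k‖ ≤ C) (a : WienerAlgebra 𝕜)
    (h : ∀ k, a k ≠ 0 → d k • powProd y k = powProd z k) :
    aeval y (diag d a) = aeval z a := by
  refine (hasSum_aeval hy _).unique ?_
  convert hasSum_aeval hz a using 2 with k
  rw [diag_apply hd]
  by_cases hk : a k = 0
  · simp [hk]
  · rw [← h k hk, mul_comm, mul_smul, smul_comm]

/-- Division by the variable with index `j`, where the monomials without this variable are
dropped. -/
noncomputable def divX (j : Fin 2) : WienerAlgebra 𝕜 →L[𝕜] WienerAlgebra 𝕜 :=
  lift fun k => if j = 0 then (if k.1 = 0 then 0 else monomial 𝕜 (k.1 - 1, k.2))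
    else (if k.2 = 0 then 0 else monomial 𝕜 (k.1, k.2 - 1))

theorem norm_divX_aux (j : Fin 2) (k : ℕ × ℕ) :
    ‖(if j = 0 then (if k.1 = 0 then 0 else monomial 𝕜 (k.1 - 1, k.2))
      else (if k.2 = 0 then 0 else monomial 𝕜 (k.1, k.2 - 1)) : WienerAlgebra 𝕜)‖ ≤ 1 := by
  split_ifs <;> simp [norm_monomial]

theorem divX_monomial (j : Fin 2) (k : ℕ × ℕ) : divX j (monomial 𝕜 k) =
    if j = 0 then (if k.1 = 0 then 0 else monomial 𝕜 (k.1 - 1, k.2))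
    else (if k.2 = 0 then 0 else monomial 𝕜 (k.1, k.2 - 1)) :=
  lift_monomial (norm_divX_aux j) k

theorem norm_divX_le (j : Fin 2) (a : WienerAlgebra 𝕜) : ‖divX j a‖ ≤ ‖a‖ :=
  (norm_lift_apply_le (norm_divX_aux j) a).trans_eq (one_mul _)

/-! ### Analytic dependence of substitution on the substituted point -/

theorem _root_.ContinuousLinearMap.map_analyticAt {E F G : Type*} [NormedAddCommGroup E]
    [NormedSpace 𝕜 E] [NormedAddCommGroup F] [NormedSpace 𝕜 F] [NormedAddCommGroup G]
    [NormedSpace 𝕜 G] (T : F →L[𝕜] G) {v : E → F} {e : E} (hv : AnalyticAt 𝕜 v e) :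
    AnalyticAt 𝕜 (fun e => T (v e)) e :=
  AnalyticAt.fun_comp (g := T) (f := v) (T.analyticAt _) hv

theorem _root_.AnalyticAt.clm_apply {E F G : Type*} [NormedAddCommGroup E] [NormedSpace 𝕜 E]
    [NormedAddCommGroup F] [NormedSpace 𝕜 F] [NormedAddCommGroup G] [NormedSpace 𝕜 G]
    {T : E → F →L[𝕜] G} {v : E → F} {e : E} (hT : AnalyticAt 𝕜 T e) (hv : AnalyticAt 𝕜 v e) :
    AnalyticAt 𝕜 (fun e => T e (v e)) e :=
  ((ContinuousLinearMap.id 𝕜 (F →L[𝕜] G)).analyticAt_bilinear (T e, v e)).comp₂ hT hv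

theorem _root_.AnalyticAt.inverse_one_sub {E Z : Type*} [NormedAddCommGroup E] [NormedSpace 𝕜 E]
    [NormedAddCommGroup Z] [NormedSpace 𝕜 Z] [CompleteSpace Z] {T : E → Z →L[𝕜] Z} {e : E}
    (hT : AnalyticAt 𝕜 T e) (hu : IsUnit (1 - T e)) :
    AnalyticAt 𝕜 (fun e => Ring.inverse (1 - T e)) e := by
  obtain ⟨u, hu⟩ := hu
  have h := analyticAt_inverse (𝕜 := 𝕜) (A := Z →L[𝕜] Z) u
  rw [hu] at h
  exact AnalyticAt.fun_comp (g := Ring.inverse) (f := fun e => 1 - T e) h (analyticAt_const.sub hT)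

/-- By the Neumann series `1 - S` is invertible near the point, and inversion is analytic at units.
-/
theorem analyticAt_of_one_sub_apply {E Z : Type*} [NormedAddCommGroup E] [NormedSpace 𝕜 E]
    [NormedAddCommGroup Z] [NormedSpace 𝕜 Z] [CompleteSpace Z] {S : E → Z →L[𝕜] Z} {e : E}
    (hS : AnalyticAt 𝕜 S e) (hlt : ‖S e‖ < 1) {ψ φ : E → Z} (hφ : AnalyticAt 𝕜 φ e)
    (h : ∀ᶠ e in 𝓝 e, (1 - S e) (ψ e) = φ e) : AnalyticAt 𝕜 ψ e := by
  have hu : ∀ {T : Z →L[𝕜] Z}, ‖T‖ < 1 → IsUnit (1 - T) := fun hT =>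
    (Units.oneSub (R := Z →L[𝕜] Z) _ hT).isUnit
  refine ((hS.inverse_one_sub (hu hlt)).clm_apply hφ).congr ?_
  filter_upwards [h, hS.continuousAt.norm.eventually_lt_const hlt] with e he hle
  rw [← he]
  exact congrArg (fun T : Z →L[𝕜] Z => T (ψ e)) (Ring.inverse_mul_cancel _ (hu hle))

section Resolvent

variable {V : Type*} [NormedAddCommGroup V] [NormedSpace 𝕜 V]
  {B : Type*} [NormedCommRing B] [NormedAlgebra 𝕜 B]

/-- The operator `φ ↦ b • φ ∘ S`, as a continuous linear function of `b`. -/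
noncomputable def mulComp (B : Type*) [NormedCommRing B] [NormedAlgebra 𝕜 B] (S : V →L[𝕜] V) :
    B →L[𝕜] (V →L[𝕜] B) →L[𝕜] (V →L[𝕜] B) :=
  (ContinuousLinearMap.compL 𝕜 (V →L[𝕜] B) (V →L[𝕜] B) (V →L[𝕜] B)
      ((ContinuousLinearMap.compL 𝕜 V V B).flip S)).comp
    ((ContinuousLinearMap.compL 𝕜 V B B).comp (ContinuousLinearMap.mul 𝕜 B))

theorem mulComp_apply (S : V →L[𝕜] V) (b : B) (φ : V →L[𝕜] B) (a : V) :
    mulComp B S b φ a = b * φ (S a) := rfl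

theorem norm_mulComp_le {S : V →L[𝕜] V} (hS : ∀ a, ‖S a‖ ≤ ‖a‖) (b : B) :
    ‖mulComp B S b‖ ≤ ‖b‖ := by
  refine ContinuousLinearMap.opNorm_le_bound _ (norm_nonneg _) fun φ =>
    ContinuousLinearMap.opNorm_le_bound _ (by positivity) fun a => ?_
  rw [mulComp_apply, mul_assoc]
  refine (norm_mul_le _ _).trans (mul_le_mul_of_nonneg_left ?_ (norm_nonneg _))
  exact (φ.le_opNorm _).trans (mul_le_mul_of_nonneg_left (hS a) (norm_nonneg _))

/-- A family of linear maps that is obtained by two resolvents is analytic. -/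
theorem analyticAt_of_one_sub_mulComp [CompleteSpace B] {S : Fin 2 → V →L[𝕜] V}
    (hS : ∀ j a, ‖S j a‖ ≤ ‖a‖) {T : (Fin 2 → B) → V →L[𝕜] B} {φ₀ : V →L[𝕜] B}
    (hT : ∀ y : Fin 2 → B, ‖y‖ < 1 →
      (1 - mulComp B (S 1) (y 1)) ((1 - mulComp B (S 0) (y 0)) (T y)) = φ₀)
    {y : Fin 2 → B} (hy : ‖y‖ < 1) : AnalyticAt 𝕜 T y := by
  have hlt : ∀ j, ‖mulComp B (S j) (y j)‖ < 1 := fun j =>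
    (norm_mulComp_le (hS j) _).trans_lt ((norm_le_pi_norm y j).trans_lt hy)
  have hm : ∀ j, AnalyticAt 𝕜 (fun y : Fin 2 → B => mulComp B (S j) (y j)) y := fun j =>
    ContinuousLinearMap.map_analyticAt (E := Fin 2 → B) (F := B)
      (G := (V →L[𝕜] B) →L[𝕜] (V →L[𝕜] B)) (mulComp B (S j))
      ((ContinuousLinearMap.proj (R := 𝕜) (φ := fun _ : Fin 2 => B) j).analyticAt y)
  refine analyticAt_of_one_sub_apply (hm 0) (hlt 0) (analyticAt_of_one_sub_apply (hm 1) (hlt 1)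
    (analyticAt_const (v := φ₀)) ?_) (Eventually.of_forall fun _ => rfl)
  filter_upwards [(isOpen_lt continuous_norm continuous_const).mem_nhds hy] with z hz
  exact hT z hz

end Resolvent

/-- An operator version of `∑ yᵏ = (1 - y₀)⁻¹ (1 - y₁)⁻¹`. Subtracting `y₀ * aeval y (divX 0 a)`
from `aeval y a` leaves the monomials without the first variable; doing the same with the second
variable leaves the constant term. Analyticity holds for the operator norm, so `a` may vary as well.
-/
theorem analyticAt_aeval {y : Fin 2 → B} (hy : ‖y‖ < 1) :
    AnalyticAt 𝕜 (fun y : Fin 2 → B => (aeval y : WienerAlgebra 𝕜 →L[𝕜] B)) y := by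
  refine analyticAt_of_one_sub_mulComp (S := divX) (φ₀ := (coeff 0).smulRight 1) norm_divX_le ?_ hy
  intro y hy
  refine ext_monomial fun k => ?_
  obtain ⟨k₁, k₂⟩ := k
  cases k₁ <;> cases k₂ <;>
  simp [mulComp_apply, divX_monomial, aeval_monomial hy.le, powProd, monomial_apply,
    pow_succ', Prod.ext_iff, mul_assoc, mul_left_comm]

theorem _root_.AnalyticAt.aeval {E : Type*} [NormedAddCommGroup E] [NormedSpace 𝕜 E]
    {y : E → Fin 2 → B} {a : E → WienerAlgebra 𝕜} {e : E} (hy : AnalyticAt 𝕜 y e)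
    (ha : AnalyticAt 𝕜 a e) (h1 : ‖y e‖ < 1) :
    AnalyticAt 𝕜 (fun e => WienerAlgebra.aeval (y e) (a e)) e := by
  exact ((analyticAt_aeval h1).fun_comp hy).clm_apply ha

end WienerAlgebra

/-! ### Supports -/

namespace WienerAlgebra

variable {𝕜 : Type*} [RCLike 𝕜]

/-- The exponent of the variable with index `i`. -/
def unitExp (i : Fin 2) : ℕ × ℕ := if i = 0 then (1, 0) else (0, 1)

/-- The variable with index `i`. -/
noncomputable def X (𝕜 : Type*) [RCLike 𝕜] (i : Fin 2) : WienerAlgebra 𝕜 := monomial 𝕜 (unitExp i)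

theorem norm_X (i : Fin 2) : ‖X 𝕜 i‖ = 1 := norm_monomial _

theorem powProd_unitExp {B : Type*} [CommMonoid B] (y : Fin 2 → B) (i : Fin 2) :
    powProd y (unitExp i) = y i := by
  fin_cases i <;> simp [powProd, unitExp]

theorem aeval_X {B : Type*} [NormedCommRing B] [NormOneClass B] [NormedAlgebra 𝕜 B]
    [CompleteSpace B] {y : Fin 2 → B} (hy : ‖y‖ ≤ 1) (i : Fin 2) : aeval y (X 𝕜 i) = y i := by
  rw [X, aeval_monomial hy, powProd_unitExp]

theorem powProd_X (k : ℕ × ℕ) : powProd (X 𝕜) k = monomial 𝕜 k := by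
  simp [powProd, X, unitExp, monomial_pow, monomial_mul]

theorem map_apply_eq_zero (φ : WienerAlgebra 𝕜 →L[𝕜] WienerAlgebra 𝕜) {a : WienerAlgebra 𝕜}
    {m : ℕ × ℕ} (h : ∀ k, a k ≠ 0 → φ (monomial 𝕜 k) m = 0) : φ a m = 0 := by
  have hs := (hasSum_monomial a).map ((coeff m).comp φ) ((coeff m).comp φ).continuous
  refine hs.unique ((hasSum_zero (α := 𝕜)).congr_fun fun k => ?_)
  by_cases hk : a k = 0
  · simp [hk]
  · simp [h k hk]

/-- The value at the exponent `k` of the linear form with coefficients `c`. -/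
def weight (c : ℤ × ℤ × ℕ) (k : ℕ × ℕ) : ℤ := c.1 * k.1 + c.2.1 * k.2

theorem weight_add (c : ℤ × ℤ × ℕ) (k l : ℕ × ℕ) : weight c (k + l) = weight c k + weight c l := by
  simp only [weight, Prod.fst_add, Prod.snd_add, Nat.cast_add]
  ring

/-- All exponents of `a` have weight at least `n`. -/
def OrderGE (c : ℤ × ℤ × ℕ) (n : ℤ) (a : WienerAlgebra 𝕜) : Prop := ∀ k, a k ≠ 0 → n ≤ weight c k

theorem OrderGE.mul {c : ℤ × ℤ × ℕ} {m n : ℤ} {a b : WienerAlgebra 𝕜} (ha : OrderGE c m a)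
    (hb : OrderGE c n b) : OrderGE c (m + n) (a * b) := by
  intro l hl
  by_contra hlt
  rw [mul_def, ← ContinuousLinearMap.flip_apply] at hl
  refine hl (map_apply_eq_zero _ fun i hi => ?_)
  refine map_apply_eq_zero (conv (monomial 𝕜 i)) fun j hj => ?_
  rw [conv_monomial, monomial_apply, if_neg]
  rintro rfl
  have h₁ := ha i hi
  have h₂ := hb j hj
  rw [weight_add] at hlt
  omega

theorem orderGE_one (c : ℤ × ℤ × ℕ) : OrderGE c 0 (1 : WienerAlgebra 𝕜) := by
  intro k hk
  rw [one_def, monomial_apply] at hk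
  obtain rfl : k = 0 := by
    by_contra h
    exact hk (if_neg h)
  simp [weight]

theorem OrderGE.pow {c : ℤ × ℤ × ℕ} {m : ℤ} {a : WienerAlgebra 𝕜} (ha : OrderGE c m a) (n : ℕ) :
    OrderGE c (n * m) (a ^ n) := by
  induction n with
  | zero => simpa using orderGE_one c
  | succ n ih =>
    rw [pow_succ]
    convert ih.mul ha using 1
    push_cast
    ring

theorem OrderGE.powProd {c : ℤ × ℤ × ℕ} {y : Fin 2 → WienerAlgebra 𝕜}
    (hy : ∀ j, OrderGE c (weight c (unitExp j)) (y j)) (k : ℕ × ℕ) :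
    OrderGE c (weight c k) (powProd y k) := by
  have h := ((hy 0).pow k.1).mul ((hy 1).pow k.2)
  rwa [show (k.1 * weight c (unitExp 0) + k.2 * weight c (unitExp 1) : ℤ) = weight c k by
    simp [weight, unitExp, mul_comm]] at h

/-- The exponents `k` such that `xᵏ` may occur in the component `i`: the weight of `k` exceeds
that of the variable with index `i` by the amount that each of the constraints prescribes. -/
def Allowed (C : Set (ℤ × ℤ × ℕ)) (i : Fin 2) (k : ℕ × ℕ) : Prop :=
  ∀ c ∈ C, weight c (unitExp i) + c.2.2 ≤ weight c k

/-- The exponents of `a` satisfy `S`. -/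
def SupportedIn (S : ℕ × ℕ → Prop) (a : WienerAlgebra 𝕜) : Prop := ∀ k, a k ≠ 0 → S k

theorem SupportedIn.add {S : ℕ × ℕ → Prop} {a b : WienerAlgebra 𝕜} (ha : SupportedIn S a)
    (hb : SupportedIn S b) : SupportedIn S (a + b) := by
  intro k hk
  by_cases h : a k = 0
  · exact hb k (by simpa [h] using hk)
  · exact ha k h

theorem SupportedIn.smul {S : ℕ × ℕ → Prop} {a : WienerAlgebra 𝕜} (c : 𝕜) (ha : SupportedIn S a) :
    SupportedIn S (c • a) := fun k hk => ha k (right_ne_zero_of_mul hk)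

theorem SupportedIn.sub {S : ℕ × ℕ → Prop} {a b : WienerAlgebra 𝕜} (ha : SupportedIn S a)
    (hb : SupportedIn S b) : SupportedIn S (a - b) := by
  rw [sub_eq_add_neg, ← neg_one_smul 𝕜 b]
  exact ha.add (hb.smul _)

theorem SupportedIn.mono {S T : ℕ × ℕ → Prop} {a : WienerAlgebra 𝕜} (ha : SupportedIn S a)
    (h : ∀ k, S k → T k) : SupportedIn T a := fun k hk => h k (ha k hk)

theorem SupportedIn.diag {S : ℕ × ℕ → Prop} {a : WienerAlgebra 𝕜} (ha : SupportedIn S a)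
    {d : ℕ × ℕ → 𝕜} {K : ℝ} (hd : ∀ k, ‖d k‖ ≤ K) : SupportedIn S (diag d a) := fun k hk => by
  rw [diag_apply hd] at hk
  exact ha k (right_ne_zero_of_mul hk)

open Classical in
/-- Restriction to the exponents that satisfy `S`. -/
noncomputable def restrict (S : ℕ × ℕ → Prop) : WienerAlgebra 𝕜 →L[𝕜] WienerAlgebra 𝕜 :=
  diag fun k => if S k then 1 else 0

open Classical in
theorem norm_indicator_le (S : ℕ × ℕ → Prop) (k : ℕ × ℕ) :
    ‖(if S k then 1 else 0 : 𝕜)‖ ≤ 1 := by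
  split_ifs <;> simp

open Classical in
theorem restrict_apply (S : ℕ × ℕ → Prop) (a : WienerAlgebra 𝕜) (k : ℕ × ℕ) :
    restrict S a k = if S k then a k else 0 := by
  rw [restrict, diag_apply (norm_indicator_le S)]
  simp

theorem supportedIn_restrict (S : ℕ × ℕ → Prop) (a : WienerAlgebra 𝕜) :
    SupportedIn S (restrict S a) := fun k hk => by
  classical
  rw [restrict_apply] at hk
  by_contra h
  exact hk (if_neg h)

theorem norm_restrict_le (S : ℕ × ℕ → Prop) (a : WienerAlgebra 𝕜) : ‖restrict S a‖ ≤ ‖a‖ := by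
  classical
  exact (norm_diag_le (norm_indicator_le S) a).trans_eq (one_mul _)

theorem SupportedIn.restrict_eq {S T : ℕ × ℕ → Prop} {a : WienerAlgebra 𝕜} (ha : SupportedIn S a)
    (h : ∀ k, S k → T k) : restrict T a = a := by
  classical
  refine DFunLike.ext _ _ fun k => ?_
  rw [restrict_apply, ite_eq_left_iff]
  intro hT
  by_contra hk
  exact hT (h k (ha k (Ne.symm hk)))

theorem orderGE_X (c : ℤ × ℤ × ℕ) (i : Fin 2) : OrderGE c (weight c (unitExp i)) (X 𝕜 i) := by
  intro k hk
  rw [X, monomial_apply] at hk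
  obtain rfl : k = unitExp i := by
    by_contra h
    exact hk (if_neg h)
  exact le_rfl

/-- Constraints are inherited by compositions. -/
theorem SupportedIn.aeval {C : Set (ℤ × ℤ × ℕ)} {i : Fin 2} {a : WienerAlgebra 𝕜}
    (ha : SupportedIn (Allowed C i) a) {ν : Fin 2 → 𝕜} {z : Fin 2 → WienerAlgebra 𝕜}
    (hz : ∀ j, SupportedIn (Allowed C j) (z j)) {t : Fin 2 → 𝕜}
    (hle : ‖fun j => t j • (ν j • X 𝕜 j + z j)‖ ≤ 1) :
    SupportedIn (Allowed C i) (WienerAlgebra.aeval (fun j => t j • (ν j • X 𝕜 j + z j)) a) := by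
  -- Each substituted function has weight at least that of its variable, because the prescribed
  -- excess is a natural number. So the image of `xᵏ` has weight at least `weight c k`, which the
  -- constraint on `a` bounds from below.
  intro m hm c hc
  by_contra hlt
  refine hm (map_apply_eq_zero _ fun k hk => ?_)
  rw [aeval_monomial hle]
  by_contra hne
  have hy : ∀ j, OrderGE c (weight c (unitExp j)) (t j • (ν j • X 𝕜 j + z j)) := fun j =>
    SupportedIn.smul _ (SupportedIn.add (SupportedIn.smul _ (orderGE_X c j))
      ((hz j).mono fun k hk => (le_add_of_nonneg_right (by positivity)).trans (hk c hc)))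
  exact hlt ((ha k hk c hc).trans (OrderGE.powProd hy k m hne))

theorem analyticAt_implicit {V W : Type*} [NormedAddCommGroup V] [NormedSpace 𝕜 V]
    [CompleteSpace V] [NormedAddCommGroup W] [NormedSpace 𝕜 W] [CompleteSpace W] {Φ : V × W → W}
    {v : V} (hΦ : AnalyticAt 𝕜 Φ (v, 0)) (h0 : Φ (v, 0) = 0) (D : W ≃L[𝕜] W)
    (hD : HasFDerivAt (fun w => Φ (v, w)) (D : W →L[𝕜] W) 0) :
    ∃ S : V → W, AnalyticAt 𝕜 S v ∧ S v = 0 ∧ ∀ᶠ v in 𝓝 v, Φ (v, S v) = 0 := by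
  -- In `WithTop ℕ∞` the element `⊤` stands for analyticity, so the smooth implicit function theorem
  -- is used at its analytic level.
  have hcd : ContDiffAt 𝕜 ⊤ Φ (v, 0) := hΦ.contDiffAt
  have hne : (⊤ : WithTop ℕ∞) ≠ 0 := by simp
  have hinr : fderiv 𝕜 Φ (v, 0) ∘L .inr 𝕜 V W = (D : W →L[𝕜] W) :=
    (hΦ.differentiableAt.hasFDerivAt.comp (0 : W) (hasFDerivAt_prodMk_right v (0 : W))).unique hD
  have hinv : (fderiv 𝕜 Φ (v, 0) ∘L .inr 𝕜 V W).IsInvertible := ⟨D, hinr.symm⟩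
  refine ⟨hcd.implicitFunction hne hinv, ?_, hcd.implicitFunction_apply_self hne hinv, ?_⟩
  · exact (hcd.contDiffAt_implicitFunction hne hinv).analyticAt
  · simpa [h0] using hcd.eventually_apply_implicitFunction hne hinv

end WienerAlgebra

/-! ### The equations for the inverse and for the conjugacy -/

namespace WienerAlgebra

variable {𝕜 : Type*} [RCLike 𝕜]

theorem _root_.AnalyticAt.pi_apply {E F : Type*} [NormedAddCommGroup E] [NormedSpace 𝕜 E]
    [NormedAddCommGroup F] [NormedSpace 𝕜 F] {f : E → Fin 2 → F} {e : E} (hf : AnalyticAt 𝕜 f e)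
    (i : Fin 2) : AnalyticAt 𝕜 (fun e => f e i) e :=
  analyticAt_pi_iff.1 hf i

/-- If `S` is analytic, `S v = 0` and `y (v, w)` depends analytically on `(v, w)`, a strict bound on
`‖y (v, 0)‖` persists along the graph of `S`. -/
theorem eventually_norm_lt_of_analyticAt {V W Y : Type*} [NormedAddCommGroup V] [NormedSpace 𝕜 V]
    [NormedAddCommGroup W] [NormedSpace 𝕜 W] [NormedAddCommGroup Y] [NormedSpace 𝕜 Y]
    {y : V × W → Y} {S : V → W} {v : V} {r : ℝ} (hy : AnalyticAt 𝕜 y (v, 0))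
    (hS : AnalyticAt 𝕜 S v) (h0 : S v = 0) (hlt : ‖y (v, 0)‖ < r) :
    ∀ᶠ v in 𝓝 v, ‖y (v, S v)‖ < r := by
  have hc : ContinuousAt (fun v => (v, S v)) v := continuousAt_id.prodMk hS.continuousAt
  have h : ContinuousAt (fun v => ‖y (v, S v)‖) v :=
    (ContinuousAt.comp (f := fun v => (v, S v)) (g := y) (by rw [h0]; exact hy.continuousAt) hc).norm
  exact h.eventually_lt_const (by simpa only [h0] using hlt)

theorem norm_smul_X_lt {ν t : Fin 2 → 𝕜} (h : ∀ j, ‖t j * ν j‖ < 1) :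
    ‖fun j => t j • (ν j • X 𝕜 j + (0 : WienerAlgebra 𝕜))‖ < 1 :=
  (pi_norm_lt_iff one_pos).2 fun j => by
    rw [add_zero, smul_smul, norm_smul, norm_X, mul_one]
    exact h j

/-- The inverse of `x ↦ ν⁻¹ x + ∑ₖ αₖ (σ⁻¹ x) ᵏ` is `x ↦ ν x + S (ν, α) (x)`. -/
theorem exists_inverse (C : Set (ℤ × ℤ × ℕ)) {ν₀ : Fin 2 → 𝕜} {σ : ℝ} (hσ : ∀ j, ‖ν₀ j‖ < σ) :
    ∃ S : (Fin 2 → 𝕜) × (Fin 2 → WienerAlgebra 𝕜) → Fin 2 → WienerAlgebra 𝕜,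
      AnalyticAt 𝕜 S (ν₀, 0) ∧ S (ν₀, 0) = 0 ∧ ∀ᶠ π in 𝓝 (ν₀, 0),
        (∀ i, SupportedIn (Allowed C i) (π.2 i)) → (∀ i, SupportedIn (Allowed C i) (S π i)) ∧
        ‖fun j => (σ : 𝕜)⁻¹ • (π.1 j • X 𝕜 j + S π j)‖ < 1 ∧
        ∀ i, S π i + π.1 i • aeval (fun j => (σ : 𝕜)⁻¹ • (π.1 j • X 𝕜 j + S π j)) (π.2 i) = 0 := by
  have hσ0 : 0 < σ := (norm_nonneg _).trans_lt (hσ 0)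
  -- The unknown is restricted to the allowed exponents before it is substituted. A solution then
  -- has allowed exponents by its own equation, and the restriction turns out to be void.
  let y : ((Fin 2 → 𝕜) × (Fin 2 → WienerAlgebra 𝕜)) × (Fin 2 → WienerAlgebra 𝕜) →
      Fin 2 → WienerAlgebra 𝕜 := fun p j =>
    (σ : 𝕜)⁻¹ • (p.1.1 j • X 𝕜 j + restrict (Allowed C j) (p.2 j))
  let Φ : ((Fin 2 → 𝕜) × (Fin 2 → WienerAlgebra 𝕜)) × (Fin 2 → WienerAlgebra 𝕜) →
      Fin 2 → WienerAlgebra 𝕜 := fun p i => p.2 i + p.1.1 i • aeval (y p) (p.1.2 i)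
  let e₀ : ((Fin 2 → 𝕜) × (Fin 2 → WienerAlgebra 𝕜)) × (Fin 2 → WienerAlgebra 𝕜) := ((ν₀, 0), 0)
  have hν : AnalyticAt 𝕜 (fun p : ((Fin 2 → 𝕜) × (Fin 2 → WienerAlgebra 𝕜)) ×
      (Fin 2 → WienerAlgebra 𝕜) => p.1.1) e₀ := analyticAt_fst.fun_comp analyticAt_fst
  have hα : AnalyticAt 𝕜 (fun p : ((Fin 2 → 𝕜) × (Fin 2 → WienerAlgebra 𝕜)) ×
      (Fin 2 → WienerAlgebra 𝕜) => p.1.2) e₀ := analyticAt_snd.fun_comp analyticAt_fst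
  have hz : AnalyticAt 𝕜 (fun p : ((Fin 2 → 𝕜) × (Fin 2 → WienerAlgebra 𝕜)) ×
      (Fin 2 → WienerAlgebra 𝕜) => p.2) e₀ := analyticAt_snd
  have hy : AnalyticAt 𝕜 y e₀ := AnalyticAt.pi fun j =>
    analyticAt_const.fun_smul (((hν.pi_apply j).fun_smul analyticAt_const).fun_add
      ((restrict (Allowed C j)).map_analyticAt (hz.pi_apply j)))
  have hy1 : ‖y e₀‖ < 1 := by
    have : y e₀ = fun j => (σ : 𝕜)⁻¹ • (ν₀ j • X 𝕜 j + 0) := by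
      funext j
      simp [y, e₀]
    rw [this]
    refine norm_smul_X_lt (t := fun _ => (σ : 𝕜)⁻¹) fun j => ?_
    rw [norm_mul, norm_inv, RCLike.norm_ofReal, abs_of_pos hσ0, inv_mul_lt_one₀ hσ0]
    exact hσ j
  have hΦ : AnalyticAt 𝕜 Φ e₀ := AnalyticAt.pi fun i =>
    (hz.pi_apply i).fun_add ((hν.pi_apply i).fun_smul (hy.aeval (hα.pi_apply i) hy1))
  obtain ⟨S, hS, hS0, hSΦ⟩ := analyticAt_implicit (v := (ν₀, 0)) hΦ (by funext i; simp [Φ])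
    (ContinuousLinearEquiv.refl 𝕜 _) (by
      have : (fun w => Φ ((ν₀, 0), w)) = id := by
        funext w i
        simp [Φ]
      rw [this]
      exact hasFDerivAt_id _)
  refine ⟨S, hS, hS0, ?_⟩
  filter_upwards [hSΦ, eventually_norm_lt_of_analyticAt hy hS hS0 hy1] with π hπ hlt hsupp
  have hc : ∀ i, S π i = -(π.1 i • aeval (y (π, S π)) (π.2 i)) := fun i =>
    eq_neg_of_add_eq_zero_left (congrFun hπ i)
  have hs : ∀ i, SupportedIn (Allowed C i) (S π i) := fun i => by
    rw [hc i, ← smul_neg, ← neg_one_smul 𝕜 (aeval _ _)]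
    exact (((hsupp i).aeval (fun j => supportedIn_restrict _ _) hlt.le).smul _).smul _
  have hyS : y (π, S π) = fun j => (σ : 𝕜)⁻¹ • (π.1 j • X 𝕜 j + S π j) := by
    funext j
    simp only [y, (hs j).restrict_eq fun k hk => hk]
  rw [hyS] at hlt hc
  exact ⟨hs, hlt, fun i => by rw [hc i, neg_add_cancel]⟩

/-- A bounded family of multipliers that is bounded away from `0` defines an isomorphism. -/
noncomputable def diagEquiv {d : ℕ × ℕ → 𝕜} {K c : ℝ} (hd : ∀ k, ‖d k‖ ≤ K) (hc : 0 < c)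
    (hdc : ∀ k, c ≤ ‖d k‖) : WienerAlgebra 𝕜 ≃L[𝕜] WienerAlgebra 𝕜 :=
  have h0 : ∀ k, d k ≠ 0 := fun k => norm_pos_iff.1 (hc.trans_le (hdc k))
  have hd' : ∀ k, ‖(d k)⁻¹‖ ≤ c⁻¹ := fun k => by
    rw [norm_inv]
    exact inv_anti₀ hc (hdc k)
  ContinuousLinearEquiv.equivOfInverse (diag d) (diag fun k => (d k)⁻¹)
    (fun a => DFunLike.ext _ _ fun k => by
      rw [diag_apply hd', diag_apply hd, inv_mul_cancel_left₀ (h0 k)])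
    (fun a => DFunLike.ext _ _ fun k => by
      rw [diag_apply hd, diag_apply hd', mul_inv_cancel_left₀ (h0 k)])

theorem powProd_smul_X (t : Fin 2 → 𝕜) (k : ℕ × ℕ) :
    powProd (fun j => t j • X 𝕜 j) k = powProd t k • monomial 𝕜 k := by
  rw [← powProd_X]
  simp only [powProd, smul_pow, smul_mul_smul_comm]

theorem restrict_monomial (S : ℕ × ℕ → Prop) [DecidablePred S] (k : ℕ × ℕ) :
    restrict S (monomial 𝕜 k) = if S k then monomial 𝕜 k else 0 := by
  rw [restrict, diag_monomial (norm_indicator_le S)]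
  split_ifs <;> simp

open Classical in
/-- Multiplication of the coefficients with exponent in `S` by the powers of `s`. -/
noncomputable def weightOn (S : ℕ × ℕ → Prop) (s : Fin 2 → ℝ) (k : ℕ × ℕ) : 𝕜 :=
  if S k then powProd (fun j => (s j : 𝕜)) k else 0

theorem norm_weightOn_le {S : ℕ × ℕ → Prop} {s : Fin 2 → ℝ} {K : ℝ} (hs : ∀ j, 0 ≤ s j)
    (hK : ∀ k, S k → s 0 ^ k.1 * s 1 ^ k.2 ≤ K) (k : ℕ × ℕ) :
    ‖(weightOn S s k : 𝕜)‖ ≤ max K 0 := by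
  rw [weightOn]
  split_ifs with h
  · refine le_max_of_le_left (le_trans (le_of_eq ?_) (hK k h))
    simp [powProd, abs_of_nonneg (hs _)]
  · simp

/-- The derivative of the conjugacy equation at the linear map with eigenvalues `μ`. -/
theorem linearized_eq_diag {L N O : ℕ × ℕ → Prop} {μ : Fin 2 → 𝕜} {s : Fin 2 → ℝ} {K : ℝ} {m : 𝕜}
    (hs : ∀ j, ‖μ j‖ < s j) (hK : ∀ k, L k → s 0 ^ k.1 * s 1 ^ k.2 ≤ K) {d : ℕ × ℕ → 𝕜} {K' : ℝ}
    (hd : ∀ k, ‖d k‖ ≤ K') (hdL : ∀ k, L k → ¬ N k ∧ ¬ O k ∧ d k = m - powProd μ k)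
    (hdN : ∀ k, N k → ¬ L k ∧ ¬ O k ∧ d k = -1) (hdO : ∀ k, O k → ¬ L k ∧ ¬ N k ∧ d k = 1)
    (hall : ∀ k, L k ∨ N k ∨ O k) :
    m • restrict L - restrict N + restrict O
      - (aeval fun j => (s j : 𝕜)⁻¹ • μ j • X 𝕜 j).comp (diag (weightOn L s)) = diag d := by
  classical
  have hs0 : ∀ j, 0 < s j := fun j => (norm_nonneg _).trans_lt (hs j)
  have hle : ‖fun j => (s j : 𝕜)⁻¹ • μ j • X 𝕜 j‖ ≤ 1 := by
    have := norm_smul_X_lt (𝕜 := 𝕜) (ν := μ) (t := fun j => (s j : 𝕜)⁻¹) fun j => by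
      rw [norm_mul, norm_inv, RCLike.norm_ofReal, abs_of_pos (hs0 j), inv_mul_lt_one₀ (hs0 j)]
      exact hs j
    simpa using this.le
  refine ext_monomial fun k => ?_
  have hpow : powProd (fun j => (s j : 𝕜)⁻¹ • μ j • X 𝕜 j) k
      = powProd (fun j => (s j : 𝕜)⁻¹ * μ j) k • monomial 𝕜 k := by
    rw [← powProd_smul_X]
    simp only [smul_smul]
  have hw : powProd (fun j => (s j : 𝕜)) k * powProd (fun j => (s j : 𝕜)⁻¹ * μ j) k
      = powProd μ k := by
    rw [← powProd_mul]
    congr 1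
    funext j
    exact mul_inv_cancel_left₀ (RCLike.ofReal_ne_zero.2 (hs0 j).ne') _
  rw [diag_monomial hd]
  simp only [_root_.sub_apply, _root_.add_apply, _root_.smul_apply,
    ContinuousLinearMap.comp_apply, restrict_monomial,
    diag_monomial (norm_weightOn_le (fun j => (hs0 j).le) hK), map_smul, aeval_monomial hle, hpow]
  rcases hall k with h | h | h
  · obtain ⟨h₁, h₂, h₃⟩ := hdL k h
    rw [if_pos h, if_neg h₁, if_neg h₂, h₃, weightOn, if_pos h, smul_smul, hw, sub_smul]
    simp
  · obtain ⟨h₁, h₂, h₃⟩ := hdN k h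
    rw [if_pos h, if_neg h₁, if_neg h₂, h₃, weightOn, if_neg h₁]
    simp
  · obtain ⟨h₁, h₂, h₃⟩ := hdO k h
    rw [if_pos h, if_neg h₁, if_neg h₂, h₃, weightOn, if_neg h₁]
    simp

end WienerAlgebra

/-! ### The equation `f ∘ h = h ∘ g` that removes one constraint violation -/

namespace WienerAlgebra

variable {𝕜 : Type*} [RCLike 𝕜]

/-- The exponents that are allowed by `C` and violate the additional constraint `c`. -/
def Removed (C : Set (ℤ × ℤ × ℕ)) (c : ℤ × ℤ × ℕ) (i : Fin 2) (k : ℕ × ℕ) : Prop :=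
  Allowed C i k ∧ ¬ Allowed {c} i k

theorem allowed_insert {C : Set (ℤ × ℤ × ℕ)} {c : ℤ × ℤ × ℕ} {i : Fin 2} {k : ℕ × ℕ} :
    Allowed (insert c C) i k ↔ Allowed C i k ∧ Allowed {c} i k := by
  simp [Allowed, and_comm]

/-- The exponents that violate `c` are not resonant, and uniformly contracted, for the eigenvalues
`μ`. -/
def SpectralGap (C : Set (ℤ × ℤ × ℕ)) (c : ℤ × ℤ × ℕ) (μ : Fin 2 → 𝕜) : Prop :=
  ∃ s : Fin 2 → ℝ, (∀ j, ‖μ j‖ < s j) ∧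
    (∃ K, ∀ i k, Removed C c i k → s 0 ^ k.1 * s 1 ^ k.2 ≤ K) ∧
    ∃ δ > 0, ∀ i k, Removed C c i k → δ ≤ ‖μ i - powProd μ k‖

/-- If the exponents that violate `c` are uniformly contracted, they can be removed: the
transformation `h` with components `X + restrict (Removed C c) S` conjugates the map
`f = μ + ∑ₖ αₖ (x / 2) ᵏ` to the map `g` with components
`μ X + restrict (Allowed (insert c C)) S`. -/
theorem exists_conjugacy (C : Set (ℤ × ℤ × ℕ)) (c : ℤ × ℤ × ℕ) {μ₀ : Fin 2 → 𝕜} {s : Fin 2 → ℝ}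
    (hs : ∀ j, ‖μ₀ j‖ < s j) {K : ℝ}
    (hK : ∀ i k, Removed C c i k → s 0 ^ k.1 * s 1 ^ k.2 ≤ K) {δ : ℝ} (hδ : 0 < δ)
    (hres : ∀ i k, Removed C c i k → δ ≤ ‖μ₀ i - powProd μ₀ k‖) :
    ∃ S : (Fin 2 → 𝕜) × (Fin 2 → WienerAlgebra 𝕜) → Fin 2 → WienerAlgebra 𝕜,
      AnalyticAt 𝕜 S (μ₀, 0) ∧ S (μ₀, 0) = 0 ∧ ∀ᶠ π in 𝓝 (μ₀, 0),
        (∀ i, SupportedIn (Allowed C i) (π.2 i)) →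
        ‖fun j => (2 : 𝕜)⁻¹ • ((1 : 𝕜) • X 𝕜 j + restrict (Removed C c j) (S π j))‖ < 1 ∧
        ‖fun j => (s j : 𝕜)⁻¹ • (π.1 j • X 𝕜 j + restrict (Allowed (insert c C) j) (S π j))‖ < 1 ∧
        ∀ i, π.1 i • restrict (Removed C c i) (S π i) +
            aeval (fun j => (2 : 𝕜)⁻¹ • ((1 : 𝕜) • X 𝕜 j + restrict (Removed C c j) (S π j))) (π.2 i)
          = restrict (Allowed (insert c C) i) (S π i) +
            aeval (fun j => (s j : 𝕜)⁻¹ •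
                (π.1 j • X 𝕜 j + restrict (Allowed (insert c C) j) (S π j)))
              (diag (weightOn (Removed C c i) s) (S π i)) := by
  classical
  have hs0 : ∀ j, 0 < s j := fun j => (norm_nonneg _).trans_lt (hs j)
  let V := ((Fin 2 → 𝕜) × (Fin 2 → WienerAlgebra 𝕜)) × (Fin 2 → WienerAlgebra 𝕜)
  let y : V → Fin 2 → WienerAlgebra 𝕜 := fun p j =>
    (2 : 𝕜)⁻¹ • ((1 : 𝕜) • X 𝕜 j + restrict (Removed C c j) (p.2 j))
  let y' : V → Fin 2 → WienerAlgebra 𝕜 := fun p j =>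
    (s j : 𝕜)⁻¹ • (p.1.1 j • X 𝕜 j + restrict (Allowed (insert c C) j) (p.2 j))
  let w : Fin 2 → WienerAlgebra 𝕜 →L[𝕜] WienerAlgebra 𝕜 := fun i =>
    diag (weightOn (Removed C c i) s)
  -- One unknown encodes `h` on the removed exponents and `g` on those that satisfy all constraints.
  -- The third summand covers the remaining exponents, so that the linearization is invertible on
  -- the whole space.
  let Φ : V → Fin 2 → WienerAlgebra 𝕜 := fun p i =>
    p.1.1 i • restrict (Removed C c i) (p.2 i) - restrict (Allowed (insert c C) i) (p.2 i)
      + restrict (fun k => ¬ Allowed C i k) (p.2 i)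
      + aeval (y p) (p.1.2 i) - aeval (y' p) (w i (p.2 i))
  let e₀ : V := ((μ₀, 0), 0)
  have hμ : AnalyticAt 𝕜 (fun p : V => p.1.1) e₀ := analyticAt_fst.fun_comp analyticAt_fst
  have hα : AnalyticAt 𝕜 (fun p : V => p.1.2) e₀ := analyticAt_snd.fun_comp analyticAt_fst
  have hz : AnalyticAt 𝕜 (fun p : V => p.2) e₀ := analyticAt_snd
  have hy : AnalyticAt 𝕜 y e₀ := AnalyticAt.pi fun j =>
    analyticAt_const.fun_smul (analyticAt_const.fun_add
      ((restrict (Removed C c j)).map_analyticAt (hz.pi_apply j)))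
  have hy' : AnalyticAt 𝕜 y' e₀ := AnalyticAt.pi fun j =>
    analyticAt_const.fun_smul (((hμ.pi_apply j).fun_smul analyticAt_const).fun_add
      ((restrict (Allowed (insert c C) j)).map_analyticAt (hz.pi_apply j)))
  have hye : y e₀ = fun j => (2 : 𝕜)⁻¹ • ((1 : 𝕜) • X 𝕜 j + 0) := by
    funext j
    simp [y, e₀]
  have hye' : y' e₀ = fun j => (s j : 𝕜)⁻¹ • (μ₀ j • X 𝕜 j + 0) := by
    funext j
    simp [y', e₀]
  have hy1 : ‖y e₀‖ < 1 := by
    rw [hye]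
    refine norm_smul_X_lt (ν := fun _ => 1) (t := fun _ => (2 : 𝕜)⁻¹) fun j => ?_
    rw [mul_one, norm_inv, RCLike.norm_ofNat]
    norm_num
  have hy1' : ‖y' e₀‖ < 1 := by
    rw [hye']
    refine norm_smul_X_lt (t := fun j => (s j : 𝕜)⁻¹) fun j => ?_
    rw [norm_mul, norm_inv, RCLike.norm_ofReal, abs_of_pos (hs0 j), inv_mul_lt_one₀ (hs0 j)]
    exact hs j
  have hΦ : AnalyticAt 𝕜 Φ e₀ := AnalyticAt.pi fun i =>
    (((((hμ.pi_apply i).fun_smul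
      ((restrict (Removed C c i)).map_analyticAt (hz.pi_apply i))).fun_sub
      ((restrict (Allowed (insert c C) i)).map_analyticAt (hz.pi_apply i))).fun_add
      ((restrict fun k => ¬ Allowed C i k).map_analyticAt (hz.pi_apply i))).fun_add
      (hy.aeval (hα.pi_apply i) hy1)).fun_sub
      (hy'.aeval ((w i).map_analyticAt (hz.pi_apply i)) hy1')
  -- The entries of the linearization on the three classes of exponents; bounded by the bound on
  -- `sᵏ`, and away from `0` by nonresonance.
  let d : Fin 2 → ℕ × ℕ → 𝕜 := fun i k =>
    if Removed C c i k then μ₀ i - powProd μ₀ k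
    else if Allowed (insert c C) i k then -1 else 1
  have hd : ∀ i k, ‖d i k‖ ≤ max (‖μ₀ i‖ + K) 1 := fun i k => by
    simp only [d]
    split_ifs with h
    · refine le_max_of_le_left ((norm_sub_le _ _).trans (add_le_add_right ((?_ : _ ≤ _).trans
        (hK i k h)) _))
      rw [powProd, norm_mul, norm_pow, norm_pow]
      gcongr
      · exact pow_nonneg (hs0 0).le _
      · exact (hs 0).le
      · exact (hs 1).le
    · simp
    · simp
  have hdc : ∀ i k, min δ 1 ≤ ‖d i k‖ := fun i k => by
    simp only [d]
    split_ifs with h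
    · exact (min_le_left _ _).trans (hres i k h)
    · simp
    · simp
  have hδ1 : 0 < min δ 1 := lt_min hδ one_pos
  let D : (Fin 2 → WienerAlgebra 𝕜) ≃L[𝕜] (Fin 2 → WienerAlgebra 𝕜) :=
    ContinuousLinearEquiv.piCongrRight fun i => diagEquiv (hd i) hδ1 (hdc i)
  have hlin : ∀ i, μ₀ i • restrict (Removed C c i) - restrict (Allowed (insert c C) i)
      + restrict (fun k => ¬ Allowed C i k) - (aeval (y' e₀)).comp (w i) = diag (d i) := fun i => by
    have h := linearized_eq_diag (L := Removed C c i) (N := Allowed (insert c C) i)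
      (O := fun k => ¬ Allowed C i k) (μ := μ₀) (m := μ₀ i) hs (hK i) (hd i)
      (fun k hk => ⟨fun h => hk.2 (allowed_insert.1 h).2, fun h => h hk.1, if_pos hk⟩)
      (fun k hk => ⟨fun h => h.2 (allowed_insert.1 hk).2, fun h => h (allowed_insert.1 hk).1, by
        simp only [d]
        rw [if_neg (fun h : Removed C c i k => h.2 (allowed_insert.1 hk).2), if_pos hk]⟩)
      (fun k hk => ⟨fun h => hk h.1, fun h => hk (allowed_insert.1 h).1, by
        simp only [d]
        rw [if_neg (fun h : Removed C c i k => hk h.1), if_neg fun h => hk (allowed_insert.1 h).1]⟩)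
      (fun k => by
        rw [allowed_insert, Removed]
        tauto)
    rw [← h, hye']
    simp only [add_zero]
    rfl
  have hD : HasFDerivAt (fun z => Φ ((μ₀, 0), z))
      (D : (Fin 2 → WienerAlgebra 𝕜) →L[𝕜] (Fin 2 → WienerAlgebra 𝕜)) 0 := by
    rw [hasFDerivAt_pi']
    intro i
    have hlinD := ((μ₀ i • restrict (Removed C c i) - restrict (Allowed (insert c C) i)
      + restrict (fun k => ¬ Allowed C i k)).comp
        (ContinuousLinearMap.proj (R := 𝕜) (φ := fun _ : Fin 2 => WienerAlgebra 𝕜) i)).hasFDerivAt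
          (x := (0 : Fin 2 → WienerAlgebra 𝕜))
    have hw := ((w i).comp
      (ContinuousLinearMap.proj (R := 𝕜) (φ := fun _ : Fin 2 => WienerAlgebra 𝕜) i)).hasFDerivAt
        (x := (0 : Fin 2 → WienerAlgebra 𝕜))
    -- Product rule for `aeval (y' p) (w i z)`: the derivative of the first factor is applied to `w
    -- i 0 = 0` and drops out. The term with `aeval (y p)` is absent, since it is applied to the
    -- coefficients `0`.
    have hT : AnalyticAt 𝕜 (fun p => (aeval (y' p) : WienerAlgebra 𝕜 →L[𝕜] WienerAlgebra 𝕜)) e₀ :=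
      (analyticAt_aeval hy1').fun_comp hy'
    have hT' := hT.differentiableAt.hasFDerivAt.comp (0 : Fin 2 → WienerAlgebra 𝕜)
      (hasFDerivAt_prodMk_right (μ₀, (0 : Fin 2 → WienerAlgebra 𝕜)) (0 : Fin 2 → WienerAlgebra 𝕜))
    have htot := hlinD.sub (hT'.clm_apply hw)
    refine (htot.congr_of_eventuallyEq (Eventually.of_forall fun z => ?_)).congr_fderiv ?_
    · simp [Φ]
    · refine ContinuousLinearMap.ext fun z => ?_
      have h := congrArg (fun T : WienerAlgebra 𝕜 →L[𝕜] WienerAlgebra 𝕜 => T (z i)) (hlin i)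
      refine Eq.trans ?_ h
      simp [e₀]
  obtain ⟨S, hS, hS0, hSΦ⟩ := analyticAt_implicit (v := (μ₀, 0)) hΦ (by funext i; simp [Φ]) D hD
  refine ⟨S, hS, hS0, ?_⟩
  filter_upwards [hSΦ, eventually_norm_lt_of_analyticAt hy hS hS0 hy1,
    eventually_norm_lt_of_analyticAt hy' hS hS0 hy1'] with π hπ hlt hlt' hsupp
  refine ⟨hlt, hlt', fun i => ?_⟩
  have hi : π.1 i • restrict (Removed C c i) (S π i) - restrict (Allowed (insert c C) i) (S π i)
      + restrict (fun k => ¬ Allowed C i k) (S π i)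
      + aeval (y (π, S π)) (π.2 i) - aeval (y' (π, S π)) (w i (S π i)) = 0 := congrFun hπ i
  have hN : ∀ j, SupportedIn (Allowed C j) (restrict (Allowed (insert c C) j) (S π j)) := fun j =>
    (supportedIn_restrict _ _).mono fun k hk => (allowed_insert.1 hk).1
  have hL : ∀ j, SupportedIn (Allowed C j) (restrict (Removed C c j) (S π j)) := fun j =>
    (supportedIn_restrict _ _).mono fun k hk => hk.1
  have hw : SupportedIn (Allowed C i) (w i (S π i)) := fun k hk => by
    simp only [w] at hk
    rw [diag_apply (norm_weightOn_le (fun j => (hs0 j).le) (hK i))] at hk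
    by_contra h
    exact left_ne_zero_of_mul hk (if_neg fun h' => h h'.1)
  -- All other terms of the equation have allowed exponents only, so the auxiliary part must vanish.
  have hO : restrict (fun k => ¬ Allowed C i k) (S π i) = 0 := by
    refine DFunLike.ext _ _ fun k => ?_
    by_contra hk
    have h₁ : ¬ Allowed C i k := supportedIn_restrict _ _ k hk
    have h₂ : restrict (fun k => ¬ Allowed C i k) (S π i)
        = restrict (Allowed (insert c C) i) (S π i) + aeval (y' (π, S π)) (w i (S π i))
          - (π.1 i • restrict (Removed C c i) (S π i) + aeval (y (π, S π)) (π.2 i)) := by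
      rw [← sub_eq_zero, ← hi]
      abel
    rw [h₂] at hk
    exact h₁ ((((hN i).add (hw.aeval hN hlt'.le)).sub
      (((hL i).smul _).add ((hsupp i).aeval hL hlt.le))) k hk)
  rw [hO, add_zero] at hi
  rw [← sub_eq_zero]
  refine Eq.trans ?_ hi
  simp only [y, y', w]
  abel

end WienerAlgebra

section

open WienerAlgebra

variable {𝕜 : Type*} [RCLike 𝕜] {E : Type*} [NormedAddCommGroup E] [NormedSpace 𝕜 E]

/-! ### Tame families -/

/-- The family `f lam (x) = μ(lam) x + ∑ₖ aₖ(lam) (x / ρ) ᵏ` has exponents that satisfy the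
constraints `C`, and its coefficients are bounded; if `P` holds, they depend analytically on the
parameter. -/
def TameFamily (P : Prop) (C : Set (ℤ × ℤ × ℕ)) (μ : E → Fin 2 → 𝕜)
    (f : E → (Fin 2 → 𝕜) → Fin 2 → 𝕜) (lam0 : E) : Prop :=
  ContinuousAt μ lam0 ∧ (P → AnalyticAt 𝕜 μ lam0) ∧
  ∃ ρ : ℝ, 0 < ρ ∧ ∃ (a : E → Fin 2 → WienerAlgebra 𝕜) (K : ℝ), (P → AnalyticAt 𝕜 a lam0) ∧
    ∀ᶠ lam in 𝓝 lam0, ‖a lam‖ ≤ K ∧ (∀ i, SupportedIn (Allowed C i) (a lam i)) ∧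
      ∀ x : Fin 2 → 𝕜, ‖x‖ ≤ ρ → ∀ i,
        f lam x i = μ lam i * x i + aeval ((ρ : 𝕜)⁻¹ • x) (a lam i)

namespace TameFamily

variable {P : Prop} {C : Set (ℤ × ℤ × ℕ)} {μ : E → Fin 2 → 𝕜}
  {f : E → (Fin 2 → 𝕜) → Fin 2 → 𝕜} {lam0 : E}

theorem two_le_of_allowed (hC : (1, 1, 1) ∈ C) {i : Fin 2} {k : ℕ × ℕ} (h : Allowed C i k) :
    2 ≤ k.1 + k.2 := by
  have := h _ hC
  fin_cases i <;> simp [weight, unitExp] at this <;> omega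

theorem norm_inv_smul_le {ρ : ℝ} (hρ : 0 < ρ) {x : Fin 2 → 𝕜} (hx : ‖x‖ ≤ ρ) :
    ‖(ρ : 𝕜)⁻¹ • x‖ ≤ 1 := by
  rw [norm_smul, norm_inv, RCLike.norm_ofReal, abs_of_pos hρ]
  exact (inv_mul_le_one₀ hρ).2 hx

/-- Elements of order at least two are small at small arguments. -/
theorem norm_aeval_le_sq {a : WienerAlgebra 𝕜} (ha : ∀ k, a k ≠ 0 → 2 ≤ k.1 + k.2)
    {y : Fin 2 → 𝕜} (hy : ‖y‖ ≤ 1) : ‖aeval y a‖ ≤ ‖a‖ * ‖y‖ ^ 2 := by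
  rw [norm_eq_tsum, ← tsum_mul_right, ← (hasSum_aeval hy a).tsum_eq]
  refine tsum_of_norm_bounded ((a.summable_norm.mul_right _).hasSum) fun k => ?_
  rw [norm_smul]
  by_cases hk : a k = 0
  · simp [hk]
  · exact mul_le_mul_of_nonneg_left ((norm_powProd_le_pow (fun j => norm_le_pi_norm y j) k).trans
      (pow_le_pow_of_le_one (norm_nonneg _) hy (ha k hk))) (norm_nonneg _)

/-- After a change of scale the nonlinear part is small, on a large polydisk. -/
theorem rescale (hf : TameFamily P C μ f lam0) (hC : (1, 1, 1) ∈ C) {σ δ : ℝ} (hσ : 1 ≤ σ)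
    (hδ : 0 < δ) : ∃ ρ₀ > 0, ∀ ρ : ℝ, 0 < ρ → ρ ≤ ρ₀ →
      ∃ α : E → Fin 2 → WienerAlgebra 𝕜, (P → AnalyticAt 𝕜 α lam0) ∧
        ∀ᶠ lam in 𝓝 lam0, ‖α lam‖ < δ ∧ (∀ i, SupportedIn (Allowed C i) (α lam i)) ∧
          ∀ x : Fin 2 → 𝕜, ‖x‖ ≤ σ * ρ → ∀ i,
            f lam x i = μ lam i * x i + ρ * aeval ((σ : 𝕜)⁻¹ • (ρ : 𝕜)⁻¹ • x) (α lam i) := by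
  classical
  obtain ⟨-, -, r, hr, a, K, haP, ha⟩ := hf
  have hσ0 : 0 < σ := one_pos.trans_le hσ
  have hK : 0 < |K| + 1 := by positivity
  -- The first bound gives `σ ρ ≤ r`. The second gives `ρ⁻¹ (σ ρ / r)² (|K| + 1) ≤ δ / 2`; the
  -- square comes from the order of the nonlinear part.
  refine ⟨min (r / σ) (δ * r ^ 2 / (σ ^ 2 * (|K| + 1)) / 2), by positivity, fun ρ hρ hρle => ?_⟩
  have hρ₁ : σ * ρ ≤ r := by
    have := hρle.trans (min_le_left _ _)
    rwa [le_div_iff₀ hσ0, mul_comm] at this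
  set t : ℝ := σ * ρ / r with ht
  have ht0 : 0 < t := by positivity
  have ht1 : t ≤ 1 := (div_le_one hr).2 hρ₁
  -- Setting the multiplier to `0` in degrees below two loses nothing on these coefficients and
  -- gives the uniform bound `t ^ 2`.
  let d : ℕ × ℕ → 𝕜 := fun k => if 2 ≤ k.1 + k.2 then (t : 𝕜) ^ (k.1 + k.2) else 0
  have hd : ∀ k, ‖d k‖ ≤ t ^ 2 := fun k => by
    simp only [d]
    split_ifs with h
    · rw [norm_pow, RCLike.norm_ofReal, abs_of_pos ht0]
      exact pow_le_pow_of_le_one ht0.le ht1 h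
    · simpa using by positivity
  refine ⟨fun lam i => (ρ : 𝕜)⁻¹ • diag d (a lam i), fun hP => AnalyticAt.pi fun i =>
    analyticAt_const.fun_smul ((diag d).map_analyticAt ((haP hP).pi_apply i)), ?_⟩
  filter_upwards [ha] with lam ⟨hK', hsupp, hfx⟩
  refine ⟨(pi_norm_lt_iff hδ).2 fun i => ?_, fun i => ((hsupp i).diag hd).smul _,
    fun x hx i => ?_⟩
  · rw [norm_smul, norm_inv, RCLike.norm_ofReal, abs_of_pos hρ]
    have h₁ : ‖diag d (a lam i)‖ ≤ t ^ 2 * (|K| + 1) :=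
      (norm_diag_le hd _).trans (mul_le_mul_of_nonneg_left (((norm_le_pi_norm _ i).trans hK').trans
        ((le_abs_self K).trans (by linarith))) (by positivity))
    have h₂ := hρle.trans (min_le_right _ _)
    rw [inv_mul_lt_iff₀ hρ]
    refine h₁.trans_lt ?_
    rw [ht, div_pow, mul_pow]
    rw [div_div, le_div_iff₀ (by positivity)] at h₂
    rw [div_mul_eq_mul_div, div_lt_iff₀ (by positivity)]
    have : 0 < ρ * δ * r ^ 2 := by positivity
    nlinarith [mul_le_mul_of_nonneg_left h₂ hρ.le]
  · rw [hfx x (hx.trans hρ₁) i, map_smul, smul_eq_mul,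
      mul_inv_cancel_left₀ (RCLike.ofReal_ne_zero.2 hρ.ne')]
    congr 1
    refine (aeval_diag ?_ (norm_inv_smul_le hr (hx.trans hρ₁)) hd _ fun k hk => ?_).symm
    · rw [smul_smul, ← mul_inv, ← RCLike.ofReal_mul]
      exact norm_inv_smul_le (by positivity) hx
    · have h2 := two_le_of_allowed hC (hsupp i k hk)
      have hρ' : (ρ : 𝕜) ≠ 0 := RCLike.ofReal_ne_zero.2 hρ.ne'
      have hσ' : (σ : 𝕜) ≠ 0 := RCLike.ofReal_ne_zero.2 hσ0.ne'
      have hr' : (r : 𝕜) ≠ 0 := RCLike.ofReal_ne_zero.2 hr.ne'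
      have hd2 : d k = powProd (fun _ => (t : 𝕜)) k := by
        simp only [d, if_pos h2, powProd, pow_add]
      rw [hd2, smul_eq_mul, ← powProd_mul]
      congr 1
      funext j
      simp only [Pi.smul_apply, smul_eq_mul, ht]
      push_cast
      field_simp

/-- The converse of `rescale`. -/
theorem of_rescaled (hμ : ContinuousAt μ lam0) (hμP : P → AnalyticAt 𝕜 μ lam0) {ρ : ℝ} (hρ : 0 < ρ)
    {α : E → Fin 2 → WienerAlgebra 𝕜} (hα : P → AnalyticAt 𝕜 α lam0) {K : ℝ}
    (h : ∀ᶠ lam in 𝓝 lam0, ‖α lam‖ ≤ K ∧ (∀ i, SupportedIn (Allowed C i) (α lam i)) ∧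
      ∀ x : Fin 2 → 𝕜, ‖x‖ ≤ ρ → ∀ i,
        f lam x i = μ lam i * x i + ρ * aeval ((ρ : 𝕜)⁻¹ • x) (α lam i)) :
    TameFamily P C μ f lam0 := by
  refine ⟨hμ, hμP, ρ, hρ, fun lam => (ρ : 𝕜) • α lam, ρ * K,
    fun hP => analyticAt_const.fun_smul (hα hP), ?_⟩
  filter_upwards [h] with lam ⟨h₁, h₂, h₃⟩
  refine ⟨?_, fun i => (h₂ i).smul _, fun x hx i => ?_⟩
  · rw [norm_smul, RCLike.norm_ofReal, abs_of_pos hρ]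
    exact mul_le_mul_of_nonneg_left h₁ hρ.le
  · rw [h₃ x hx i, Pi.smul_apply, map_smul, smul_eq_mul]

/-- Allows identities between germs to be composed: an identity valid near `(lam0, 0)` may be used
at the image point. -/
theorem tendsto (hf : TameFamily P C μ f lam0) (hC : (1, 1, 1) ∈ C) :
    Tendsto (fun z : E × (Fin 2 → 𝕜) => (z.1, f z.1 z.2)) (𝓝 (lam0, 0)) (𝓝 (lam0, 0)) := by
  obtain ⟨hμ, -, r, hr, a, K, -, ha⟩ := hf
  refine Tendsto.prodMk_nhds continuous_fst.continuousAt ?_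
  have hx : Tendsto (fun z : E × (Fin 2 → 𝕜) => ‖z.2‖) (𝓝 (lam0, 0)) (𝓝 0) := by
    simpa using (continuous_snd.norm.tendsto (lam0, (0 : Fin 2 → 𝕜)))
  have hlam : Tendsto (fun z : E × (Fin 2 → 𝕜) => z.1) (𝓝 (lam0, 0)) (𝓝 lam0) :=
    continuous_fst.tendsto (lam0, (0 : Fin 2 → 𝕜))
  have hbd : Tendsto (fun z : E × (Fin 2 → 𝕜) => ‖μ z.1‖ * ‖z.2‖ + |K| * (r⁻¹ * ‖z.2‖) ^ 2)
      (𝓝 (lam0, 0)) (𝓝 0) := by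
    have := ((hμ.norm.tendsto.comp hlam).mul hx).add
      (((hx.const_mul r⁻¹).pow 2).const_mul |K|)
    simpa using this
  refine squeeze_zero_norm' ?_ hbd
  filter_upwards [hlam.eventually ha, hx.eventually (eventually_le_nhds hr)] with z ⟨h₁, h₂, h₃⟩ hz
  refine (pi_norm_le_iff_of_nonneg (by positivity)).2 fun i => ?_
  rw [h₃ z.2 hz i]
  refine (norm_add_le _ _).trans (add_le_add ?_ ?_)
  · rw [norm_mul]
    gcongr
    · exact norm_le_pi_norm _ i
    · exact norm_le_pi_norm _ i
  · refine (norm_aeval_le_sq (fun k hk => two_le_of_allowed hC (h₂ i k hk))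
      (norm_inv_smul_le hr hz)).trans ?_
    rw [norm_smul, norm_inv, RCLike.norm_ofReal, abs_of_pos hr]
    gcongr
    exact ((norm_le_pi_norm _ i).trans h₁).trans (le_abs_self K)

end TameFamily

/-! ### Composition, inversion and conjugation of tame families -/

namespace TameFamily

variable {P : Prop} {C : Set (ℤ × ℤ × ℕ)} {μ ν : E → Fin 2 → 𝕜}
  {f g : E → (Fin 2 → 𝕜) → Fin 2 → 𝕜} {lam0 : E}

theorem eventually_prod {E : Type*} [TopologicalSpace E] {lam0 : E} {ρ : ℝ} (hρ : 0 < ρ)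
    {Q : E → (Fin 2 → 𝕜) → Prop} (h : ∀ᶠ lam in 𝓝 lam0, ∀ x, ‖x‖ ≤ ρ → Q lam x) :
    ∀ᶠ z : E × (Fin 2 → 𝕜) in 𝓝 (lam0, 0), Q z.1 z.2 := by
  have hx : ∀ᶠ x : Fin 2 → 𝕜 in 𝓝 0, ‖x‖ ≤ ρ := by
    filter_upwards [Metric.closedBall_mem_nhds (0 : Fin 2 → 𝕜) hρ] with x hx
    simpa using hx
  rw [nhds_prod_eq]
  filter_upwards [h.prod_mk hx] with z hz
  exact hz.1 _ hz.2

/-- Evaluation of a rescaled map whose linear part is diagonal. -/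
theorem aeval_linear_add {ρ : ℝ} (hρ : 0 < ρ) {x : Fin 2 → 𝕜} (hx : ‖x‖ ≤ ρ) (t m : 𝕜)
    (b : WienerAlgebra 𝕜) (j : Fin 2) :
    aeval ((ρ : 𝕜)⁻¹ • x) (t • (m • X 𝕜 j + b))
      = t * (ρ : 𝕜)⁻¹ * (m * x j + ρ * aeval ((ρ : 𝕜)⁻¹ • x) b) := by
  have hρ' : (ρ : 𝕜) ≠ 0 := RCLike.ofReal_ne_zero.2 hρ.ne'
  rw [map_smul, map_add, map_smul, aeval_X (norm_inv_smul_le hρ hx)]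
  simp only [Pi.smul_apply, smul_eq_mul]
  field_simp

theorem comp (hf : TameFamily P C μ f lam0) (hg : TameFamily P C ν g lam0) (hC : (1, 1, 1) ∈ C) :
    TameFamily P C (fun lam i => μ lam i * ν lam i) (fun lam x => f lam (g lam x)) lam0 := by
  obtain ⟨hμ, hμP, r, hr, a, K, haP, ha⟩ := hf
  obtain ⟨ρ₀, hρ₀, hres⟩ := hg.rescale hC le_rfl one_pos
  obtain ⟨hν, hνP, -⟩ := hg
  -- One unit of slack is for the variation of `ν`, the other for the nonlinear part of norm less
  -- than `1`. With `ρ M ≤ r / 2` the inner map then stays in the domain of the outer expansion.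
  set M : ℝ := ‖ν lam0‖ + 2 with hM
  have hM0 : 0 < M := by positivity
  set ρ : ℝ := min ρ₀ (r / (2 * M)) with hρdef
  have hρ : 0 < ρ := by positivity
  have hρr : ρ * M ≤ r / 2 := by
    have := min_le_right ρ₀ (r / (2 * M))
    rw [← hρdef, le_div_iff₀ (by positivity)] at this
    linarith
  obtain ⟨β, hβP, hβ⟩ := hres ρ hρ (min_le_left _ _)
  let y : E → Fin 2 → WienerAlgebra 𝕜 := fun lam j =>
    ((r : 𝕜)⁻¹ * ρ) • (ν lam j • X 𝕜 j + β lam j)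
  have hνlt : ∀ᶠ lam in 𝓝 lam0, ‖ν lam‖ < ‖ν lam0‖ + 1 :=
    hν.norm.eventually_lt_const (lt_add_one _)
  have hμlt : ∀ᶠ lam in 𝓝 lam0, ‖μ lam‖ < ‖μ lam0‖ + 1 :=
    hμ.norm.eventually_lt_const (lt_add_one _)
  have hy : ∀ᶠ lam in 𝓝 lam0, ‖y lam‖ < 1 := by
    filter_upwards [hβ, hνlt] with lam ⟨hβ₁, _⟩ hν₁
    refine (pi_norm_lt_iff one_pos).2 fun j => ?_
    rw [norm_smul, norm_mul, norm_inv, RCLike.norm_ofReal, RCLike.norm_ofReal, abs_of_pos hr,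
      abs_of_pos hρ, mul_assoc, inv_mul_lt_one₀ hr]
    have h₁ : ‖ν lam j • X 𝕜 j + β lam j‖ ≤ M := by
      refine (norm_add_le _ _).trans ?_
      rw [norm_smul, norm_X, mul_one]
      have := norm_le_pi_norm (ν lam) j
      have := norm_le_pi_norm (β lam) j
      linarith
    have := mul_le_mul_of_nonneg_left h₁ hρ.le
    linarith
  have hyP : P → AnalyticAt 𝕜 y lam0 := fun hP => AnalyticAt.pi fun j =>
    analyticAt_const.fun_smul ((((hνP hP).pi_apply j).fun_smul analyticAt_const).fun_add
      ((hβP hP).pi_apply j))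
  refine ⟨?_, fun hP => AnalyticAt.pi fun i => ((hμP hP).pi_apply i).fun_mul ((hνP hP).pi_apply i),
    ρ, hρ, fun lam i => (μ lam i * ρ) • β lam i + aeval (y lam) (a lam i),
    (‖μ lam0‖ + 1) * ρ + K, fun hP => AnalyticAt.pi fun i =>
      ((((hμP hP).pi_apply i).fun_mul analyticAt_const).fun_smul ((hβP hP).pi_apply i)).fun_add
        ((hyP hP).aeval ((haP hP).pi_apply i) hy.self_of_nhds), ?_⟩
  · exact continuousAt_pi.2 fun i => (continuousAt_pi.1 hμ i).mul (continuousAt_pi.1 hν i)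
  filter_upwards [ha, hβ, hy, hμlt] with lam ⟨ha₁, ha₂, ha₃⟩ ⟨hβ₁, hβ₂, hβ₃⟩ hy₁ hμ₁
  have hK0 : 0 ≤ K := (norm_nonneg _).trans ha₁
  refine ⟨(pi_norm_le_iff_of_nonneg (by positivity)).2 fun i => ?_, fun i =>
    ((hβ₂ i).smul _).add ((ha₂ i).aeval hβ₂ hy₁.le), fun x hx i => ?_⟩
  · refine (norm_add_le _ _).trans (add_le_add ?_ ((norm_aeval_le hy₁.le _).trans
      ((norm_le_pi_norm _ i).trans ha₁)))
    rw [norm_smul, norm_mul, RCLike.norm_ofReal, abs_of_pos hρ]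
    have h₁ := (norm_le_pi_norm (μ lam) i).trans hμ₁.le
    have h₂ := (norm_le_pi_norm (β lam) i).trans hβ₁.le
    calc ‖μ lam i‖ * ρ * ‖β lam i‖ ≤ (‖μ lam0‖ + 1) * ρ * 1 := by gcongr
      _ = _ := mul_one _
  · have hv := norm_inv_smul_le hρ hx
    have hgx : ∀ j, g lam x j = ν lam j * x j + ρ * aeval ((ρ : 𝕜)⁻¹ • x) (β lam j) := fun j => by
      simpa using hβ₃ x (by simpa using hx) j
    have hρ' : (ρ : 𝕜) ≠ 0 := RCLike.ofReal_ne_zero.2 hρ.ne'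
    have hr' : (r : 𝕜) ≠ 0 := RCLike.ofReal_ne_zero.2 hr.ne'
    have hyv : (fun j => aeval ((ρ : 𝕜)⁻¹ • x) (y lam j)) = (r : 𝕜)⁻¹ • g lam x := by
      funext j
      simp only [y, aeval_linear_add hρ hx, Pi.smul_apply, smul_eq_mul, hgx]
      field_simp
    have hgr : ‖g lam x‖ ≤ r := by
      have := norm_aeval_pi_le hv hy₁.le
      rw [hyv, norm_smul, norm_inv, RCLike.norm_ofReal, abs_of_pos hr] at this
      exact (inv_mul_le_one₀ hr).1 this
    rw [ha₃ _ hgr i, ← hyv, ← aeval_aeval hv hy₁.le, hgx, map_add, map_smul, smul_eq_mul]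
    ring

/-- Rescaling makes the coefficients small enough for the implicit function of
`WienerAlgebra.exists_inverse`; its equation is then evaluated at points. -/
theorem exists_rightInverse (hf : TameFamily P C μ f lam0) (hC : (1, 1, 1) ∈ C)
    (hμ0 : ∀ i, μ lam0 i ≠ 0) : ∃ F : E → (Fin 2 → 𝕜) → Fin 2 → 𝕜,
      TameFamily P C (fun lam i => (μ lam i)⁻¹) F lam0 ∧
      ∀ᶠ z : E × (Fin 2 → 𝕜) in 𝓝 (lam0, 0), f z.1 (F z.1 z.2) = z.2 := by
  have hμ := hf.1
  have hμP := hf.2.1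
  set ν : E → Fin 2 → 𝕜 := fun lam i => (μ lam i)⁻¹ with hνdef
  have hν : ContinuousAt ν lam0 :=
    continuousAt_pi.2 fun i => (continuousAt_pi.1 hμ i).inv₀ (hμ0 i)
  have hνP : P → AnalyticAt 𝕜 ν lam0 := fun hP =>
    AnalyticAt.pi fun i => ((hμP hP).pi_apply i).fun_inv (hμ0 i)
  set σ : ℝ := ‖ν lam0‖ + 1 with hσdef
  have hσ0 : 0 < σ := by positivity
  obtain ⟨S, hS, hS0, hSeq⟩ := exists_inverse C (ν₀ := ν lam0) (σ := σ) fun j =>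
    (norm_le_pi_norm _ j).trans_lt (lt_add_one _)
  have hSlt : ∀ᶠ π in 𝓝 (ν lam0, (0 : Fin 2 → WienerAlgebra 𝕜)), ‖S π‖ < 1 :=
    hS.continuousAt.norm.eventually_lt_const (by simp [hS0])
  -- A ball in the space of eigenvalues and coefficients, independent of `lam`. The coefficients at
  -- `lam0` are small but need not vanish, hence analyticity of `S` is recorded on the whole ball.
  obtain ⟨δ, hδ, hball⟩ := Metric.eventually_nhds_iff.1
    (hSeq.and (hSlt.and hS.eventually_analyticAt))
  obtain ⟨ρ, hρ, hres⟩ := hf.rescale hC (σ := σ) (by simp [hσdef]) hδ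
  obtain ⟨α, hαP, hα⟩ := hres ρ hρ le_rfl
  have hnear : ∀ᶠ lam in 𝓝 lam0, dist (ν lam, α lam) (ν lam0, 0) < δ := by
    filter_upwards [hα, Metric.continuousAt_iff'.1 hν δ hδ] with lam h₁ h₂
    rw [Prod.dist_eq]
    exact max_lt h₂ (by simpa using h₁.1)
  refine ⟨fun lam x i => ν lam i * x i + ρ * aeval ((ρ : 𝕜)⁻¹ • x) (S (ν lam, α lam) i),
    of_rescaled (K := 1) hν hνP hρ (α := fun lam => S (ν lam, α lam)) (fun hP => ?_) ?_, ?_⟩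
  · exact AnalyticAt.fun_comp (g := S) (f := fun lam => (ν lam, α lam))
      (hball hnear.self_of_nhds).2.2 ((hνP hP).prod (hαP hP))
  · filter_upwards [hα, hnear] with lam h₁ h₂
    exact ⟨(hball h₂).2.1.le, ((hball h₂).1 h₁.2.1).1, fun x _ i => rfl⟩
  · refine eventually_prod (Q := fun lam x => f lam (fun i =>
      ν lam i * x i + ρ * aeval ((ρ : 𝕜)⁻¹ • x) (S (ν lam, α lam) i)) = x) hρ ?_
    filter_upwards [hα, hnear, (continuousAt_pi.1 hμ 0).eventually_ne (hμ0 0),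
      (continuousAt_pi.1 hμ 1).eventually_ne (hμ0 1)] with lam ⟨_, hα₂, hα₃⟩ h₂ hm₀ hm₁ x hx
    obtain ⟨-, hy, heq⟩ := (hball h₂).1 hα₂
    have hm : ∀ i, μ lam i ≠ 0 := Fin.forall_fin_two.2 ⟨hm₀, hm₁⟩
    have hv := norm_inv_smul_le hρ hx
    have hρ' : (ρ : 𝕜) ≠ 0 := RCLike.ofReal_ne_zero.2 hρ.ne'
    have hσ' : (σ : 𝕜) ≠ 0 := RCLike.ofReal_ne_zero.2 hσ0.ne'
    set Fx : Fin 2 → 𝕜 := fun i =>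
      ν lam i * x i + ρ * aeval ((ρ : 𝕜)⁻¹ • x) (S (ν lam, α lam) i) with hFx
    have hyv : (fun j => aeval ((ρ : 𝕜)⁻¹ • x)
        ((σ : 𝕜)⁻¹ • (ν lam j • X 𝕜 j + S (ν lam, α lam) j))) = (σ : 𝕜)⁻¹ • (ρ : 𝕜)⁻¹ • Fx := by
      funext j
      simp only [aeval_linear_add hρ hx, Pi.smul_apply, smul_eq_mul, hFx]
      ring
    have hFr : ‖Fx‖ ≤ σ * ρ := by
      have := norm_aeval_pi_le hv hy.le
      rw [hyv, smul_smul, ← mul_inv, ← RCLike.ofReal_mul, norm_smul, norm_inv, RCLike.norm_ofReal,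
        abs_of_pos (by positivity)] at this
      exact (inv_mul_le_one₀ (by positivity)).1 this
    funext i
    have hz := congrArg (aeval ((ρ : 𝕜)⁻¹ • x)) (heq i)
    rw [map_add, map_smul, aeval_aeval hv hy.le, hyv, map_zero, smul_eq_mul] at hz
    rw [hα₃ Fx hFr i]
    have h1 : μ lam i * ν lam i = 1 := mul_inv_cancel₀ (hm i)
    simp only at hz
    have h3 : μ lam i * Fx i = x i + ρ * (μ lam i * aeval ((ρ : 𝕜)⁻¹ • x) (S (ν lam, α lam) i)) := by
      simp only [hFx]
      linear_combination (x i) * h1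
    rw [h3]
    linear_combination (ρ * μ lam i) * hz - ρ * aeval ((σ : 𝕜)⁻¹ • (ρ : 𝕜)⁻¹ • Fx) (α lam i) * h1

/-- A right inverse `F` of `f` has a right inverse `G` itself; then `f = f ∘ F ∘ G = G` near the
origin, so `F` is also a left inverse. -/
theorem exists_inverse (hf : TameFamily P C μ f lam0) (hC : (1, 1, 1) ∈ C)
    (hμ0 : ∀ i, μ lam0 i ≠ 0) : ∃ F : E → (Fin 2 → 𝕜) → Fin 2 → 𝕜,
      TameFamily P C (fun lam i => (μ lam i)⁻¹) F lam0 ∧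
      ∀ᶠ z : E × (Fin 2 → 𝕜) in 𝓝 (lam0, 0),
        f z.1 (F z.1 z.2) = z.2 ∧ F z.1 (f z.1 z.2) = z.2 := by
  obtain ⟨F, hF, hfF⟩ := hf.exists_rightInverse hC hμ0
  obtain ⟨G, hG, hFG⟩ := hF.exists_rightInverse hC fun i => inv_ne_zero (hμ0 i)
  refine ⟨F, hF, ?_⟩
  filter_upwards [hfF, hFG, (hG.tendsto hC).eventually hfF] with z h₁ h₂ h₃
  refine ⟨h₁, ?_⟩
  simp only [h₂] at h₃
  rw [h₃, h₂]

/-- Transfers the solution of the coefficient equation to maps by evaluating it on a small polydisk.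
-/
theorem exists_conjugacy (hf : TameFamily P C μ f lam0) (hC : (1, 1, 1) ∈ C) {c : ℤ × ℤ × ℕ}
    (hgap : SpectralGap C c (μ lam0)) : ∃ h g : E → (Fin 2 → 𝕜) → Fin 2 → 𝕜,
      TameFamily P C (fun _ _ => 1) h lam0 ∧ TameFamily P (insert c C) μ g lam0 ∧
      ∀ᶠ z : E × (Fin 2 → 𝕜) in 𝓝 (lam0, 0), f z.1 (h z.1 z.2) = h z.1 (g z.1 z.2) := by
  have hμ := hf.1
  have hμP := hf.2.1
  obtain ⟨s, hs, ⟨K, hK⟩, δ', hδ', hδ''⟩ := hgap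
  have hs0 : ∀ j, 0 < s j := fun j => (norm_nonneg _).trans_lt (hs j)
  obtain ⟨S, hS, hS0, hSeq⟩ := WienerAlgebra.exists_conjugacy C c hs hK hδ' hδ''
  have hSlt : ∀ᶠ π in 𝓝 (μ lam0, (0 : Fin 2 → WienerAlgebra 𝕜)), ‖S π‖ < 1 :=
    hS.continuousAt.norm.eventually_lt_const (by simp [hS0])
  obtain ⟨δ, hδ, hball⟩ := Metric.eventually_nhds_iff.1
    (hSeq.and (hSlt.and hS.eventually_analyticAt))
  -- The factor `2` leaves room for `h`, a small perturbation of the identity, to map the polydisk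
  -- of radius `ρ` into the domain of `f`.
  obtain ⟨ρ, hρ, hres⟩ := hf.rescale hC (σ := 2) one_le_two hδ
  obtain ⟨α, hαP, hα⟩ := hres ρ hρ le_rfl
  have hnear : ∀ᶠ lam in 𝓝 lam0, dist (μ lam, α lam) (μ lam0, 0) < δ := by
    filter_upwards [hα, Metric.continuousAt_iff'.1 hμ δ hδ] with lam h₁ h₂
    rw [Prod.dist_eq]
    exact max_lt h₂ (by simpa using h₁.1)
  have hSP : P → AnalyticAt 𝕜 (fun lam => S (μ lam, α lam)) lam0 := fun hP =>
    AnalyticAt.fun_comp (g := S) (f := fun lam => (μ lam, α lam))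
      (hball hnear.self_of_nhds).2.2 ((hμP hP).prod (hαP hP))
  let β : E → Fin 2 → WienerAlgebra 𝕜 := fun lam i =>
    restrict (Removed C c i) (S (μ lam, α lam) i)
  let γ : E → Fin 2 → WienerAlgebra 𝕜 := fun lam i =>
    restrict (Allowed (insert c C) i) (S (μ lam, α lam) i)
  let h : E → (Fin 2 → 𝕜) → Fin 2 → 𝕜 := fun lam x i =>
    1 * x i + ρ * aeval ((ρ : 𝕜)⁻¹ • x) (β lam i)
  let g : E → (Fin 2 → 𝕜) → Fin 2 → 𝕜 := fun lam x i =>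
    μ lam i * x i + ρ * aeval ((ρ : 𝕜)⁻¹ • x) (γ lam i)
  have hh : TameFamily P C (fun _ _ => 1) h lam0 := by
    refine of_rescaled (K := 1) continuousAt_const (fun _ => analyticAt_const) hρ (α := β)
      (fun hP => AnalyticAt.pi fun i => (restrict _).map_analyticAt ((hSP hP).pi_apply i)) ?_
    filter_upwards [hnear] with lam h₂
    exact ⟨(pi_norm_le_iff_of_nonneg zero_le_one).2 fun i => (norm_restrict_le _ _).trans
      ((norm_le_pi_norm _ i).trans (hball h₂).2.1.le),
      fun i => (supportedIn_restrict _ _).mono fun k hk => hk.1, fun x _ i => rfl⟩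
  have hg : TameFamily P (insert c C) μ g lam0 := by
    refine of_rescaled (K := 1) hμ hμP hρ (α := γ)
      (fun hP => AnalyticAt.pi fun i => (restrict _).map_analyticAt ((hSP hP).pi_apply i)) ?_
    filter_upwards [hnear] with lam h₂
    exact ⟨(pi_norm_le_iff_of_nonneg zero_le_one).2 fun i => (norm_restrict_le _ _).trans
      ((norm_le_pi_norm _ i).trans (hball h₂).2.1.le),
      fun i => supportedIn_restrict _ _, fun x _ i => rfl⟩
  refine ⟨h, g, hh, hg, ?_⟩
  have hgsmall : ∀ᶠ z : E × (Fin 2 → 𝕜) in 𝓝 (lam0, 0), ‖g z.1 z.2‖ ≤ ρ :=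
    (hg.tendsto (Set.mem_insert_of_mem _ hC)).eventually
      (eventually_prod (Q := fun _ x => ‖x‖ ≤ ρ) hρ (Eventually.of_forall fun _ _ hx => hx))
  refine (hgsmall.and (eventually_prod (Q := fun lam x => ‖g lam x‖ ≤ ρ →
    f lam (h lam x) = h lam (g lam x)) hρ ?_)).mono fun z hz => hz.2 hz.1
  filter_upwards [hα, hnear] with lam ⟨_, hα₂, hα₃⟩ h₂ x hx hgρ
  obtain ⟨hy, hy', heq⟩ := (hball h₂).1 hα₂
  have hv := norm_inv_smul_le hρ hx
  have hρ' : (ρ : 𝕜) ≠ 0 := RCLike.ofReal_ne_zero.2 hρ.ne'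
  have hyv : (fun j => aeval ((ρ : 𝕜)⁻¹ • x) ((2 : 𝕜)⁻¹ • ((1 : 𝕜) • X 𝕜 j + β lam j)))
      = ((2 : ℝ) : 𝕜)⁻¹ • (ρ : 𝕜)⁻¹ • h lam x := by
    funext j
    simp only [aeval_linear_add hρ hx, Pi.smul_apply, smul_eq_mul, h, RCLike.ofReal_ofNat]
    ring
  have hyv' : ∀ j, aeval ((ρ : 𝕜)⁻¹ • x) ((s j : 𝕜)⁻¹ • (μ lam j • X 𝕜 j + γ lam j))
      = (s j : 𝕜)⁻¹ * ((ρ : 𝕜)⁻¹ • g lam x) j := fun j => by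
    simp only [aeval_linear_add hρ hx, Pi.smul_apply, smul_eq_mul, g]
    ring
  have hhr : ‖h lam x‖ ≤ 2 * ρ := by
    have := norm_aeval_pi_le hv hy.le
    rw [hyv, smul_smul, ← mul_inv, ← RCLike.ofReal_mul, norm_smul, norm_inv, RCLike.norm_ofReal,
      abs_of_pos (by positivity)] at this
    exact (inv_mul_le_one₀ (by positivity)).1 this
  funext i
  -- The factors `sᵏ` in the coefficients cancel the factors `s⁻¹` in the argument. This is where
  -- the formal substitution becomes the actual value of `h` at `g lam x`.
  have hw : aeval (fun j => aeval ((ρ : 𝕜)⁻¹ • x) ((s j : 𝕜)⁻¹ • (μ lam j • X 𝕜 j + γ lam j)))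
        (diag (weightOn (Removed C c i) s) (S (μ lam, α lam) i))
      = aeval ((ρ : 𝕜)⁻¹ • g lam x) (β lam i) := by
    classical
    have hwle := norm_weightOn_le (𝕜 := 𝕜) (fun j => (hs0 j).le) (hK i)
    have hwr : diag (weightOn (Removed C c i) s) (S (μ lam, α lam) i)
        = diag (weightOn (Removed C c i) s) (β lam i) := by
      refine DFunLike.ext _ _ fun k => ?_
      rw [diag_apply hwle, diag_apply hwle]
      simp only [β, restrict_apply, weightOn]
      split_ifs <;> simp
    rw [hwr]
    refine aeval_diag (norm_aeval_pi_le hv hy'.le) (norm_inv_smul_le hρ hgρ) hwle _ fun k hk => ?_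
    have hR : Removed C c i k := supportedIn_restrict _ _ k hk
    rw [weightOn, if_pos hR, smul_eq_mul, ← powProd_mul]
    congr 1
    funext j
    rw [hyv' j, mul_inv_cancel_left₀ (RCLike.ofReal_ne_zero.2 (hs0 j).ne')]
  have hz := congrArg (aeval ((ρ : 𝕜)⁻¹ • x)) (heq i)
  rw [map_add, map_add, aeval_aeval hv hy.le, aeval_aeval hv hy'.le, map_smul, smul_eq_mul] at hz
  rw [hα₃ _ hhr i, ← hyv]
  change _ = 1 * g lam x i + ρ * aeval ((ρ : 𝕜)⁻¹ • g lam x) (β lam i)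
  rw [← hw]
  change _ = 1 * (μ lam i * x i + ρ * aeval ((ρ : 𝕜)⁻¹ • x) (γ lam i)) + _
  change μ lam i * (1 * x i + ρ * aeval ((ρ : 𝕜)⁻¹ • x) (β lam i)) + _ = _
  linear_combination (ρ : 𝕜) * hz

end TameFamily

/-! ### Normal forms -/

namespace TameFamily

variable {P : Prop} {C C' : Set (ℤ × ℤ × ℕ)} {μ ν : E → Fin 2 → 𝕜}
  {f g : E → (Fin 2 → 𝕜) → Fin 2 → 𝕜} {lam0 : E}

theorem mono (hf : TameFamily P C μ f lam0) (h : C' ⊆ C) : TameFamily P C' μ f lam0 := by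
  obtain ⟨hμ, hμP, r, hr, a, K, haP, ha⟩ := hf
  refine ⟨hμ, hμP, r, hr, a, K, haP, ha.mono fun lam hlam => ⟨hlam.1, fun i => ?_, hlam.2.2⟩⟩
  exact (hlam.2.1 i).mono fun k hk c hc => hk c (h hc)

/-- Two constraints of which one is violated by contracted exponents only, and the other one by
expanded exponents only, can both be achieved by a change of variables. -/
theorem exists_normalForm (hf : TameFamily P C μ f lam0) (hC : (1, 1, 1) ∈ C)
    (hμ0 : ∀ i, μ lam0 i ≠ 0) {c c' : ℤ × ℤ × ℕ} (hgap : SpectralGap C c (μ lam0))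
    (hgap' : SpectralGap (insert c C) c' fun i => (μ lam0 i)⁻¹) :
    ∃ h hinv g : E → (Fin 2 → 𝕜) → Fin 2 → 𝕜,
      TameFamily P C (fun _ _ => 1) h lam0 ∧ TameFamily P C (fun _ _ => 1) hinv lam0 ∧
      TameFamily P (insert c' (insert c C)) μ g lam0 ∧
      (∀ᶠ z : E × (Fin 2 → 𝕜) in 𝓝 (lam0, 0),
        hinv z.1 (h z.1 z.2) = z.2 ∧ h z.1 (hinv z.1 z.2) = z.2) ∧
      ∀ᶠ z : E × (Fin 2 → 𝕜) in 𝓝 (lam0, 0), g z.1 z.2 = hinv z.1 (f z.1 (h z.1 z.2)) := by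
  have hC₁ : (1, 1, 1) ∈ insert c C := Set.mem_insert_of_mem _ hC
  have hC₂ : (1, 1, 1) ∈ insert c' (insert c C) := Set.mem_insert_of_mem _ hC₁
  obtain ⟨h₁, g₁, hh₁, hg₁, hconj₁⟩ := hf.exists_conjugacy hC hgap
  -- The second conjugation acts on the inverse of `g₁`, for which the violating exponents are the
  -- contracted ones. It starts from `insert c C`, so the constraint already achieved is kept.
  obtain ⟨F, hF, hgF⟩ := hg₁.exists_inverse hC₁ hμ0
  obtain ⟨h₂, G, hh₂, hG, hconj₂⟩ := hF.exists_conjugacy hC₁ hgap'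
  obtain ⟨g, hg, hGg⟩ := hG.exists_inverse hC₂ fun i => inv_ne_zero (hμ0 i)
  simp only [inv_inv] at hg
  have hh := hh₁.comp (hh₂.mono (Set.subset_insert _ _)) hC
  simp only [mul_one] at hh
  obtain ⟨hinv, hhinv, hhh⟩ := hh.exists_inverse hC fun _ => one_ne_zero
  simp only [inv_one] at hhinv
  refine ⟨_, hinv, g, hh, hhinv, hg, hhh.mono fun z hz => ⟨hz.2, hz.1⟩, ?_⟩
  have t₂ := hh₂.tendsto hC₁
  have tg := hg.tendsto hC₂
  filter_upwards [t₂.eventually hconj₁, tg.eventually hhh, tg.eventually hconj₂, hGg,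
    (t₂.comp tg).eventually hgF] with z e₁ e₂ e₃ e₄ e₅
  simp only [Function.comp_apply] at e₁ e₂ e₃ e₄ e₅
  rw [e₄.1] at e₃
  rw [e₃] at e₅
  rw [e₁, e₅.1, e₂.2]

end TameFamily

/-! ### Return from coefficient sequences to analytic families on `𝕜 × 𝕜` -/

/-- The family `G` of functions of two variables has an absolutely convergent expansion with bounded
coefficients; if `P` holds, they depend analytically on the parameter. -/
def HasWienerExpansion (P : Prop) (G : E → 𝕜 × 𝕜 → 𝕜) (lam0 : E) : Prop :=
  ∃ (t : Fin 2 → 𝕜) (ρ : ℝ) (c : E → WienerAlgebra 𝕜) (K : ℝ), 0 < ρ ∧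
    (P → AnalyticAt 𝕜 c lam0) ∧
    ∀ᶠ lam in 𝓝 lam0, ‖c lam‖ ≤ K ∧
      ∀ x : 𝕜 × 𝕜, ‖x‖ ≤ ρ → G lam x = aeval (fun j => t j * ![x.1, x.2] j) (c lam)

namespace HasWienerExpansion

variable {P : Prop} {G : E → 𝕜 × 𝕜 → 𝕜} {lam0 : E}

theorem norm_le_of_prod (x : 𝕜 × 𝕜) (j : Fin 2) : ‖![x.1, x.2] j‖ ≤ ‖x‖ := by
  fin_cases j
  · exact norm_fst_le x
  · exact norm_snd_le x

theorem summable_half_pow : Summable fun k : ℕ × ℕ => (1 / 2 : ℝ) ^ (k.1 + k.2) := by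
  have h := summable_geometric_two
  simpa only [pow_add] using h.mul_of_nonneg h (fun _ => by positivity) (fun _ => by positivity)

theorem isAnalyticFamily (hG : HasWienerExpansion P G lam0) : IsAnalyticFamily G lam0 := by
  obtain ⟨t, ρ, c, K, hρ, -, hc⟩ := hG
  set T : ℝ := ‖t‖ + 1 with hT
  have hT0 : 0 < T := by positivity
  have htT : ∀ j, ‖t j‖ ≤ T := fun j => (norm_le_pi_norm t j).trans (by linarith)
  -- On the radius `1 / (2 T)` the bounds `T ^ |k| * |K|` are dominated by `|K| * (1 / 2) ^ |k|`.
  refine ⟨fun k lam => powProd t k * c lam k, min ρ (1 / (2 * T)), by positivity,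
    fun k => T ^ (k.1 + k.2) * |K|, ?_, ?_⟩
  · refine Summable.of_nonneg_of_le (fun k => by positivity) (fun k => ?_)
      (summable_half_pow.mul_left |K|)
    calc T ^ (k.1 + k.2) * |K| * min ρ (1 / (2 * T)) ^ (k.1 + k.2)
        ≤ T ^ (k.1 + k.2) * |K| * (1 / (2 * T)) ^ (k.1 + k.2) := by
          gcongr
          exact min_le_right _ _
      _ = |K| * (T * (1 / (2 * T))) ^ (k.1 + k.2) := by rw [mul_pow]; ring
      _ = |K| * (1 / 2) ^ (k.1 + k.2) := by
          congr 2
          field_simp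
  · filter_upwards [hc] with lam ⟨hK, hx⟩
    refine ⟨fun k => ?_, fun x hxr => ?_⟩
    · rw [norm_mul]
      have h₁ := norm_powProd_le_pow htT k
      have h₂ := ((norm_apply_le (c lam) k).trans hK).trans (le_abs_self K)
      gcongr
    · rw [hx x (hxr.trans (min_le_left _ _))]
      have hle : ‖fun j => t j * ![x.1, x.2] j‖ ≤ 1 := by
        refine (pi_norm_le_iff_of_nonneg zero_le_one).2 fun j => ?_
        rw [norm_mul]
        calc ‖t j‖ * ‖![x.1, x.2] j‖ ≤ T * (1 / (2 * T)) := by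
              gcongr
              · exact htT j
              · exact (norm_le_of_prod x j).trans (hxr.trans (min_le_right _ _))
          _ = 1 / 2 := by field_simp
          _ ≤ 1 := by norm_num
      refine (hasSum_aeval hle (c lam)).congr_fun fun k => ?_
      rw [powProd_mul]
      simp only [powProd, Matrix.cons_val_zero, Matrix.cons_val_one, smul_eq_mul]
      ring

theorem dependsAnalytically (hG : HasWienerExpansion P G lam0) (hP : P) :
    DependsAnalytically G lam0 := by
  obtain ⟨t, ρ, c, K, hρ, hcP, hc⟩ := hG
  have hy : AnalyticAt 𝕜 (fun z : E × (𝕜 × 𝕜) => fun j => t j * ![z.2.1, z.2.2] j) (lam0, 0) := by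
    refine AnalyticAt.pi fun j => analyticAt_const.fun_mul ?_
    fin_cases j
    · exact analyticAt_fst.fun_comp analyticAt_snd
    · exact analyticAt_snd.fun_comp analyticAt_snd
  have hc' : AnalyticAt 𝕜 (fun z : E × (𝕜 × 𝕜) => c z.1) (lam0, 0) :=
    AnalyticAt.fun_comp (g := c) (f := Prod.fst) (hcP hP) analyticAt_fst
  refine (hy.aeval hc' ?_).congr ?_
  · have : (fun j => t j * ![(lam0, (0 : 𝕜 × 𝕜)).2.1, (lam0, (0 : 𝕜 × 𝕜)).2.2] j) = 0 := by
      funext j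
      fin_cases j <;> simp
    rw [this]
    simp
  · have hx : ∀ᶠ x : 𝕜 × 𝕜 in 𝓝 0, ‖x‖ ≤ ρ := by
      filter_upwards [Metric.closedBall_mem_nhds (0 : 𝕜 × 𝕜) hρ] with x hx
      simpa using hx
    rw [nhds_prod_eq]
    filter_upwards [hc.prod_mk hx] with z hz
    exact (hz.1.2 _ hz.2).symm

end HasWienerExpansion

theorem IsAnalyticFamily.prodMk {E : Type*} [TopologicalSpace E] {F G : E → 𝕜 × 𝕜 → 𝕜}
    {lam0 : E} (hF : IsAnalyticFamily F lam0)
    (hG : IsAnalyticFamily G lam0) :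
    IsAnalyticFamily (fun lam x => (F lam x, G lam x)) lam0 := by
  obtain ⟨c, r, hr, M, hM, hc⟩ := hF
  obtain ⟨c', r', hr', M', hM', hc'⟩ := hG
  have hM0 : ∀ k, 0 ≤ M k := fun k => (norm_nonneg _).trans (hc.self_of_nhds.1 k)
  have hM0' : ∀ k, 0 ≤ M' k := fun k => (norm_nonneg _).trans (hc'.self_of_nhds.1 k)
  refine ⟨fun k lam => (c k lam, c' k lam), min r r', lt_min hr hr', fun k => M k + M' k, ?_, ?_⟩
  · refine Summable.of_nonneg_of_le (fun k => ?_) (fun k => ?_) (hM.add hM')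
    · have := hM0 k
      have := hM0' k
      positivity
    · rw [add_mul]
      refine add_le_add (mul_le_mul_of_nonneg_left ?_ (hM0 k))
        (mul_le_mul_of_nonneg_left ?_ (hM0' k))
      · gcongr
        exact min_le_left _ _
      · gcongr
        exact min_le_right _ _
  · filter_upwards [hc, hc'] with lam h h'
    refine ⟨fun k => ?_, fun x hx => ?_⟩
    · exact max_le ((h.1 k).trans (by linarith [hM0' k])) ((h'.1 k).trans (by linarith [hM0 k]))
    · exact (h.2 x (hx.trans (min_le_left _ _))).prodMk (h'.2 x (hx.trans (min_le_right _ _)))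

namespace TameFamily

variable {P : Prop} {C : Set (ℤ × ℤ × ℕ)} {μ : E → Fin 2 → 𝕜}
  {f : E → (Fin 2 → 𝕜) → Fin 2 → 𝕜} {lam0 : E}

/-- A map of `Fin 2 → 𝕜`, considered as a map of `𝕜 × 𝕜`. -/
def toProd (f : E → (Fin 2 → 𝕜) → Fin 2 → 𝕜) (lam : E) (x : 𝕜 × 𝕜) : 𝕜 × 𝕜 :=
  (f lam ![x.1, x.2] 0, f lam ![x.1, x.2] 1)

theorem hasWienerExpansion (hf : TameFamily P C μ f lam0) (i : Fin 2) :
    HasWienerExpansion P (fun lam x => f lam ![x.1, x.2] i) lam0 := by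
  obtain ⟨hμ, hμP, r, hr, a, K, haP, ha⟩ := hf
  refine ⟨fun _ => (r : 𝕜)⁻¹, r, fun lam => (μ lam i * r) • X 𝕜 i + a lam i,
    (‖μ lam0‖ + 1) * r + K, hr, fun hP => ((((hμP hP).pi_apply i).fun_mul
      analyticAt_const).fun_smul analyticAt_const).fun_add ((haP hP).pi_apply i), ?_⟩
  filter_upwards [ha, hμ.norm.eventually_lt_const (lt_add_one _)] with lam ⟨ha₁, ha₂, ha₃⟩ hμ₁
  refine ⟨(norm_add_le _ _).trans (add_le_add ?_ ((norm_le_pi_norm _ i).trans ha₁)),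
    fun x hx => ?_⟩
  · rw [norm_smul, norm_X, mul_one, norm_mul, RCLike.norm_ofReal, abs_of_pos hr]
    have := (norm_le_pi_norm (μ lam) i).trans hμ₁.le
    gcongr
  · have hxr : ‖![x.1, x.2]‖ ≤ r := (pi_norm_le_iff_of_nonneg hr.le).2 fun j =>
      (HasWienerExpansion.norm_le_of_prod x j).trans hx
    have h1 := norm_inv_smul_le hr hxr
    have hr' : (r : 𝕜) ≠ 0 := RCLike.ofReal_ne_zero.2 hr.ne'
    change _ = aeval ((r : 𝕜)⁻¹ • ![x.1, x.2]) _
    rw [ha₃ _ hxr i, map_add, map_smul, aeval_X h1, Pi.smul_apply, smul_eq_mul, smul_eq_mul]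
    field_simp

theorem isAnalyticFamily_toProd (hf : TameFamily P C μ f lam0) :
    IsAnalyticFamily (toProd f) lam0 :=
  (hf.hasWienerExpansion 0).isAnalyticFamily.prodMk (hf.hasWienerExpansion 1).isAnalyticFamily

theorem dependsAnalytically_toProd (hf : TameFamily P C μ f lam0) (hP : P) :
    DependsAnalytically (toProd f) lam0 :=
  ((hf.hasWienerExpansion 0).dependsAnalytically hP).prod
    ((hf.hasWienerExpansion 1).dependsAnalytically hP)

end TameFamily

/-! ### Convergents and spectral gaps -/

section ContinuedFraction

open GenContFract

theorem Irrational.not_terminatedAt_of {R : ℝ} (hR : Irrational R) (n : ℕ) :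
    ¬ (GenContFract.of R).TerminatedAt n := fun h => by
  obtain ⟨q, hq⟩ := exists_rat_eq_of_terminates (v := R) ⟨n, h⟩
  exact hR ⟨q, hq.symm⟩

theorem Irrational.dens_pos {R : ℝ} (hR : Irrational R) (n : ℕ) :
    0 < (GenContFract.of R).dens n :=
  lt_of_lt_of_le (by exact_mod_cast Nat.fib_pos.2 n.succ_pos)
    (succ_nth_fib_le_of_nth_den (Or.inr (hR.not_terminatedAt_of _)))

/-- The convergents lie alternately below and above the number. -/
theorem Irrational.neg_one_pow_mul_sub_pos {R : ℝ} (hR : Irrational R) (n : ℕ) :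
    0 < (-1) ^ n * (R * (GenContFract.of R).dens n - (GenContFract.of R).nums n) := by
  have hB := hR.dens_pos n
  obtain ⟨ifp, hifp⟩ : ∃ ifp, IntFractPair.stream R n = some ifp := by
    refine Option.ne_none_iff_exists'.1 fun h => ?_
    cases n with
    | zero => simp [IntFractPair.stream] at h
    | succ n =>
      exact hR.not_terminatedAt_of n (of_terminatedAt_n_iff_succ_nth_intFractPair_stream_eq_none.2 h)
  have h : R - (GenContFract.of R).convs n = if ifp.fr = 0 then 0 else (-1) ^ n /
      (((GenContFract.of R).contsAux (n + 1)).b * (ifp.fr⁻¹ * ((GenContFract.of R).contsAux (n + 1)).b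
        + ((GenContFract.of R).contsAux n).b)) := sub_convs_eq hifp
  have hconv : (GenContFract.of R).convs n
      = (GenContFract.of R).nums n / (GenContFract.of R).dens n := rfl
  have hfr : ifp.fr ≠ 0 := fun h0 => by
    rw [if_pos h0, sub_eq_zero] at h
    obtain ⟨q, hq⟩ := exists_rat_eq_nth_conv R n
    exact hR ⟨q, by rw [h, hq]⟩
  have hfr0 : 0 < ifp.fr := lt_of_le_of_ne (IntFractPair.nth_stream_fr_nonneg hifp) hfr.symm
  rw [if_neg hfr, hconv] at h
  have hpB : 0 ≤ ((GenContFract.of R).contsAux n).b := zero_le_of_contsAux_b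
  have hB' : ((GenContFract.of R).contsAux (n + 1)).b = (GenContFract.of R).dens n := rfl
  rw [hB'] at h
  have hD : 0 < (GenContFract.of R).dens n *
      (ifp.fr⁻¹ * (GenContFract.of R).dens n + ((GenContFract.of R).contsAux n).b) := by positivity
  have hsq : ((-1 : ℝ) ^ n) * (-1) ^ n = 1 := by rw [← mul_pow]; simp
  have hmul : (-1 : ℝ) ^ n * (R * (GenContFract.of R).dens n - (GenContFract.of R).nums n)
      = (GenContFract.of R).dens n * ((GenContFract.of R).dens n *
      (ifp.fr⁻¹ * (GenContFract.of R).dens n + ((GenContFract.of R).contsAux n).b))⁻¹ := by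
    have h' : R * (GenContFract.of R).dens n - (GenContFract.of R).nums n
        = (GenContFract.of R).dens n *
          (R - (GenContFract.of R).nums n / (GenContFract.of R).dens n) := by
      field_simp
    rw [h', h, div_eq_mul_inv]
    linear_combination ((GenContFract.of R).dens n * ((GenContFract.of R).dens n *
      (ifp.fr⁻¹ * (GenContFract.of R).dens n + ((GenContFract.of R).contsAux n).b))⁻¹) * hsq
  rw [hmul]
  positivity

/-- The determinant formula for continuants, together with the alternation of convergents: even
indices lie below `R`, odd ones above. -/
theorem Irrational.consecutive_convs {R : ℝ} (hR : Irrational R) {k p q p' q' : ℕ}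
    (hq : (q : ℝ) = (GenContFract.of R).nums (2 * k))
    (hp : (p : ℝ) = (GenContFract.of R).dens (2 * k))
    (hq' : (q' : ℝ) = (GenContFract.of R).nums (2 * k + 1))
    (hp' : (p' : ℝ) = (GenContFract.of R).dens (2 * k + 1)) :
    p * q' = q * p' + 1 ∧ (q : ℝ) < R * p ∧ R * p' < q' := by
  have hdet := (SimpContFract.of R).determinant (hR.not_terminatedAt_of (2 * k))
  have h₁ := hR.neg_one_pow_mul_sub_pos (2 * k)
  have h₂ := hR.neg_one_pow_mul_sub_pos (2 * k + 1)
  change (GenContFract.of R).nums (2 * k) * (GenContFract.of R).dens (2 * k + 1) -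
    (GenContFract.of R).dens (2 * k) * (GenContFract.of R).nums (2 * k + 1) = _ at hdet
  rw [← hq, ← hp, ← hq', ← hp'] at hdet
  rw [← hq, ← hp] at h₁
  rw [← hq', ← hp'] at h₂
  rw [pow_succ, pow_mul] at hdet h₂
  rw [pow_mul] at h₁
  norm_num at hdet h₁ h₂
  refine ⟨?_, h₁, h₂⟩
  have : (p * q' : ℝ) = q * p' + 1 := by linarith
  exact_mod_cast this

end ContinuedFraction

/-! ### Uniform contraction of the violating exponents -/

section Gap

theorem pow_mul_pow_pow_le {a b : ℝ} (ha : 0 ≤ a) (hb : 1 ≤ b) {p q k l : ℕ} (e : ℕ)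
    (h : p * l ≤ q * k + e) : (a ^ k * b ^ l) ^ p ≤ (a ^ p * b ^ q) ^ k * b ^ e := by
  have h1 : b ^ (p * l) ≤ b ^ (q * k + e) := pow_le_pow_right₀ hb h
  calc (a ^ k * b ^ l) ^ p = a ^ (p * k) * b ^ (p * l) := by
        rw [mul_pow, ← pow_mul, ← pow_mul, mul_comm k, mul_comm l]
    _ ≤ a ^ (p * k) * b ^ (q * k + e) := by gcongr
    _ = (a ^ p * b ^ q) ^ k * b ^ e := by rw [mul_pow, ← pow_mul, ← pow_mul, pow_add, mul_assoc]

/-- Raising to the power `p` compares `a ^ k * b ^ l` with a power of `a ^ p * b ^ q < 1`. This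
inequality is open, so `a` and `b` can be enlarged slightly for `s` and `t`; the rate `η` is the
`p`-th root of `a ^ p * b ^ q`. -/
theorem exists_gap_bounds {a b : ℝ} (ha : 0 < a) (hb : 1 < b) {p q : ℕ} (hp : 1 ≤ p)
    (hθ : a ^ p * b ^ q < 1) :
    ∃ s t : ℝ, a < s ∧ b < t ∧ (∀ k l, p * l ≤ q * k + p → s ^ k * t ^ l ≤ t) ∧
      ∃ η < 1, 0 ≤ η ∧ ∀ k l, 1 ≤ k → p * l ≤ q * k → a ^ k * b ^ l ≤ η := by
  have hp0 : p ≠ 0 := by omega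
  have hcont : ContinuousAt (fun ε : ℝ => (a + ε) ^ p * (b + ε) ^ q) 0 := by fun_prop
  have hev : ∀ᶠ ε : ℝ in 𝓝 0, (a + ε) ^ p * (b + ε) ^ q < 1 :=
    hcont.eventually_lt_const (by simpa using hθ)
  obtain ⟨ε, hε, hε0⟩ := ((hev.filter_mono nhdsWithin_le_nhds).and
    (self_mem_nhdsWithin : Set.Ioi (0 : ℝ) ∈ 𝓝[>] 0)).exists
  refine ⟨a + ε, b + ε, by linarith, by linarith, fun k l hkl => ?_,
    (a ^ p * b ^ q) ^ ((p : ℝ)⁻¹), ?_, by positivity, fun k l hk hkl => ?_⟩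
  · refine le_of_pow_le_pow_left₀ hp0 (by linarith) ?_
    refine (pow_mul_pow_pow_le (by linarith) (by linarith) p hkl).trans ?_
    refine mul_le_of_le_one_left (pow_nonneg (by linarith) _) (pow_le_one₀ ?_ hε.le)
    have : 0 < a + ε := by linarith
    have : 0 < b + ε := by linarith
    positivity
  · exact Real.rpow_lt_one (by positivity) hθ (by positivity)
  · refine le_of_pow_le_pow_left₀ hp0 (by positivity) ?_
    rw [Real.rpow_inv_natCast_pow (by positivity) hp0]
    refine (pow_mul_pow_pow_le ha.le hb.le 0 hkl).trans ?_
    rw [pow_zero, mul_one]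
    exact pow_le_of_le_one (by positivity) hθ.le (by omega)

theorem le_norm_sub_of_norm_le {x y : 𝕜} {η m : ℝ} (hη : η ≤ 1) (hm : m ≤ ‖x‖)
    (h : ‖y‖ ≤ ‖x‖ * η) : m * (1 - η) ≤ ‖x - y‖ := by
  have := norm_sub_norm_le x y
  nlinarith

theorem norm_powProd (μ : Fin 2 → 𝕜) (k : ℕ × ℕ) :
    ‖powProd μ k‖ = ‖μ 0‖ ^ k.1 * ‖μ 1‖ ^ k.2 := by
  rw [powProd, norm_mul, norm_pow, norm_pow]

/-- One factor `μ i` is split off `μᵏ`; the remaining exponent satisfies `p l ≤ q k` and contributes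
at most `η`. If `i = 1` and the second variable is absent, there is no factor to split off, and `1 <
‖μ 1‖` is used instead. Then `‖μ i - μᵏ‖ ≥ ‖μ i‖ (1 - η)`. -/
theorem spectralGap_lower {C : Set (ℤ × ℤ × ℕ)} (hC : (1, 1, 1) ∈ C) {μ : Fin 2 → 𝕜} {p q : ℕ}
    (hp : 1 ≤ p) (h0 : μ 0 ≠ 0) (h1 : 1 < ‖μ 1‖) (hθ : ‖μ 0‖ ^ p * ‖μ 1‖ ^ q < 1) :
    SpectralGap C (-q, p, 0) μ := by
  have ha : 0 < ‖μ 0‖ := norm_pos_iff.2 h0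
  obtain ⟨s, t, hs, ht, hK, η, hη, hη0, hle⟩ := exists_gap_bounds ha h1 hp hθ
  have hbounds : ∀ i k, Removed C (-q, p, 0) i k →
      p * k.2 ≤ q * k.1 + p ∧ ‖powProd μ k‖ ≤ ‖μ i‖ * η := by
    rintro i ⟨k, l⟩ ⟨hC', hk⟩
    have h2 := TameFamily.two_le_of_allowed hC hC'
    simp only [Allowed, Set.mem_singleton_iff, forall_eq, not_le] at hk
    rw [norm_powProd]
    fin_cases i
    · simp only [weight, unitExp] at hk h2 ⊢
      simp only [Fin.zero_eta, if_true, Nat.cast_one, Nat.cast_zero] at hk ⊢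
      have hk' : p * l + q < q * k := by zify; linarith
      obtain ⟨k, rfl⟩ : ∃ k', k = k' + 2 := by
        refine ⟨k - 2, ?_⟩
        have : 2 ≤ k := by
          by_contra hlt
          have : k ≤ 1 := by omega
          nlinarith
        omega
      have := hle (k + 1) l (by omega) (by nlinarith)
      refine ⟨by omega, ?_⟩
      calc ‖μ 0‖ ^ (k + 2) * ‖μ 1‖ ^ l = ‖μ 0‖ * (‖μ 0‖ ^ (k + 1) * ‖μ 1‖ ^ l) := by ring
        _ ≤ ‖μ 0‖ * η := by gcongr
    · simp only [weight, unitExp] at hk h2 ⊢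
      simp only [Fin.mk_one, one_ne_zero, if_false, Nat.cast_one, Nat.cast_zero] at hk ⊢
      have hk' : p * l < q * k + p := by zify; linarith
      refine ⟨by omega, ?_⟩
      rcases l with - | l
      · have := hle k 0 (by omega) (by simp)
        rw [pow_zero, mul_one] at this ⊢
        nlinarith
      · have hk1 : 1 ≤ k := by
          by_contra hlt
          obtain rfl : k = 0 := by omega
          nlinarith
        have := hle k l hk1 (by nlinarith)
        calc ‖μ 0‖ ^ k * ‖μ 1‖ ^ (l + 1) = ‖μ 1‖ * (‖μ 0‖ ^ k * ‖μ 1‖ ^ l) := by ring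
          _ ≤ ‖μ 1‖ * η := by gcongr
  refine ⟨![s, t], Fin.forall_fin_two.2 ⟨hs, ht⟩, ⟨t, fun i k hk => ?_⟩,
    min ‖μ 0‖ ‖μ 1‖ * (1 - η), mul_pos (lt_min ha (one_pos.trans h1)) (by linarith),
    fun i k hk => ?_⟩
  · simpa using hK k.1 k.2 (hbounds i k hk).1
  · refine le_norm_sub_of_norm_le hη.le ?_ (hbounds i k hk).2
    fin_cases i
    · exact min_le_left _ _
    · exact min_le_right _ _

/-- The mirror image of `spectralGap_lower`, with the two variables interchanged. -/
theorem spectralGap_upper {C : Set (ℤ × ℤ × ℕ)} (hC : (1, 1, 1) ∈ C) {μ : Fin 2 → 𝕜} {p q : ℕ}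
    (hq : 1 ≤ q) (h0 : μ 1 ≠ 0) (h1 : 1 < ‖μ 0‖) (hθ : ‖μ 0‖ ^ p * ‖μ 1‖ ^ q < 1) :
    SpectralGap C (q, -p, 0) μ := by
  have ha : 0 < ‖μ 1‖ := norm_pos_iff.2 h0
  obtain ⟨s, t, hs, ht, hK, η, hη, hη0, hle⟩ := exists_gap_bounds ha h1 hq
    (by rwa [mul_comm] at hθ)
  have hbounds : ∀ i k, Removed C (q, -p, 0) i k →
      q * k.1 ≤ p * k.2 + q ∧ ‖powProd μ k‖ ≤ ‖μ i‖ * η := by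
    rintro i ⟨l, k⟩ ⟨hC', hk⟩
    have h2 := TameFamily.two_le_of_allowed hC hC'
    simp only [Allowed, Set.mem_singleton_iff, forall_eq, not_le] at hk
    rw [norm_powProd]
    fin_cases i
    · simp only [weight, unitExp] at hk h2 ⊢
      simp only [Fin.zero_eta, if_true, Nat.cast_one, Nat.cast_zero] at hk ⊢
      have hk' : q * l < p * k + q := by zify; linarith
      refine ⟨by omega, ?_⟩
      rcases l with - | l
      · have := hle k 0 (by omega) (by simp)
        rw [pow_zero] at this ⊢
        nlinarith
      · have hk1 : 1 ≤ k := by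
          by_contra hlt
          obtain rfl : k = 0 := by omega
          nlinarith
        have := hle k l hk1 (by nlinarith)
        calc ‖μ 0‖ ^ (l + 1) * ‖μ 1‖ ^ k = ‖μ 0‖ * (‖μ 1‖ ^ k * ‖μ 0‖ ^ l) := by ring
          _ ≤ ‖μ 0‖ * η := by gcongr
    · simp only [weight, unitExp] at hk h2 ⊢
      simp only [Fin.mk_one, one_ne_zero, if_false, Nat.cast_one, Nat.cast_zero] at hk ⊢
      have hk' : q * l + p < p * k := by zify; linarith
      obtain ⟨k, rfl⟩ : ∃ k', k = k' + 2 := by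
        refine ⟨k - 2, ?_⟩
        have : 2 ≤ k := by
          by_contra hlt
          have : k ≤ 1 := by omega
          nlinarith
        omega
      have := hle (k + 1) l (by omega) (by nlinarith)
      refine ⟨by omega, ?_⟩
      calc ‖μ 0‖ ^ l * ‖μ 1‖ ^ (k + 2) = ‖μ 1‖ * (‖μ 1‖ ^ (k + 1) * ‖μ 0‖ ^ l) := by ring
        _ ≤ ‖μ 1‖ * η := by gcongr
  refine ⟨![t, s], Fin.forall_fin_two.2 ⟨ht, hs⟩, ⟨t, fun i k hk => ?_⟩,
    min ‖μ 0‖ ‖μ 1‖ * (1 - η), mul_pos (lt_min (one_pos.trans h1) ha) (by linarith),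
    fun i k hk => ?_⟩
  · simpa [mul_comm] using hK k.2 k.1 (hbounds i k hk).1
  · refine le_norm_sub_of_norm_le hη.le ?_ (hbounds i k hk).2
    fin_cases i
    · exact min_le_left _ _
    · exact min_le_right _ _

end Gap

/-! ### Exponents in a unimodular cone -/

namespace WienerAlgebra

/-- Continuous linear maps that agree on the monomials of `a` agree at `a`. -/
theorem map_congr {Z : Type*} [AddCommMonoid Z] [Module 𝕜 Z] [TopologicalSpace Z] [T2Space Z]
    {φ ψ : WienerAlgebra 𝕜 →L[𝕜] Z} {a : WienerAlgebra 𝕜}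
    (h : ∀ k, a k ≠ 0 → φ (monomial 𝕜 k) = ψ (monomial 𝕜 k)) : φ a = ψ a := by
  refine ((hasSum_monomial a).map φ φ.continuous).unique
    (((hasSum_monomial a).map ψ ψ.continuous).congr_fun fun k => ?_)
  by_cases hk : a k = 0
  · simp [hk]
  · simp [h k hk]

/-- An exponent in the cone that is spanned by a unimodular pair is a combination of it. -/
theorem exists_eq_add_of_allowed {C : Set (ℤ × ℤ × ℕ)} (hC : (1, 1, 1) ∈ C) {p q p' q' : ℕ}
    (hdet : p * q' = q * p' + 1) (hv : (-(q : ℤ), (p : ℤ), 0) ∈ C)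
    (hw : ((q' : ℤ), -(p' : ℤ), 0) ∈ C) {i : Fin 2} {k : ℕ × ℕ} (hk : Allowed C i k) :
    ∃ m : ℕ × ℕ, m ≠ 0 ∧ k = unitExp i + m.1 • (p, q) + m.2 • (p', q') ∧
      weight ((q' : ℤ), -(p' : ℤ), 0) k = weight ((q' : ℤ), -(p' : ℤ), 0) (unitExp i) + m.1 ∧
      weight (-(q : ℤ), (p : ℤ), 0) k = weight (-(q : ℤ), (p : ℤ), 0) (unitExp i) + m.2 := by
  have h₀ := TameFamily.two_le_of_allowed hC hk
  have h₁ := hk _ hv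
  have h₂ := hk _ hw
  simp only [Nat.cast_zero, add_zero] at h₁ h₂
  obtain ⟨α, hα⟩ := Int.eq_ofNat_of_zero_le (sub_nonneg.2 h₂)
  obtain ⟨β, hβ⟩ := Int.eq_ofNat_of_zero_le (sub_nonneg.2 h₁)
  have hdet' : (p * q' : ℤ) = q * p' + 1 := by exact_mod_cast hdet
  obtain ⟨k₁, k₂⟩ := k
  have e₁ : (k₁ : ℤ) = (unitExp i).1 + α * p + β * p' := by
    simp only [weight] at hα hβ
    linear_combination (-(k₁ : ℤ) + (unitExp i).1) * hdet' + (p : ℤ) * hα + (p' : ℤ) * hβ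
  have e₂ : (k₂ : ℤ) = (unitExp i).2 + α * q + β * q' := by
    simp only [weight] at hα hβ
    linear_combination (-(k₂ : ℤ) + (unitExp i).2) * hdet' + (q : ℤ) * hα + (q' : ℤ) * hβ
  have e₁' : k₁ = (unitExp i).1 + α * p + β * p' := by exact_mod_cast e₁
  have e₂' : k₂ = (unitExp i).2 + α * q + β * q' := by exact_mod_cast e₂
  refine ⟨(α, β), fun h0 => ?_, Prod.ext ?_ ?_, by linarith, by linarith⟩
  · obtain ⟨rfl, rfl⟩ := Prod.mk.inj h0
    have hu : (unitExp i).1 + (unitExp i).2 = 1 := by fin_cases i <;> simp [unitExp]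
    simp only [zero_mul, add_zero] at e₁' e₂'
    simp only at h₀
    omega
  · simpa using e₁'
  · simpa using e₂'

/-- The exponents of an element of the cone with respect to the unimodular pair. -/
def coneExp (p q p' q' : ℕ) (i : Fin 2) (k : ℕ × ℕ) : ℕ × ℕ :=
  ((weight ((q' : ℤ), -(p' : ℤ), 0) k - weight ((q' : ℤ), -(p' : ℤ), 0) (unitExp i)).toNat,
    (weight (-(q : ℤ), (p : ℤ), 0) k - weight (-(q : ℤ), (p : ℤ), 0) (unitExp i)).toNat)

end WienerAlgebra

/-- Every monomial of the nonlinear part is `xᵢ uᵐ u'ⁿ` with `(m, n) ≠ 0`. Those with `m ≥ 1` are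
collected in `u b`, those with `m = 0` in `u' b'`. -/
theorem TameFamily.exists_coneForm {P : Prop} {C : Set (ℤ × ℤ × ℕ)} {μ : E → Fin 2 → 𝕜}
    {g : E → (Fin 2 → 𝕜) → Fin 2 → 𝕜} {lam0 : E} (hg : TameFamily P C μ g lam0)
    (hC : (1, 1, 1) ∈ C) {p q p' q' : ℕ} (hdet : p * q' = q * p' + 1)
    (hv : (-(q : ℤ), (p : ℤ), 0) ∈ C) (hw : ((q' : ℤ), -(p' : ℤ), 0) ∈ C) (i : Fin 2) :
    ∃ b b' : E → 𝕜 × 𝕜 → 𝕜, HasWienerExpansion P b lam0 ∧ HasWienerExpansion P b' lam0 ∧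
      ∀ᶠ z : E × (Fin 2 → 𝕜) in 𝓝 (lam0, 0), ∀ u u' : 𝕜,
        u = z.2 0 ^ p * z.2 1 ^ q → u' = z.2 0 ^ p' * z.2 1 ^ q' →
        g z.1 z.2 i = z.2 i * (μ z.1 i + u * b z.1 (u, u') + u' * b' z.1 (u, u')) := by
  obtain ⟨-, -, ρ, hρ, a, K, haP, ha⟩ := hg
  let e := coneExp p q p' q' i
  let w : ℕ × ℕ → WienerAlgebra 𝕜 := fun k =>
    if (e k).1 = 0 then 0 else monomial 𝕜 ((e k).1 - 1, (e k).2)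
  let w' : ℕ × ℕ → WienerAlgebra 𝕜 := fun k =>
    if (e k).1 = 0 then monomial 𝕜 (0, (e k).2 - 1) else 0
  have hw1 : ∀ k, ‖w k‖ ≤ 1 := fun k => by
    simp only [w]
    split_ifs <;> simp [norm_monomial]
  have hw1' : ∀ k, ‖w' k‖ ≤ 1 := fun k => by
    simp only [w']
    split_ifs <;> simp [norm_monomial]
  let t : 𝕜 := powProd (fun _ => (ρ : 𝕜)⁻¹) (p, q)
  let t' : 𝕜 := powProd (fun _ => (ρ : 𝕜)⁻¹) (p', q')
  let c : E → WienerAlgebra 𝕜 := fun lam => ((ρ : 𝕜)⁻¹ * t) • lift w (a lam i)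
  let c' : E → WienerAlgebra 𝕜 := fun lam => ((ρ : 𝕜)⁻¹ * t') • lift w' (a lam i)
  have hexp : ∀ (v : ℕ × ℕ → WienerAlgebra 𝕜) (s : 𝕜), (∀ k, ‖v k‖ ≤ 1) →
      HasWienerExpansion P (fun lam x => aeval (fun j => ![t, t'] j * ![x.1, x.2] j)
        (s • lift v (a lam i))) lam0 := fun v s hv1 => by
    -- The radius `1` is arbitrary: the equality is a definition, and convergence is arranged later
    -- by shrinking the polydisk.
    refine ⟨![t, t'], 1, fun lam => s • lift v (a lam i), ‖s‖ * K, one_pos, fun hP =>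
      analyticAt_const.fun_smul ((lift v).map_analyticAt ((haP hP).pi_apply i)), ?_⟩
    filter_upwards [ha] with lam hlam
    refine ⟨?_, fun x _ => rfl⟩
    rw [norm_smul]
    refine mul_le_mul_of_nonneg_left ?_ (norm_nonneg _)
    have h₁ := norm_lift_apply_le hv1 (a lam i)
    rw [one_mul] at h₁
    exact h₁.trans ((norm_le_pi_norm _ i).trans hlam.1)
  refine ⟨_, _, hexp w ((ρ : 𝕜)⁻¹ * t) hw1, hexp w' ((ρ : 𝕜)⁻¹ * t') hw1', ?_⟩
  refine TameFamily.eventually_prod (Q := fun lam x => ∀ u u' : 𝕜,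
    u = x 0 ^ p * x 1 ^ q → u' = x 0 ^ p' * x 1 ^ q' → g lam x i = x i * (μ lam i +
      u * aeval (fun j => ![t, t'] j * ![(u, u').1, (u, u').2] j)
        (((ρ : 𝕜)⁻¹ * t) • lift w (a lam i)) +
      u' * aeval (fun j => ![t, t'] j * ![(u, u').1, (u, u').2] j)
        (((ρ : 𝕜)⁻¹ * t') • lift w' (a lam i)))) hρ ?_
  filter_upwards [ha] with lam ⟨_, ha₂, ha₃⟩ x hx u u' hu hu'
  have hv1 := TameFamily.norm_inv_smul_le hρ hx
  set v : Fin 2 → 𝕜 := (ρ : 𝕜)⁻¹ • x with hvdef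
  have hut : t * u = powProd v (p, q) := by
    rw [hu]
    exact (powProd_mul (fun _ => (ρ : 𝕜)⁻¹) x (p, q)).symm
  have hut' : t' * u' = powProd v (p', q') := by
    rw [hu']
    exact (powProd_mul (fun _ => (ρ : 𝕜)⁻¹) x (p', q')).symm
  set y : Fin 2 → 𝕜 := fun j => ![t, t'] j * ![(u, u').1, (u, u').2] j with hy
  have hy0 : y 0 = powProd v (p, q) := hut
  have hy1 : y 1 = powProd v (p', q') := hut'
  have hyle : ‖y‖ ≤ 1 := (pi_norm_le_iff_of_nonneg zero_le_one).2 <| Fin.forall_fin_two.2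
    ⟨by rw [hy0]; exact norm_powProd_le hv1 _, by rw [hy1]; exact norm_powProd_le hv1 _⟩
  have key : aeval v (a lam i) = v i * (y 0 * aeval y (lift w (a lam i)) +
      y 1 * aeval y (lift w' (a lam i))) := by
    refine map_congr (φ := aeval v) (ψ := v i • (y 0 • (aeval y).comp (lift w) +
      y 1 • (aeval y).comp (lift w'))) fun k hk => ?_
    obtain ⟨m, hm0, hkm, hm₁, hm₂⟩ := exists_eq_add_of_allowed hC hdet hv hw (ha₂ i k hk)
    have he : e k = m := by
      refine Prod.ext ?_ ?_
      · change (_ - _ : ℤ).toNat = m.1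
        rw [hm₁]
        simp
      · change (_ - _ : ℤ).toNat = m.2
        rw [hm₂]
        simp
    have hpow : powProd v k = v i * (y 0 ^ m.1 * y 1 ^ m.2) := by
      rw [hkm, powProd_add, powProd_add, powProd_unitExp, hy0, hy1, mul_assoc]
      simp only [powProd, Prod.smul_fst, Prod.smul_snd, smul_eq_mul, mul_pow, ← pow_mul,
        mul_comm m.1, mul_comm m.2]
    simp only [_root_.smul_apply, _root_.add_apply, ContinuousLinearMap.comp_apply,
      lift_monomial hw1, lift_monomial hw1', aeval_monomial hv1, hpow, smul_eq_mul]
    congr 1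
    simp only [w, w', he]
    obtain ⟨m₁, m₂⟩ := m
    rcases m₁ with - | m₁
    · rcases m₂ with - | m₂
      · exact absurd rfl hm0
      · simp [aeval_monomial hyle, powProd, pow_succ']
    · simp [aeval_monomial hyle, powProd, pow_succ', mul_assoc]
  have hy0' : y 0 = t * u := rfl
  have hy1' : y 1 = t' * u' := rfl
  have hvi : v i = (ρ : 𝕜)⁻¹ * x i := rfl
  rw [ha₃ x hx i, key, map_smul, map_smul, hvi, smul_eq_mul, smul_eq_mul, hy0', hy1']
  ring

/-! ### Coefficients of analytic functions -/

namespace FormalMultilinearSeries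

variable {U V B ι : Type*} [NormedAddCommGroup U] [NormedSpace 𝕜 U] [NormedAddCommGroup V]
  [NormedSpace 𝕜 V] [NormedCommRing B] [NormedAlgebra 𝕜 B] [Fintype ι]

/-- The series of the function `u ↦ ∑ₙ pₙ (∑ᵢ wᵢ Aᵢ u)ⁿ` with values in the algebra `B`, that is,
the extension of scalars of `p` at `∑ᵢ wᵢ Aᵢ u`. -/
noncomputable def extendScalars (p : FormalMultilinearSeries 𝕜 V 𝕜) (A : ι → U →L[𝕜] V)
    (w : ι → B) : FormalMultilinearSeries 𝕜 U B := fun n =>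
  ∑ s : Fin n → ι, (ContinuousLinearMap.toSpanSingleton 𝕜
    (∏ j, w (s j))).compContinuousMultilinearMap ((p n).compContinuousLinearMap fun j => A (s j))

/-- The sum has `card ι ^ n` terms, each bounded by `‖p n‖`; hence the radius of convergence shrinks
at most by the factor `card ι`. -/
theorem norm_extendScalars_le [NormOneClass B] (p : FormalMultilinearSeries 𝕜 V 𝕜)
    {A : ι → U →L[𝕜] V} {w : ι → B} (hA : ∀ i, ‖A i‖ ≤ 1) (hw : ∀ i, ‖w i‖ ≤ 1) (n : ℕ) :
    ‖p.extendScalars A w n‖ ≤ Fintype.card ι ^ n * ‖p n‖ := by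
  refine (norm_sum_le_of_le _ (f := fun s : Fin n → ι => _) (n := fun _ => ‖p n‖)
    fun s _ => ?_).trans_eq (by simp)
  refine (ContinuousLinearMap.norm_compContinuousMultilinearMap_le _ _).trans ?_
  have h₁ : ‖∏ j, w (s j)‖ ≤ 1 :=
    (Finset.norm_prod_le _ _).trans (Finset.prod_le_one (fun _ _ => norm_nonneg _) fun j _ => hw _)
  have h₂ : ∏ j, ‖A (s j)‖ ≤ 1 := Finset.prod_le_one (fun _ _ => norm_nonneg _) fun j _ => hA _
  rw [ContinuousLinearMap.norm_toSpanSingleton]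
  calc _ ≤ 1 * (‖p n‖ * 1) := mul_le_mul h₁
        ((ContinuousMultilinearMap.norm_compContinuousLinearMap_le _ _).trans (by gcongr))
        (norm_nonneg _) zero_le_one
    _ = _ := by ring

/-- Multilinear expansion of `p n` at `∑ yᵢ Aᵢ u`, where `φ` is only required to be multiplicative
on the products that occur. -/
theorem map_extendScalars (p : FormalMultilinearSeries 𝕜 V 𝕜) (A : ι → U →L[𝕜] V) (w : ι → B)
    (φ : B →L[𝕜] 𝕜) {y : ι → 𝕜} {n : ℕ} (hφ : ∀ s : Fin n → ι, φ (∏ j, w (s j)) = ∏ j, y (s j))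
    (u : U) : φ (p.extendScalars A w n fun _ => u) = p n fun _ => ∑ i, y i • A i u := by
  classical
  rw [ContinuousMultilinearMap.map_sum, extendScalars, _root_.sum_apply, map_sum]
  refine Finset.sum_congr rfl fun s _ => ?_
  rw [ContinuousMultilinearMap.map_smul_univ]
  simp [hφ, mul_comm]

end FormalMultilinearSeries

namespace WienerAlgebra

open FormalMultilinearSeries

theorem aeval_eq_linear_add_restrict {y : Fin 2 → 𝕜} (hy : ‖y‖ ≤ 1) (a : WienerAlgebra 𝕜) :
    aeval y a = a 0 + (a (unitExp 0) * y 0 + a (unitExp 1) * y 1)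
      + aeval y (restrict (fun k => 2 ≤ k.1 + k.2) a) := by
  classical
  have : a = a 0 • 1 + (a (unitExp 0) • X 𝕜 0 + a (unitExp 1) • X 𝕜 1)
      + restrict (fun k => 2 ≤ k.1 + k.2) a := by
    refine DFunLike.ext _ _ fun k => ?_
    simp only [add_apply, smul_apply, one_def, X, monomial_apply, restrict_apply, smul_eq_mul]
    obtain ⟨k₁, k₂⟩ := k
    by_cases h : 2 ≤ k₁ + k₂
    · have h0 : (k₁, k₂) ≠ (0, 0) := by rintro ⟨⟩; simp at h
      have h1 : (k₁, k₂) ≠ (1, 0) := by rintro ⟨⟩; simp at h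
      have h2 : (k₁, k₂) ≠ (0, 1) := by rintro ⟨⟩; simp at h
      simp only [unitExp, ← Prod.mk_zero_zero, h0, h1, h, if_true, if_false]
      simp [h2]
    · have : (k₁ = 0 ∧ k₂ = 0) ∨ (k₁ = 1 ∧ k₂ = 0) ∨ (k₁ = 0 ∧ k₂ = 1) := by omega
      rcases this with ⟨rfl, rfl⟩ | ⟨rfl, rfl⟩ | ⟨rfl, rfl⟩ <;>
        simp [unitExp, ← Prod.mk_zero_zero]
  conv_lhs => rw [this]
  simp only [map_add, map_smul, aeval_one hy, aeval_X hy, smul_eq_mul, mul_one]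

/-- The constant term is the value at `0`. Along a coordinate axis the terms of order at least two
are `O(t²)`, so division by `t` and `t → 0` kill the linear coefficients. -/
theorem lowCoeff_eq_zero {a : WienerAlgebra 𝕜} (ha : ∀ y : Fin 2 → 𝕜, ‖y‖ ≤ 1 → aeval y a = 0) :
    a 0 = 0 ∧ ∀ i, a (unitExp i) = 0 := by
  have hS : ∀ k, restrict (fun k => 2 ≤ k.1 + k.2) a k ≠ 0 → 2 ≤ k.1 + k.2 :=
    supportedIn_restrict _ _
  have h0 : a 0 = 0 := by
    have h₁ : ‖(0 : Fin 2 → 𝕜)‖ ≤ 1 := by simp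
    have h₂ := TameFamily.norm_aeval_le_sq hS h₁
    have h₃ := aeval_eq_linear_add_restrict h₁ a
    rw [ha _ h₁] at h₃
    have h₄ : aeval (0 : Fin 2 → 𝕜) (restrict (fun k => 2 ≤ k.1 + k.2) a) = 0 := by
      simpa using h₂
    simpa [h₄] using h₃.symm
  refine ⟨h0, fun i => ?_⟩
  have key : ∀ t : ℝ, 0 < t → t ≤ 1 → ‖a (unitExp i)‖ ≤ ‖a‖ * t := by
    intro t ht ht1
    have hn : ‖(Pi.single i (t : 𝕜) : Fin 2 → 𝕜)‖ = t := by
      rw [Pi.norm_single, RCLike.norm_ofReal, abs_of_pos ht]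
    have h₁ : ‖(Pi.single i (t : 𝕜) : Fin 2 → 𝕜)‖ ≤ 1 := hn.trans_le ht1
    have h₂ := TameFamily.norm_aeval_le_sq hS h₁
    have h₃ := aeval_eq_linear_add_restrict h₁ a
    rw [ha _ h₁, h0, zero_add] at h₃
    have h₄ : a (unitExp 0) * (Pi.single i (t : 𝕜) : Fin 2 → 𝕜) 0
        + a (unitExp 1) * (Pi.single i (t : 𝕜) : Fin 2 → 𝕜) 1 = a (unitExp i) * t := by
      fin_cases i <;> simp
    rw [h₄] at h₃
    rw [eq_neg_of_add_eq_zero_right h₃.symm, norm_neg, norm_mul, RCLike.norm_ofReal,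
      abs_of_pos ht, hn, pow_two, ← mul_assoc] at h₂
    exact (le_of_mul_le_mul_right h₂ ht).trans
      (mul_le_mul_of_nonneg_right (norm_restrict_le _ _) ht.le)
  have hlim : Tendsto (fun t : ℝ => ‖a‖ * t) (𝓝[>] 0) (𝓝 0) := by
    have : Tendsto (fun t : ℝ => ‖a‖ * t) (𝓝 0) (𝓝 (‖a‖ * 0)) :=
      (continuous_const.mul continuous_id).tendsto 0
    rw [mul_zero] at this
    exact this.mono_left nhdsWithin_le_nhds
  have : ‖a (unitExp i)‖ ≤ 0 := by
    refine ge_of_tendsto hlim ?_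
    filter_upwards [Ioc_mem_nhdsGT one_pos] with t ht using key t ht.1 ht.2
  exact norm_le_zero_iff.1 this

/-- A function that is analytic jointly in the parameter and the variables is a power series in the
variables, with coefficients that depend analytically on the parameter. -/
theorem exists_analytic_coefficients {F : E × (Fin 2 → 𝕜) → 𝕜} {lam0 : E}
    (hF : AnalyticAt 𝕜 F (lam0, 0)) : ∃ ρ₀ > 0, ∀ ρ : ℝ, 0 < ρ → ρ ≤ ρ₀ →
      ∃ c : E → WienerAlgebra 𝕜, AnalyticAt 𝕜 c lam0 ∧ ∀ᶠ lam in 𝓝 lam0,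
        ∀ x : Fin 2 → 𝕜, ‖x‖ ≤ ρ → F (lam, x) = aeval ((ρ : 𝕜)⁻¹ • x) (c lam) := by
  obtain ⟨p, r, hp⟩ := hF
  obtain ⟨r₁, hr₁0, hr₁⟩ := ENNReal.lt_iff_exists_nnreal_btwn.1 hp.r_pos
  rw [ENNReal.coe_pos] at hr₁0
  -- With these data the extended series at `(η, ρ)` is, formally, `F` at `(lam0 + η, ρ X)`: the
  -- parameter is multiplied by `1`, and the coordinates are replaced by the variables of the
  -- algebra.
  let A : Option (Fin 2) → (E × 𝕜) →L[𝕜] E × (Fin 2 → 𝕜) := fun o => o.elim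
    ((ContinuousLinearMap.fst 𝕜 E 𝕜).prod 0)
    fun i => ContinuousLinearMap.prod 0
      ((ContinuousLinearMap.single 𝕜 (fun _ : Fin 2 => 𝕜) i).comp (ContinuousLinearMap.snd 𝕜 E 𝕜))
  let w : Option (Fin 2) → WienerAlgebra 𝕜 := fun o => o.elim 1 (X 𝕜)
  have hA : ∀ o, ‖A o‖ ≤ 1 := by
    intro o
    refine ContinuousLinearMap.opNorm_le_bound _ zero_le_one fun u => ?_
    rw [one_mul]
    cases o with
    | none => simp [A, Prod.norm_def]
    | some i => simp [A, Prod.norm_def, Pi.norm_single]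
  have hw : ∀ o, ‖w o‖ ≤ 1 := by
    intro o
    cases o with
    | none => simp [w]
    | some i => simp [w, norm_X]
  obtain ⟨D, -, hD⟩ := p.norm_mul_pow_le_of_lt_radius (hr₁.trans_le hp.r_le)
  let Q := p.extendScalars A w
  -- The factor `3` is the cardinality of `Option (Fin 2)`.
  have hQ : ((r₁ / 3 : NNReal) : ENNReal) ≤ Q.radius := by
    refine Q.le_radius_of_bound D fun n => le_trans ?_ (hD n)
    have := p.norm_extendScalars_le hA hw n
    calc ‖Q n‖ * ((r₁ / 3 : NNReal) : ℝ) ^ n ≤ (3 ^ n * ‖p n‖) * ((r₁ / 3 : NNReal) : ℝ) ^ n := by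
          gcongr
          simpa using this
      _ = ‖p n‖ * r₁ ^ n := by
          push_cast
          rw [div_pow]
          field_simp
  have hr₂0 : 0 < r₁ / 3 := by positivity
  have hQs := (Q.hasFPowerSeriesOnBall ((ENNReal.coe_pos.2 hr₂0).trans_le hQ)).mono
    (ENNReal.coe_pos.2 hr₂0) hQ
  refine ⟨r₁ / 6, by positivity, fun ρ hρ hρle => ?_⟩
  have hρ3 : ρ < (r₁ / 3 : NNReal) := by
    have : (0 : ℝ) < r₁ := hr₁0
    push_cast
    linarith
  have hmem : ∀ η : E, ‖η‖ < (r₁ / 3 : NNReal) →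
      (η, (ρ : 𝕜)) ∈ Metric.eball (0 : E × 𝕜) (r₁ / 3 : NNReal) := by
    intro η hη
    rw [Metric.eball_coe, mem_ball_zero_iff, Prod.norm_def]
    refine max_lt hη ?_
    simpa [abs_of_pos hρ] using hρ3
  refine ⟨fun lam => Q.sum (lam - lam0, (ρ : 𝕜)), ?_, ?_⟩
  · refine AnalyticAt.fun_comp (g := Q.sum) (f := fun lam => (lam - lam0, (ρ : 𝕜))) ?_
      ((analyticAt_id.fun_sub analyticAt_const).prod analyticAt_const)
    exact hQs.analyticAt_of_mem (hmem _ (by simpa using hr₂0))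
  · have hev : ∀ᶠ lam in 𝓝 lam0, ‖lam - lam0‖ < (r₁ / 3 : NNReal) := by
      have : Tendsto (fun lam => ‖lam - lam0‖) (𝓝 lam0) (𝓝 0) := by
        simpa using ((continuous_id.sub continuous_const).norm.tendsto lam0 :
          Tendsto (fun lam => ‖lam - lam0‖) (𝓝 lam0) (𝓝 ‖lam0 - lam0‖))
      exact this.eventually (gt_mem_nhds (NNReal.coe_pos.2 hr₂0))
    filter_upwards [hev] with lam hlam x hx
    have hρ' : (ρ : 𝕜) ≠ 0 := RCLike.ofReal_ne_zero.2 hρ.ne'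
    have hy := TameFamily.norm_inv_smul_le hρ hx
    set y : Fin 2 → 𝕜 := (ρ : 𝕜)⁻¹ • x with hydef
    have h₁ := (hQs.hasSum (hmem _ hlam)).mapL (aeval y)
    rw [zero_add] at h₁
    have h₂ : HasSum (fun n => p n fun _ => (lam - lam0, x)) (F (lam, x)) := by
      have hm : (lam - lam0, x) ∈ Metric.eball (0 : E × (Fin 2 → 𝕜)) r := by
        refine Metric.eball_subset_eball hr₁.le ?_
        rw [Metric.eball_coe, mem_ball_zero_iff, Prod.norm_def]
        have h3 : ((r₁ / 3 : NNReal) : ℝ) ≤ r₁ := by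
          push_cast
          linarith [r₁.coe_nonneg]
        exact max_lt (hlam.trans_le h3) (hx.trans_lt (hρ3.trans_le h3))
      simpa using hp.hasSum hm
    refine h₂.unique (h₁.congr_fun fun n => ?_)
    rw [p.map_extendScalars A w (aeval y) (y := fun o => o.elim 1 y)]
    · congr 1
      funext j
      simp only [Fintype.sum_option, A, Option.elim]
      refine Prod.ext ?_ ?_
      · simp
      · funext i
        fin_cases i <;> simp [hydef] <;> field_simp
    · intro s
      have hprod : ∀ t : Finset (Fin n), aeval y (∏ j ∈ t, w (s j))
          = ∏ j ∈ t, ((s j).elim 1 y : 𝕜) := by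
        intro t
        induction t using Finset.cons_induction with
        | empty => simp [aeval_one hy]
        | cons j t hj ih =>
          rw [Finset.prod_cons, Finset.prod_cons, aeval_mul hy, ih]
          congr 1
          cases s j with
          | none => simp [w, aeval_one hy]
          | some i => simp [w, aeval_X hy]
      exact hprod _

end WienerAlgebra

namespace TameFamily

/-- A family that is given by power series with bounded coefficients is tame if its linear part is
diagonal. -/
theorem of_expansion {P : Prop} {μ : E → Fin 2 → 𝕜} {f : E → (Fin 2 → 𝕜) → Fin 2 → 𝕜} {lam0 : E}
    (hμ : ContinuousAt μ lam0) {ρ : ℝ} (hρ : 0 < ρ) {c : E → Fin 2 → WienerAlgebra 𝕜} {K : ℝ}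
    (hcP : P → AnalyticAt 𝕜 c lam0)
    (hc : ∀ᶠ lam in 𝓝 lam0, ‖c lam‖ ≤ K ∧
      (∀ i, c lam i 0 = 0 ∧ ∀ j, c lam i (unitExp j) = if i = j then ρ * μ lam i else 0) ∧
      ∀ x : Fin 2 → 𝕜, ‖x‖ ≤ ρ → ∀ i, f lam x i = aeval ((ρ : 𝕜)⁻¹ • x) (c lam i)) :
    TameFamily P {(1, 1, 1)} μ f lam0 := by
  have hρ' : (ρ : 𝕜) ≠ 0 := RCLike.ofReal_ne_zero.2 hρ.ne'
  refine ⟨hμ, fun hP => ?_, ρ, hρ, fun lam i => restrict (fun k => 2 ≤ k.1 + k.2) (c lam i), K,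
    fun hP => ?_, ?_⟩
  · refine analyticAt_pi_iff.2 fun i => ?_
    have h : AnalyticAt 𝕜 (fun lam => (ρ : 𝕜)⁻¹ • coeff (unitExp i) (c lam i)) lam0 :=
      analyticAt_const.fun_smul ((coeff (unitExp i)).map_analyticAt ((hcP hP).pi_apply i))
    refine h.congr ?_
    filter_upwards [hc] with lam ⟨_, h, _⟩
    simp [(h i).2, hρ']
  · exact analyticAt_pi_iff.2 fun i => (restrict _).map_analyticAt ((hcP hP).pi_apply i)
  · filter_upwards [hc] with lam ⟨h₁, h₂, h₃⟩
    refine ⟨?_, fun i => ?_, fun x hx i => ?_⟩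
    · exact (pi_norm_le_iff_of_nonneg ((norm_nonneg _).trans h₁)).2 fun i =>
        ((norm_restrict_le _ _).trans (norm_le_pi_norm _ i)).trans h₁
    · refine (supportedIn_restrict _ _).mono fun k hk => ?_
      rintro _ rfl
      fin_cases i <;> simp [weight, unitExp] <;> omega
    · rw [h₃ x hx i, aeval_eq_linear_add_restrict (norm_inv_smul_le hρ hx), (h₂ i).1,
        (h₂ i).2, (h₂ i).2]
      congr 1
      fin_cases i <;> simp <;> field_simp

end TameFamily

/-- The coefficients, after rescaling, of a uniform expansion. -/
theorem HasUniformExpansion.exists_wiener {E : Type*} [TopologicalSpace E]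
    {c : ℕ × ℕ → E → 𝕜 × 𝕜} {F : E → 𝕜 × 𝕜 → 𝕜 × 𝕜}
    {lam0 : E} (h : HasUniformExpansion c F lam0) : ∃ r > 0, ∃ K : ℝ, ∀ ρ : ℝ, 0 < ρ → ρ ≤ r →
      ∃ α : E → Fin 2 → WienerAlgebra 𝕜, ∀ᶠ lam in 𝓝 lam0, ‖α lam‖ ≤ K ∧
        (∀ i k, α lam i k = (ρ : 𝕜) ^ (k.1 + k.2) * ![(c k lam).1, (c k lam).2] i) ∧
        ∀ x : Fin 2 → 𝕜, ‖x‖ ≤ ρ → ∀ i,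
          ![(F lam (x 0, x 1)).1, (F lam (x 0, x 1)).2] i
            = aeval ((ρ : 𝕜)⁻¹ • x) (α lam i) := by
  classical
  obtain ⟨r, hr, M, hM, hc⟩ := h
  refine ⟨r, hr, ∑' k : ℕ × ℕ, M k * r ^ (k.1 + k.2), fun ρ hρ hρr => ?_⟩
  have hρ' : (ρ : 𝕜) ≠ 0 := RCLike.ofReal_ne_zero.2 hρ.ne'
  let a : E → Fin 2 → ℕ × ℕ → 𝕜 := fun lam i k =>
    (ρ : 𝕜) ^ (k.1 + k.2) * ![(c k lam).1, (c k lam).2] i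
  refine ⟨fun lam i => if h : Summable fun k => ‖a lam i k‖ then ofSummable (a lam i) h else 0, ?_⟩
  filter_upwards [hc] with lam ⟨h₁, h₂⟩
  have hle : ∀ i k, ‖a lam i k‖ ≤ M k * r ^ (k.1 + k.2) := by
    intro i k
    have hi : ‖![(c k lam).1, (c k lam).2] i‖ ≤ M k := by
      refine le_trans ?_ (h₁ k)
      fin_cases i
      · exact norm_fst_le _
      · exact norm_snd_le _
    simp only [a, norm_mul, norm_pow, RCLike.norm_ofReal, abs_of_pos hρ]
    rw [mul_comm]
    exact mul_le_mul hi (pow_le_pow_left₀ hρ.le hρr _) (by positivity) ((norm_nonneg _).trans hi)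
  have hs : ∀ i, Summable fun k => ‖a lam i k‖ := fun i =>
    Summable.of_nonneg_of_le (fun _ => norm_nonneg _) (hle i) hM
  simp only [hs, dif_pos]
  refine ⟨?_, fun i k => rfl, fun x hx i => ?_⟩
  · refine (pi_norm_le_iff_of_nonneg ?_).2 fun i => ?_
    · exact tsum_nonneg fun k => (norm_nonneg _).trans (hle 0 k)
    · rw [norm_eq_tsum]
      exact (hs i).tsum_le_tsum (hle i) hM
  · have hx' : ‖(x 0, x 1)‖ ≤ r :=
      (norm_prod_le_iff.2 ⟨norm_le_pi_norm x 0, norm_le_pi_norm x 1⟩).trans (hx.trans hρr)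
    have hsum := h₂ _ hx'
    have hi : HasSum (fun k : ℕ × ℕ => (x 0 ^ k.1 * x 1 ^ k.2) * ![(c k lam).1, (c k lam).2] i)
        (![(F lam (x 0, x 1)).1, (F lam (x 0, x 1)).2] i) := by
      fin_cases i
      · exact hsum.mapL (ContinuousLinearMap.fst 𝕜 𝕜 𝕜)
      · exact hsum.mapL (ContinuousLinearMap.snd 𝕜 𝕜 𝕜)
    refine hi.unique ((hasSum_aeval (TameFamily.norm_inv_smul_le hρ hx) _).congr_fun fun k => ?_)
    simp only [ofSummable_apply, a, powProd, Pi.smul_apply, smul_eq_mul, mul_pow, pow_add, inv_pow]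
    field_simp

/-- A family with diagonal linear part is tame. The coefficients depend analytically on the
parameter if the family does. -/
theorem IsDiagonalFamily.tameFamily {f : E → 𝕜 × 𝕜 → 𝕜 × 𝕜} {μ₁ μ₂ : E → 𝕜} {lam0 : E}
    (hf : IsDiagonalFamily f μ₁ μ₂ lam0) (hμ₁ : ContinuousAt μ₁ lam0)
    (hμ₂ : ContinuousAt μ₂ lam0) :
    TameFamily (DependsAnalytically f lam0) {(1, 1, 1)} (fun lam => ![μ₁ lam, μ₂ lam])
      (fun lam x => ![(f lam (x 0, x 1)).1, (f lam (x 0, x 1)).2]) lam0 := by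
  obtain ⟨a, ha, hlow⟩ := hf
  have hμ : ContinuousAt (fun lam => ![μ₁ lam, μ₂ lam]) lam0 := by
    refine continuousAt_pi.2 fun i => ?_
    fin_cases i
    · exact hμ₁
    · exact hμ₂
  obtain ⟨r, hr, K, hK⟩ := ha.exists_wiener
  have hlow' : ∀ {ρ : ℝ} {α : Fin 2 → WienerAlgebra 𝕜} {lam : E},
      (a (0, 0) lam = 0 ∧ a (1, 0) lam = (μ₁ lam, 0) ∧ a (0, 1) lam = (0, μ₂ lam)) →
      (∀ i k, α i k = (ρ : 𝕜) ^ (k.1 + k.2) * ![(a k lam).1, (a k lam).2] i) →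
      ∀ i, α i 0 = 0 ∧ ∀ j, α i (unitExp j) = if i = j then ρ * ![μ₁ lam, μ₂ lam] i else 0 := by
    rintro ρ α lam ⟨h₀, h₁, h₂⟩ hα i
    refine ⟨?_, fun j => ?_⟩
    · rw [hα, ← Prod.mk_zero_zero, h₀]
      fin_cases i <;> simp
    · rw [hα]
      fin_cases i <;> fin_cases j <;> simp [unitExp, h₁, h₂]
  -- The coefficients in the given expansion need not be known to be analytic in `lam`. If `f` is
  -- jointly analytic they are replaced by those of its joint power series.
  by_cases hP : DependsAnalytically f lam0
  · have hL : AnalyticAt 𝕜 (fun z : E × (Fin 2 → 𝕜) => f z.1 (z.2 0, z.2 1)) (lam0, 0) := by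
      refine AnalyticAt.fun_comp (g := fun z : E × (𝕜 × 𝕜) => f z.1 z.2)
        (f := fun z : E × (Fin 2 → 𝕜) => (z.1, (z.2 0, z.2 1))) hP ?_
      exact analyticAt_fst.prod ((analyticAt_snd.pi_apply 0).prod (analyticAt_snd.pi_apply 1))
    have hF : ∀ i, AnalyticAt 𝕜 (fun z : E × (Fin 2 → 𝕜) =>
        ![(f z.1 (z.2 0, z.2 1)).1, (f z.1 (z.2 0, z.2 1)).2] i) (lam0, 0) := by
      intro i
      fin_cases i
      · exact (ContinuousLinearMap.fst 𝕜 𝕜 𝕜).map_analyticAt hL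
      · exact (ContinuousLinearMap.snd 𝕜 𝕜 𝕜).map_analyticAt hL
    choose ρ₀ hρ₀ hres using fun i => exists_analytic_coefficients (hF i)
    obtain ⟨ρ, hρ, hρr, hρ0⟩ : ∃ ρ : ℝ, 0 < ρ ∧ ρ ≤ r ∧ ∀ i, ρ ≤ ρ₀ i := by
      refine ⟨min r (min (ρ₀ 0) (ρ₀ 1)), lt_min hr (lt_min (hρ₀ 0) (hρ₀ 1)), min_le_left _ _,
        fun i => ?_⟩
      fin_cases i
      · exact (min_le_right _ _).trans (min_le_left _ _)
      · exact (min_le_right _ _).trans (min_le_right _ _)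
    have hρ' : (ρ : 𝕜) ≠ 0 := RCLike.ofReal_ne_zero.2 hρ.ne'
    choose c hcA hc using fun i => hres i ρ hρ (hρ0 i)
    obtain ⟨α, hα⟩ := hK ρ hρ hρr
    have hcA' : AnalyticAt 𝕜 (fun lam i => c i lam) lam0 := analyticAt_pi_iff.2 hcA
    refine TameFamily.of_expansion hμ hρ (c := fun lam i => c i lam)
      (K := ‖fun i => c i lam0‖ + 1) (fun _ => hcA') ?_
    filter_upwards [hcA'.continuousAt.norm.eventually (eventually_le_nhds (lt_add_one _)), hα, hlow,
      eventually_all.2 hc] with lam h₁ ⟨_, h₂, h₃⟩ h₄ h₅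
    refine ⟨h₁, fun i => ?_, fun x hx i => h₅ i x hx⟩
    -- Agreement in degrees zero and one is enough: it shows that the new coefficients have the same
    -- diagonal linear part.
    have heq : ∀ y : Fin 2 → 𝕜, ‖y‖ ≤ 1 → aeval y (c i lam - α lam i) = 0 := by
      intro y hy
      have hx : ‖(ρ : 𝕜) • y‖ ≤ ρ := by
        rw [norm_smul, RCLike.norm_ofReal, abs_of_pos hρ]
        exact mul_le_of_le_one_right hρ.le hy
      have h := (h₅ i _ hx).symm.trans (h₃ _ hx i)
      rw [smul_smul, inv_mul_cancel₀ hρ', one_smul] at h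
      rw [map_sub, h, sub_self]
    obtain ⟨hz, hz'⟩ := lowCoeff_eq_zero heq
    obtain ⟨hα₀, hα₁⟩ := hlow' h₄ h₂ i
    exact ⟨(sub_eq_zero.1 hz).trans hα₀, fun j => (sub_eq_zero.1 (hz' j)).trans (hα₁ j)⟩
  · obtain ⟨α, hα⟩ := hK r hr le_rfl
    refine TameFamily.of_expansion hμ hr (c := α) (K := K) (fun h => absurd h hP) ?_
    filter_upwards [hα, hlow] with lam ⟨h₁, h₂, h₃⟩ h₄
    exact ⟨h₁, hlow' h₄ h₂, h₃⟩

/-! ### Conclusion -/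

theorem vec_eta {α : Type*} (v : Fin 2 → α) : ![v 0, v 1] = v := by
  funext i
  fin_cases i <;> rfl

theorem tendsto_vec {X : Type*} [TopologicalSpace X] (x₀ : X) :
    Tendsto (fun z : X × (𝕜 × 𝕜) => (z.1, ![z.2.1, z.2.2])) (𝓝 (x₀, 0)) (𝓝 (x₀, 0)) := by
  have h : Continuous fun z : X × (𝕜 × 𝕜) => (z.1, ![z.2.1, z.2.2]) := by
    refine continuous_fst.prodMk (continuous_pi fun i => ?_)
    fin_cases i
    · exact continuous_snd.fst
    · exact continuous_snd.snd
  have h₀ := h.tendsto (x₀, 0)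
  rwa [show (![((x₀, 0) : X × (𝕜 × 𝕜)).2.1, ((x₀, 0) : X × (𝕜 × 𝕜)).2.2] : Fin 2 → 𝕜) = 0 by
    simp] at h₀

theorem pow_mul_pow_lt_one_of_log {A B R : ℝ} (hA : 0 < A) (hB : 0 < B)
    (h : Real.log A = -R * Real.log B) {m n : ℕ} (hmn : (n - R * m) * Real.log B < 0) :
    A ^ m * B ^ n < 1 := by
  refine (Real.log_neg_iff (by positivity)).1 ?_
  rw [Real.log_mul (by positivity) (by positivity), Real.log_pow, Real.log_pow, h]
  linarith

namespace TameFamily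

variable {P : Prop} {C : Set (ℤ × ℤ × ℕ)} {μ : E → Fin 2 → 𝕜}
  {f : E → (Fin 2 → 𝕜) → Fin 2 → 𝕜} {lam0 : E}

theorem toProd_zero (hf : TameFamily P C μ f lam0) (hC : (1, 1, 1) ∈ C) :
    ∀ᶠ lam in 𝓝 lam0, toProd f lam 0 = 0 := by
  obtain ⟨-, -, r, hr, a, K, -, ha⟩ := hf
  filter_upwards [ha] with lam ⟨_, h₂, h₃⟩
  have h : ∀ i, f lam 0 i = 0 := by
    intro i
    have h₀ := norm_aeval_le_sq (fun k hk => two_le_of_allowed hC (h₂ i k hk))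
      (show ‖(0 : Fin 2 → 𝕜)‖ ≤ 1 by simp)
    rw [h₃ 0 (by simpa using hr.le) i, smul_zero, Pi.zero_apply, mul_zero, zero_add]
    simpa using h₀
  have h0 : (![0, 0] : Fin 2 → 𝕜) = 0 := by simp
  simp [toProd, h0, h]

/-- The conditions on the exponents that the two convergents define can be achieved. -/
theorem exists_normalForm_of_log (hf : TameFamily P {(1, 1, 1)} μ f lam0)
    (hμ0 : ∀ i, μ lam0 i ≠ 0) (hhyp : ‖μ lam0 1‖ ≠ 1) {R : ℝ} (hR : 0 < R)
    (hlog : Real.log ‖μ lam0 0‖ = -R * Real.log ‖μ lam0 1‖) {p q p' q' : ℕ}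
    (hdet : p * q' = q * p' + 1) (hq : (q : ℝ) < R * p) (hq' : R * p' < q') :
    ∃ (C : Set (ℤ × ℤ × ℕ)) (h hinv g : E → (Fin 2 → 𝕜) → Fin 2 → 𝕜),
      (1, 1, 1) ∈ C ∧ (-(q : ℤ), (p : ℤ), 0) ∈ C ∧ ((q' : ℤ), -(p' : ℤ), 0) ∈ C ∧
      TameFamily P {(1, 1, 1)} (fun _ _ => 1) h lam0 ∧
      TameFamily P {(1, 1, 1)} (fun _ _ => 1) hinv lam0 ∧ TameFamily P C μ g lam0 ∧
      (∀ᶠ z : E × (Fin 2 → 𝕜) in 𝓝 (lam0, 0),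
        hinv z.1 (h z.1 z.2) = z.2 ∧ h z.1 (hinv z.1 z.2) = z.2) ∧
      ∀ᶠ z : E × (Fin 2 → 𝕜) in 𝓝 (lam0, 0), g z.1 z.2 = hinv z.1 (f z.1 (h z.1 z.2)) := by
  have hp1 : 1 ≤ p := Nat.one_le_iff_ne_zero.2 (by rintro rfl; simp at hdet)
  have hq1 : 1 ≤ q' := Nat.one_le_iff_ne_zero.2 (by rintro rfl; simp at hdet)
  have hA : 0 < ‖μ lam0 0‖ := norm_pos_iff.2 (hμ0 0)
  have hB : 0 < ‖μ lam0 1‖ := norm_pos_iff.2 (hμ0 1)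
  have hlog' : Real.log ‖(μ lam0 0)⁻¹‖ = -R * Real.log ‖(μ lam0 1)⁻¹‖ := by
    simp only [norm_inv, Real.log_inv, hlog]
    ring
  have hA' : 0 < ‖(μ lam0 0)⁻¹‖ := norm_pos_iff.2 (inv_ne_zero (hμ0 0))
  have hB' : 0 < ‖(μ lam0 1)⁻¹‖ := norm_pos_iff.2 (inv_ne_zero (hμ0 1))
  have hlogB' : Real.log ‖(μ lam0 1)⁻¹‖ = -Real.log ‖μ lam0 1‖ := by
    rw [norm_inv, Real.log_inv]
  have h1 : ((1, 1, 1) : ℤ × ℤ × ℕ) ∈ ({(1, 1, 1)} : Set (ℤ × ℤ × ℕ)) := rfl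
  -- Since `R > 0`, exactly one eigenvalue is expanding. This decides which inequality is treated
  -- with the map and which with the inverse.
  rcases lt_or_gt_of_ne hhyp with hlt | hgt
  · have hneg : Real.log ‖μ lam0 1‖ < 0 := Real.log_neg hB hlt
    have hgtA : 1 < ‖μ lam0 0‖ := (Real.log_pos_iff hA.le).1 (by rw [hlog]; nlinarith)
    have hgtB : 1 < ‖(μ lam0 1)⁻¹‖ := by rw [norm_inv]; exact (one_lt_inv₀ hB).2 hlt
    obtain ⟨h, hinv, g, hh, hhinv, hg, H⟩ := hf.exists_normalForm h1 hμ0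
      (spectralGap_upper h1 hq1 (hμ0 1) hgtA
        (pow_mul_pow_lt_one_of_log (m := p') hA hB hlog (by nlinarith)))
      (spectralGap_lower (q := q) (Set.mem_insert_of_mem _ h1) hp1 (inv_ne_zero (hμ0 0)) hgtB
        (pow_mul_pow_lt_one_of_log hA' hB' hlog' (by rw [hlogB']; nlinarith)))
    exact ⟨_, h, hinv, g, by simp, by simp, by simp, hh, hhinv, hg, H⟩
  · have hpos : 0 < Real.log ‖μ lam0 1‖ := Real.log_pos hgt
    have hgtA : 1 < ‖(μ lam0 0)⁻¹‖ :=
      (Real.log_pos_iff hA'.le).1 (by rw [hlog', hlogB']; nlinarith)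
    obtain ⟨h, hinv, g, hh, hhinv, hg, H⟩ := hf.exists_normalForm h1 hμ0
      (spectralGap_lower h1 hp1 (hμ0 0) hgt
        (pow_mul_pow_lt_one_of_log (n := q) hA hB hlog (by nlinarith)))
      (spectralGap_upper (p := p') (Set.mem_insert_of_mem _ h1) hq1 (inv_ne_zero (hμ0 1)) hgtA
        (pow_mul_pow_lt_one_of_log hA' hB' hlog' (by rw [hlogB']; nlinarith)))
    exact ⟨_, h, hinv, g, by simp, by simp, by simp, hh, hhinv, hg, H⟩

end TameFamily

end

/-- In Mathlib the convergents are indexed from `0`: the convergent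
`[a₁ a₂ … aₙ] = qₙ / pₙ` of `R` has numerator `(GenContFract.of R).nums (n - 1)` and denominator
`(GenContFract.of R).dens (n - 1)`. Below, `q / p` is the one with `n = 2 k + 1` and `q' / p'` the
one with `n = 2 k + 2`; the function `b j i` is the one with upper index `j + 1` in the component
`i + 1`. -/
theorem theorem2 {𝕜 E : Type*} [RCLike 𝕜] [NormedAddCommGroup E] [NormedSpace 𝕜 E]
    (lam0 : E) (f : E → 𝕜 × 𝕜 → 𝕜 × 𝕜) (μ₁ μ₂ : E → 𝕜)
    (hf : IsDiagonalFamily f μ₁ μ₂ lam0)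
    (hμ₁ : ContinuousAt μ₁ lam0) (hμ₂ : ContinuousAt μ₂ lam0)
    (hμ₁0 : μ₁ lam0 ≠ 0) (hμ₂0 : μ₂ lam0 ≠ 0)
    (hhyp₁ : ‖μ₁ lam0‖ ≠ 1) (hhyp₂ : ‖μ₂ lam0‖ ≠ 1)
    (R : ℝ) (hR : Real.log ‖μ₁ lam0‖ / Real.log ‖μ₂ lam0‖ = -R)
    (hRpos : 0 < R) (hRirr : Irrational R)
    (k p q p' q' : ℕ)
    (hq : (q : ℝ) = (GenContFract.of R).nums (2 * k))
    (hp : (p : ℝ) = (GenContFract.of R).dens (2 * k))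
    (hq' : (q' : ℝ) = (GenContFract.of R).nums (2 * k + 1))
    (hp' : (p' : ℝ) = (GenContFract.of R).dens (2 * k + 1)) :
    ∃ (h hinv g : E → 𝕜 × 𝕜 → 𝕜 × 𝕜) (b : Fin 2 → Fin 2 → E → 𝕜 × 𝕜 → 𝕜),
      IsAnalyticChange h hinv lam0 ∧
      (∀ᶠ z : E × (𝕜 × 𝕜) in 𝓝 (lam0, 0), g z.1 z.2 = hinv z.1 (f z.1 (h z.1 z.2))) ∧
      (∀ᶠ z : E × (𝕜 × 𝕜) in 𝓝 (lam0, 0), ∀ u u' : 𝕜,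
        u = z.2.1 ^ p * z.2.2 ^ q → u' = z.2.1 ^ p' * z.2.2 ^ q' →
        g z.1 z.2 =
          (z.2.1 * (μ₁ z.1 + u * b 0 0 z.1 (u, u') + u' * b 1 0 z.1 (u, u')),
           z.2.2 * (μ₂ z.1 + u * b 0 1 z.1 (u, u') + u' * b 1 1 z.1 (u, u')))) ∧
      (∀ j i, IsAnalyticFamily (b j i) lam0) ∧
      (DependsAnalytically f lam0 →
        DependsAnalytically h lam0 ∧ DependsAnalytically hinv lam0 ∧
        DependsAnalytically g lam0 ∧ ∀ j i, DependsAnalytically (b j i) lam0) := by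
  have htame := hf.tameFamily hμ₁ hμ₂
  obtain ⟨hdet, hlt, hlt'⟩ := hRirr.consecutive_convs hq hp hq' hp'
  have hB : Real.log ‖μ₂ lam0‖ ≠ 0 := by
    have := norm_pos_iff.2 hμ₂0
    exact Real.log_ne_zero_of_pos_of_ne_one this hhyp₂
  obtain ⟨C, h, hinv, g, hC, hv, hw, hh, hhinv, hg, hinvs, hconj⟩ :=
    htame.exists_normalForm_of_log (fun i => by fin_cases i <;> assumption) (by simpa using hhyp₂)
      hRpos (by simpa using (div_eq_iff hB).1 hR) hdet hlt hlt'
  choose b b' hb hb' hform using fun i => hg.exists_coneForm hC hdet hv hw i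
  refine ⟨TameFamily.toProd h, TameFamily.toProd hinv, TameFamily.toProd g, ![b, b'],
    ⟨hh.isAnalyticFamily_toProd, hhinv.isAnalyticFamily_toProd,
      (hh.toProd_zero rfl).and (hhinv.toProd_zero rfl), ?_⟩, ?_, ?_, ?_, fun hP =>
      ⟨hh.dependsAnalytically_toProd hP, hhinv.dependsAnalytically_toProd hP,
        hg.dependsAnalytically_toProd hP, ?_⟩⟩
  · filter_upwards [(tendsto_vec lam0).eventually hinvs] with z hz
    simp only [TameFamily.toProd, vec_eta]
    simp [hz.1, hz.2]
  · filter_upwards [(tendsto_vec lam0).eventually hconj] with z hz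
    simp only [TameFamily.toProd, hz]
  · filter_upwards [(tendsto_vec lam0).eventually (eventually_all.2 hform)] with z hz u u' hu hu'
    exact Prod.ext (hz 0 u u' hu hu') (hz 1 u u' hu hu')
  · intro j i
    fin_cases j
    · exact (hb i).isAnalyticFamily
    · exact (hb' i).isAnalyticFamily
  · intro j i
    fin_cases j
    · exact (hb i).dependsAnalytically hP
    · exact (hb' i).dependsAnalytically hP
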